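/- **Setting.** Let $\psi=(\theta,\eta)\in\Psi\subseteq\mathbb R^{k}\times\mathbb R^{h}$, $\Psi$ open, $k\ge1$, with parameter of interest $\theta$. A complete dataset $X$ has $n$ independent rows in $\mathbb R^p$ with density $f(X\mid\psi)$, a product of row densities with respect to a product reference measure. For each $n$, $X$ is drawn from $f(\cdot\mid\psi^\star)$, $\psi^\star=\psi^\star_n$, only a part $X_{\rm obs}$ of its entries is observed, and $X^1,\dots,X^m$ are completed datasets that agree with $X$ on the observed entries. For a non-empty multiset $S$ from $\{1,\dots,m\}$, $X^S$ is the dataset with $n|S|$ rows obtained by stacking $X^\ell$, $\ell\in S$. Let $\hat\psi=(\hat\theta,\hat\eta)$ and $\hat\psi_0$ be the MLEs of $\psi$ over $\Psi$ and over $\{\psi\in\Psi:\theta=\theta_0\}$, $u$ and $I(\cdot\mid X)$ the score and minus the Hessian of the log-likelihood $\log f(X\mid\cdot)$, $\hat V(X)$ a variance estimator of $\hat\theta$, and let $d(X)$ be any one of the Wald statistic $(\hat\theta-\theta_0)^{\mathsf T}\hat V^{-1}(\hat\theta-\theta_0)$, the likelihood-ratio statistic $2\log\{f(X\mid\hat\psi)/f(X\mid\hat\psi_0)\}$,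 the score statistic $u(\hat\psi_0)^{\mathsf T}I(\hat\psi_0)^{-1}u(\hat\psi_0)$. Put $\hat d^S=d(X^S)/|S|$ and, for non-empty $S_1\ne S_2\subseteq\{1,\dots,m\}$, with $\oplus$ the multiset sum, $$\hat T_{S_1,S_2}=\frac{|S_1|+|S_2|}{|S_1|+|S_2|-2|S_1\cap S_2|}\bigl\{|S_1|\hat d^{S_1}+|S_2|\hat d^{S_2}-(|S_1|+|S_2|)\hat d^{S_1\oplus S_2}\bigr\}.$$ The jackknife rule takes the $m$ pairs $(\{\ell\},\{-\ell\})$, where $\{-\ell\}=\{1,\dots,m\}\setminus\{\ell\}$; put $\hat t_\tau=\frac1m\sum_{\ell=1}^m\hat T_{\{\ell\},\{-\ell\}}^{\tau}$ and $$\hat\sigma_r^2=\frac{\{k(m-1)+2\}\hat t_2-(m-1)(k+2)\hat t_1^2}{2k^2(m-2)}.$$ **Information.** Let $J_{\rm com},J_{\rm mis}$ be the limits of $n^{-1}$ times the expectations at $\psi^\star$ of minus the Hessians of $\log f(X\mid\psi)$ and of $\log f(X\mid X_{\rm obs},\psi)=\log\{f(X\mid\psi)/f(X_{\rm obs}\mid\psi)\}$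 (these Hessians are integrable and the limits exist), and $J_{\rm obs}=J_{\rm com}-J_{\rm mis}$; $J_{\rm com},J_{\rm obs}$ are positive definite. Let $V_1,T_1$ be the $\theta\theta$-blocks of $J_{\rm com}^{-1},J_{\rm obs}^{-1}$, and $B_1=T_1-V_1$, positive semidefinite. The Fisher informations of $\theta$ are $i_{\rm com}=V_1^{-1}$, $i_{\rm obs}=T_1^{-1}$, $i_{\rm mis}=i_{\rm com}-i_{\rm obs}$; $f_1,\dots,f_k$ are the eigenvalues of $i_{\rm mis}i_{\rm com}^{-1}$ and $r_j=f_j/(1-f_j)$ the odds of missing information. Write $R_\tau=\sum_j r_j^\tau$, $\mu_r=R_1/k$, $\sigma_r^2=\frac1k\sum_j(r_j-\mu_r)^2$. **Assumptions** (as $n\to\infty$, $m$ fixed). 1. $\sqrt n(\hat\theta_{\rm obs}-\theta^\star)\Rightarrow N_k(0,T_1)$ for the observed-data MLE $\hat\theta_{\rm obs}$. 2. The pairs $(\hat\theta(X^\ell),\hat V(X^\ell))$, $\ell=1,\dots,m$, are conditionally independent given $X_{\rm obs}$; for each $\ell$, given $X_{\rm obs}$, $\sqrt n(\hat\theta(X^\ell)-\hat\theta_{\rm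 obs})\Rightarrow N_k(0,B_1)$ (weak convergence of conditional laws, in probability), and $T^{-1}(\hat V(X^\ell)-V)\to0$ in probability, where $V$ and $T$ are the $\theta\theta$-blocks of the inverses of the $n$-sample complete-data and observed-data informations at $\psi^\star$. 3. For all non-empty $S_1\neq S_2\subseteq\{1,\dots,m\}$, $\{\hat T_{S_1,S_2}^{4}(n):n\ge1\}$ is uniformly integrable: $\lim_{C\to\infty}\sup_n E[\hat T_{S_1,S_2}^4\mathbf 1\{|\hat T_{S_1,S_2}|>C\}]=0$. 4. (Local alternatives) $\sqrt nA(\theta^\star-\theta_0)\to\delta$ for some invertible $A$ and some $\delta\in\mathbb R^k$. 5. (Likelihood regularity) $\psi^\star_n$ converges in $\Psi$. For each $\ell$: almost surely $f(X^\ell\mid\cdot)$ is positive and $C^2$ on $\Psi$; $n^{-1/2}u(\psi^\star\mid X^\ell)$ is bounded in probability; for all $\varepsilon,\eta>0$ there is $\rho>0$ such that, for all large $n$, with probability at least $1-\eta$ every entry of $n^{-1}I(\psi\mid X^\ell)-J_{\rm com}$ is at most $\varepsilon$ in absolute value for all $\psi\in\Psi$ with $\|\psi-\psi^\star\|<\rho$;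 and for every $\rho>0$ there is $c>0$ such that, with probability tending to one, $\log f(X^\ell\mid\psi)\le\log f(X^\ell\mid\psi^\star)-cn$ for all $\psi\in\Psi$ with $\|\psi-\psi^\star\|\ge\rho$. If the Wald statistic is used, $\hat V$ is to first order the inverse observed information: $n\{\hat V(X^S)-[I(\hat\psi(X^S)\mid X^S)^{-1}]_{\theta\theta}\}\to0$ in probability for every non-empty multiset $S$. **Corollary.** Let $m\ge3$ be fixed and use the jackknife rule. Then $\hat\sigma^2_r$ is square integrable for every $n\ge1$, and as $n\to\infty$: (1) $E(\hat\sigma_r^2)\to\sigma_r^2$; (2) $\displaystyle \operatorname{Var}(\hat\sigma_r^2)\to\frac{2(6k^2R_4-8kR_3R_1+k^2R_2^2+4R_1^2R_2)}{k^4m}+I_m,$ where $I_m$ depends only on $m,k,r_1,\dots,r_k$ and $I_m=o(1/m)$ as $m\to\infty$. More precisely, for every $m\ge3$ the limiting variance in (2) equals $$\frac{2}{k^4(m-1)^3(m-2)}\Bigl[2\{(m-1)^2(3m-7)k^2-4(m-1)k-4\}R_4-8(m-1)^2(m-2)k\,R_3R_1+(m-2)\{(m-1)^2k^2+4(m-1)k+4m\}R_2^2+4(m-1)^2(m-2)R_1^2R_2\Bigr].$$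 -/

import Mathlib

open MeasureTheory ProbabilityTheory Filter Topology
open scoped ENNReal Matrix

noncomputable section

namespace StackedMI

/-! ### Parameters, datasets, likelihoods -/

/-- Full parameter `ψ = (θ, η)`: parameter of interest `θ` (first `k` coordinates), nuisance `η`. -/
abbrev Par (k h : ℕ) := Fin k ⊕ Fin h → ℝ

/-- The sub-vector `θ` of `ψ`. -/
def theta {k h : ℕ} (ψ : Par k h) : Fin k → ℝ := fun j => ψ (Sum.inl j)

/-- An `n × p` dataset (rows are units). -/
abbrev Dataset (n p : ℕ) := Fin n → Fin p → ℝ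

/-- An observation pattern: `true` means that the entry is observed. -/
abbrev Pattern (n p : ℕ) := Fin n → Fin p → Bool

/-- A parametric model for independent units: `dens i · ψ` is the density of the row of unit `i`
with respect to a product reference measure on `ℝ^p` (Lebesgue, counting, mixed, ...). -/
structure Model (p k h : ℕ) where
  ref : Fin p → Measure ℝ
  sigmaFinite_ref : ∀ j, SigmaFinite (ref j)
  Psi : Set (Par k h)
  isOpen_Psi : IsOpen Psi
  dens : ℕ → (Fin p → ℝ) → Par k h → ℝ
  dens_nonneg : ∀ i x, ∀ ψ ∈ Psi, 0 ≤ dens i x ψ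
  measurable_dens : ∀ i, ∀ ψ ∈ Psi, Measurable fun x => dens i x ψ
  lintegral_dens : ∀ i, ∀ ψ ∈ Psi, ∫⁻ x, ENNReal.ofReal (dens i x ψ) ∂Measure.pi ref = 1

section Likelihood

variable {p k h m n : ℕ}

/-- Likelihood `f(D ∣ ψ)` of a stacked dataset `D`, given as the list of its `n`-row blocks
(so `D` has `n * D.length` rows). -/
def Model.lik (M : Model p k h) (D : List (Dataset n p)) (ψ : Par k h) : ℝ :=
  (D.map fun x => ∏ i : Fin n, M.dens i (x i) ψ).prod

/-- Observed-data density of a row: the missing coordinates are integrated out. -/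
def Model.obsDens (M : Model p k h) (i : ℕ) (o : Fin p → Bool) (x : Fin p → ℝ) (ψ : Par k h) : ℝ :=
  (lmarginal M.ref (Finset.univ.filter fun j => o j = false)
    (fun y => ENNReal.ofReal (M.dens i y ψ)) x).toReal

/-- Observed-data likelihood `f(X_obs ∣ ψ)`. -/
def Model.obsLik (M : Model p k h) (o : Pattern n p) (x : Dataset n p) (ψ : Par k h) : ℝ :=
  ∏ i : Fin n, M.obsDens i (o i) (x i) ψ

/-- Gradient of `L` as a vector of partial derivatives. -/
def grad (L : Par k h → ℝ) (ψ : Par k h) : Par k h :=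
  fun a => fderiv ℝ L ψ (Pi.single a 1)

/-- Negative Hessian matrix `- ∂² L / ∂ψ ∂ψᵀ`. -/
def negHess (L : Par k h → ℝ) (ψ : Par k h) : Matrix (Fin k ⊕ Fin h) (Fin k ⊕ Fin h) ℝ :=
  Matrix.of fun a b => - fderiv ℝ (fun φ => grad L φ b) ψ (Pi.single a 1)

/-- Score function `u(ψ ∣ D)`. -/
def Model.score (M : Model p k h) (D : List (Dataset n p)) (ψ : Par k h) : Par k h :=
  grad (fun φ => Real.log (M.lik D φ)) ψ

/-- Information `I(ψ ∣ D) = - ∂² log f(D ∣ ψ) / ∂ψ ∂ψᵀ`. -/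
def Model.info (M : Model p k h) (D : List (Dataset n p)) (ψ : Par k h) :
    Matrix (Fin k ⊕ Fin h) (Fin k ⊕ Fin h) ℝ :=
  negHess (fun φ => Real.log (M.lik D φ)) ψ

/-- `- ∂² log f(X ∣ X_obs, ψ) / ∂ψ ∂ψᵀ`, where `f(X ∣ X_obs, ψ) = f(X ∣ ψ) / f(X_obs ∣ ψ)`. -/
def Model.misInfo (M : Model p k h) (o : Pattern n p) (x : Dataset n p) (ψ : Par k h) :
    Matrix (Fin k ⊕ Fin h) (Fin k ⊕ Fin h) ℝ :=
  negHess (fun φ => Real.log (M.lik [x] φ / M.obsLik o x φ)) ψ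

/-- `ψ` maximizes the likelihood `L` over the parameter set `A`. -/
def IsMLE (L : Par k h → ℝ) (A : Set (Par k h)) (ψ : Par k h) : Prop :=
  ψ ∈ A ∧ IsMaxOn L A ψ

/-- Parameters in `Ψ` that satisfy the null hypothesis `θ = θ₀`. -/
def Model.nullSet (M : Model p k h) (θ₀ : Fin k → ℝ) : Set (Par k h) :=
  {ψ | ψ ∈ M.Psi ∧ theta ψ = θ₀}

/-- The observed part of a dataset (missing entries are overwritten by `0`). -/
def mask (o : Pattern n p) (x : Dataset n p) : Dataset n p :=
  fun i j => if o i j = true then x i j else 0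

/-- The stacked dataset `X^S` for a multiset `S` of indices of imputed datasets. -/
def stack (X : Fin m → Dataset n p) (S : Multiset (Fin m)) : List (Dataset n p) :=
  S.sort.map X

/-- Variance matrix of `θ` that belongs to an information matrix `J` of `ψ`: the `θ`-block of
`J⁻¹` (simply `J⁻¹` if there are no nuisance parameters). -/
def thetaVar (J : Matrix (Fin k ⊕ Fin h) (Fin k ⊕ Fin h) ℝ) : Matrix (Fin k) (Fin k) ℝ :=
  J⁻¹.toBlocks₁₁

/-- Fisher information of `θ`: the inverse of `thetaVar J` (simply `J` without nuisance
parameters). -/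
def thetaInfo (J : Matrix (Fin k ⊕ Fin h) (Fin k ⊕ Fin h) ℝ) : Matrix (Fin k) (Fin k) ℝ :=
  (thetaVar J)⁻¹

end Likelihood

/-! ### The multiple imputation problem -/

/-- A multiple imputation problem with `m` imputations: for each sample size `n`, a probability
space carrying the complete data, the observation pattern and the `m` imputed datasets, together
with the estimators used by the analyst. The estimators are functions of the dataset only. -/
structure MIProblem (p k h m : ℕ) where
  model : Model p k h
  /-- null value of `θ` -/
  theta0 : Fin k → ℝ
  /-- true value of `ψ` at sample size `n` (local alternatives are allowed) -/
  psiStar : ℕ → Par k h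
  psiStar_mem : ∀ n, psiStar n ∈ model.Psi
  Ω : ℕ → Type*
  mΩ : ∀ n, MeasurableSpace (Ω n)
  borelΩ : ∀ n, StandardBorelSpace (Ω n)
  P : ∀ n, Measure (Ω n)
  probP : ∀ n, IsProbabilityMeasure (P n)
  /-- complete data -/
  X : ∀ n, Ω n → Dataset n p
  /-- which entries are observed -/
  obs : ∀ n, Ω n → Pattern n p
  /-- imputed datasets -/
  imp : ∀ n, Ω n → Fin m → Dataset n p
  measurable_X : ∀ n, Measurable (X n)
  measurable_obs : ∀ n, Measurable (obs n)
  measurable_imp : ∀ n, Measurable (imp n)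
  law_X : ∀ n, (P n).map (X n) =
    (Measure.pi fun _ : Fin n => Measure.pi model.ref).withDensity
      fun x => ENNReal.ofReal (model.lik [x] (psiStar n))
  imp_eq : ∀ n ω ℓ i j, obs n ω i j = true → imp n ω ℓ i j = X n ω i j
  /-- unrestricted MLE of `ψ` -/
  psiHat : ∀ n, List (Dataset n p) → Par k h
  isMLE_psiHat : ∀ n (D : List (Dataset n p)),
    (∃ ψ, IsMLE (model.lik D) model.Psi ψ) → IsMLE (model.lik D) model.Psi (psiHat n D)
  /-- MLE of `ψ` under the restriction `θ = θ₀` -/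
  psiHat0 : ∀ n, List (Dataset n p) → Par k h
  isMLE_psiHat0 : ∀ n (D : List (Dataset n p)),
    (∃ ψ, IsMLE (model.lik D) (model.nullSet theta0) ψ) →
      IsMLE (model.lik D) (model.nullSet theta0) (psiHat0 n D)
  /-- variance estimator of the MLE of `θ` -/
  Vhat : ∀ n, List (Dataset n p) → Matrix (Fin k) (Fin k) ℝ
  /-- observed-data MLE of `ψ` -/
  psiObs : ∀ n, Pattern n p → Dataset n p → Par k h
  isMLE_psiObs : ∀ n (o : Pattern n p) (x : Dataset n p),
    (∃ ψ, IsMLE (model.obsLik o x) model.Psi ψ) →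
      IsMLE (model.obsLik o x) model.Psi (psiObs n o x)
  measurable_psiObs : ∀ n, Measurable fun z : Pattern n p × Dataset n p => psiObs n z.1 z.2

attribute [instance] MIProblem.mΩ MIProblem.borelΩ MIProblem.probP

/-- Complete-data testing devices: Wald, likelihood ratio and Rao's score test. -/
inductive Device where
  | wald
  | lrt
  | rao

namespace MIProblem

variable {p k h m : ℕ} (Q : MIProblem p k h m)

/-- The complete-data test statistic as a function of the dataset. -/
def device (d : Device) (n : ℕ) (D : List (Dataset n p)) : ℝ :=
  match d with
  | .wald =>
      (theta (Q.psiHat n D) - Q.theta0) ⬝ᵥ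
        ((Q.Vhat n D)⁻¹ *ᵥ (theta (Q.psiHat n D) - Q.theta0))
  | .lrt => 2 * Real.log (Q.model.lik D (Q.psiHat n D) / Q.model.lik D (Q.psiHat0 n D))
  | .rao =>
      Q.model.score D (Q.psiHat0 n D) ⬝ᵥ
        ((Q.model.info D (Q.psiHat0 n D))⁻¹ *ᵥ Q.model.score D (Q.psiHat0 n D))

/-- The stacked statistic `d̂^S = 𝒹(X^S) / |S|`. -/
def dHat (d : Device) (S : Multiset (Fin m)) (n : ℕ) (ω : Q.Ω n) : ℝ :=
  Q.device d n (stack (Q.imp n ω) S) / (S.card : ℝ)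

/-- The stacked multiple imputation statistic `T̂_{S₁,S₂}`; `S₁.val + S₂.val` is the multiset sum. -/
def smi (d : Device) (S₁ S₂ : Finset (Fin m)) (n : ℕ) (ω : Q.Ω n) : ℝ :=
  ((S₁.card : ℝ) + S₂.card) / ((S₁.card : ℝ) + S₂.card - 2 * (S₁ ∩ S₂).card) *
    ((S₁.card : ℝ) * Q.dHat d S₁.val n ω + (S₂.card : ℝ) * Q.dHat d S₂.val n ω
      - ((S₁.card : ℝ) + S₂.card) * Q.dHat d (S₁.val + S₂.val) n ω)

/-- `t̂_τ(Λ)`: the average of `T̂_{S₁,S₂}^τ` over the selected pairs. -/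
def tHat (d : Device) (Λ : Finset (Finset (Fin m) × Finset (Fin m))) (τ n : ℕ) (ω : Q.Ω n) : ℝ :=
  (Λ.card : ℝ)⁻¹ * ∑ S ∈ Λ, Q.smi d S.1 S.2 n ω ^ τ

/-- The bias-corrected estimator `σ̂²_r`, with selection rule `Λ`. -/
def sigmaHatSq (d : Device) (Λ : Finset (Finset (Fin m) × Finset (Fin m))) (n : ℕ)
    (ω : Q.Ω n) : ℝ :=
  (((k : ℝ) * (m - 1) + 2) * Q.tHat d Λ 2 n ω - ((m : ℝ) - 1) * (k + 2) * Q.tHat d Λ 1 n ω ^ 2) /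
    (2 * (k : ℝ) ^ 2 * (m - 2))

end MIProblem

/-- The jackknife selection rule `{({ℓ}, {-ℓ}) : ℓ}`. -/
def jackknife (m : ℕ) : Finset (Finset (Fin m) × Finset (Fin m)) :=
  Finset.univ.image fun ℓ => ({ℓ}, {ℓ}ᶜ)

/-! ### Information matrices and odds of missing information -/

section Info

variable {p k h m : ℕ}

/-- Complete-data Fisher information of `ψ` (in `n` units) at the true value. -/
def MIProblem.infoCom (Q : MIProblem p k h m) (n : ℕ) :
    Matrix (Fin k ⊕ Fin h) (Fin k ⊕ Fin h) ℝ :=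
  Matrix.of fun a b => ∫ ω, Q.model.info [Q.X n ω] (Q.psiStar n) a b ∂Q.P n

/-- Missing-data Fisher information of `ψ` (in `n` units) at the true value. -/
def MIProblem.infoMis (Q : MIProblem p k h m) (n : ℕ) :
    Matrix (Fin k ⊕ Fin h) (Fin k ⊕ Fin h) ℝ :=
  Matrix.of fun a b =>
    ∫ ω, Q.model.misInfo (Q.obs n ω) (Q.X n ω) (Q.psiStar n) a b ∂Q.P n

/-- `F = I_mis I_com⁻¹` for the parameter `θ`, from the (per-unit) complete-data information
`Jcom` and missing-data information `Jmis` of `ψ`; the observed-data information is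
`Jcom - Jmis`. -/
def fmiMatrix (Jcom Jmis : Matrix (Fin k ⊕ Fin h) (Fin k ⊕ Fin h) ℝ) : Matrix (Fin k) (Fin k) ℝ :=
  (thetaInfo Jcom - thetaInfo (Jcom - Jmis)) * (thetaInfo Jcom)⁻¹

/-- Odds of missing information `r_j = f_j / (1 - f_j)`, where the `f_j` are the eigenvalues of `F`
with multiplicity. -/
def omi (Jcom Jmis : Matrix (Fin k ⊕ Fin h) (Fin k ⊕ Fin h) ℝ) : Multiset ℝ :=
  (fmiMatrix Jcom Jmis).charpoly.roots.map fun f => f / (1 - f)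

/-- Power sums `R_τ = ∑ r_j ^ τ`. -/
def powerSum (r : Multiset ℝ) (τ : ℕ) : ℝ := (r.map fun x => x ^ τ).sum

/-- Mean `μ_r` of the odds of missing information. -/
def omiMean (k : ℕ) (r : Multiset ℝ) : ℝ := r.sum / k

/-- Variance `σ²_r` of the odds of missing information. -/
def omiVar (k : ℕ) (r : Multiset ℝ) : ℝ := (r.map fun x => (x - omiMean k r) ^ 2).sum / k

end Info

/-! ### Modes of convergence -/

namespace MIProblem

variable {p k h m : ℕ} (Q : MIProblem p k h m)

/-- Convergence in probability to `0` along the sequence of probability spaces. -/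
def ToZeroInProb (Y : ∀ n, Q.Ω n → ℝ) : Prop :=
  ∀ ε : ℝ, 0 < ε → Tendsto (fun n => Q.P n {ω | ε ≤ |Y n ω|}) atTop (𝓝 0)

/-- Boundedness in probability. -/
def BoundedInProb (Y : ∀ n, Q.Ω n → ℝ) : Prop :=
  ∀ ε : ℝ, 0 < ε → ∃ C : ℝ, ∀ᶠ n in atTop, Q.P n {ω | C < |Y n ω|} ≤ ENNReal.ofReal ε

/-- The observed data `X_obs`: the pattern and the observed entries. -/
def obsData (n : ℕ) (ω : Q.Ω n) : Pattern n p × Dataset n p :=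
  (Q.obs n ω, mask (Q.obs n ω) (Q.X n ω))

lemma measurable_obsData (n : ℕ) : Measurable (Q.obsData n) := by
  refine (Q.measurable_obs n).prodMk ?_
  refine measurable_pi_lambda _ fun i => measurable_pi_lambda _ fun j => ?_
  refine Measurable.ite ?_ ?_ measurable_const
  · have h1 : Measurable fun ω => Q.obs n ω i j :=
      (measurable_pi_apply j).comp ((measurable_pi_apply i).comp (Q.measurable_obs n))
    exact h1 (measurableSet_singleton true)
  · exact (measurable_pi_apply j).comp ((measurable_pi_apply i).comp (Q.measurable_X n))

/-- The σ-algebra generated by the observed data. -/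
@[reducible]
def obsAlg (n : ℕ) : MeasurableSpace (Q.Ω n) := MeasurableSpace.comap (Q.obsData n) inferInstance

lemma obsAlg_le (n : ℕ) : Q.obsAlg n ≤ Q.mΩ n := (Q.measurable_obsData n).comap_le

/-- Weak convergence of the conditional laws of `Y n` given `X_obs` to `μ`, in probability. -/
def CondTendstoInDistribution {E : Type*} [TopologicalSpace E] [MeasurableSpace E]
    (Y : ∀ n, Q.Ω n → E) (μ : Measure E) : Prop :=
  ∀ g : BoundedContinuousFunction E ℝ,
    Q.ToZeroInProb fun n ω =>
      ((Q.P n)[fun ω' => g (Y n ω') | Q.obsAlg n]) ω - ∫ y, g y ∂μ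

/-- Convergence of `Y n` to `0` in conditional probability given `X_obs`. -/
def CondToZeroInProb (Y : ∀ n, Q.Ω n → ℝ) : Prop :=
  ∀ ε : ℝ, 0 < ε → Q.ToZeroInProb
    ((fun n => (Q.P n)[{ω | ε ≤ |Y n ω|}.indicator (fun _ => (1 : ℝ)) | Q.obsAlg n]))

/-! ### Estimators on the observed and on the imputed data -/

/-- Observed-data MLE of `θ`. -/
def thetaObs (n : ℕ) (ω : Q.Ω n) : Fin k → ℝ :=
  theta (Q.psiObs n (Q.obsData n ω).1 (Q.obsData n ω).2)

/-- MLE of `θ` from the `ℓ`-th imputed dataset. -/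
def thetaImp (ℓ : Fin m) (n : ℕ) (ω : Q.Ω n) : Fin k → ℝ := theta (Q.psiHat n [Q.imp n ω ℓ])

/-- Variance estimator from the `ℓ`-th imputed dataset. -/
def VImp (ℓ : Fin m) (n : ℕ) (ω : Q.Ω n) : Matrix (Fin k) (Fin k) ℝ := Q.Vhat n [Q.imp n ω ℓ]

/-! ### Conditions -/

/-- Usual likelihood regularity for the device `d`, with per-unit information matrices `Jcom`, `Jmis`
of `ψ`. The likelihood conditions concern single imputed datasets only. -/
structure Regular (d : Device) (Jcom Jmis : Matrix (Fin k ⊕ Fin h) (Fin k ⊕ Fin h) ℝ) :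
    Prop where
  /-- the true values stay away from the boundary of `Ψ` -/
  psiStar_tendsto : ∃ ψ ∈ Q.model.Psi, Tendsto Q.psiStar atTop (𝓝 ψ)
  integrable_com : ∀ n a b,
    Integrable (fun ω => Q.model.info [Q.X n ω] (Q.psiStar n) a b) (Q.P n)
  integrable_mis : ∀ n a b,
    Integrable (fun ω => Q.model.misInfo (Q.obs n ω) (Q.X n ω) (Q.psiStar n) a b) (Q.P n)
  tendsto_com : Tendsto (fun n : ℕ => (n : ℝ)⁻¹ • Q.infoCom n) atTop (𝓝 Jcom)
  tendsto_mis : Tendsto (fun n : ℕ => (n : ℝ)⁻¹ • Q.infoMis n) atTop (𝓝 Jmis)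
  posDef_com : Jcom.PosDef
  posDef_obs : (Jcom - Jmis).PosDef
  /-- positive, twice continuously differentiable likelihoods -/
  smooth : ∀ n ℓ, ∀ᵐ ω ∂Q.P n,
    (∀ ψ ∈ Q.model.Psi, 0 < Q.model.lik [Q.imp n ω ℓ] ψ) ∧
      ContDiffOn ℝ 2 (Q.model.lik [Q.imp n ω ℓ]) Q.model.Psi
  /-- the normalized score at the truth is bounded in probability -/
  score_bounded : ∀ ℓ a, Q.BoundedInProb fun n ω =>
    (Real.sqrt n)⁻¹ * Q.model.score [Q.imp n ω ℓ] (Q.psiStar n) a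
  /-- the normalized information converges, uniformly near the truth -/
  info_tendsto : ∀ ℓ, ∀ ε : ℝ, 0 < ε → ∀ η : ℝ, 0 < η → ∃ ρ : ℝ, 0 < ρ ∧ ∀ᶠ n in atTop,
    Q.P n {ω | ∃ ψ ∈ Q.model.Psi, ‖ψ - Q.psiStar n‖ < ρ ∧ ∃ a b,
      ε < |(n : ℝ)⁻¹ * Q.model.info [Q.imp n ω ℓ] ψ a b - Jcom a b|} ≤ ENNReal.ofReal η
  /-- the truth is well separated -/
  separated : ∀ ℓ, ∀ ρ : ℝ, 0 < ρ → ∃ c : ℝ, 0 < c ∧ Tendsto (fun n : ℕ =>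
    Q.P n {ω | ∃ ψ ∈ Q.model.Psi, ρ ≤ ‖ψ - Q.psiStar n‖ ∧
      Real.log (Q.model.lik [Q.imp n ω ℓ] (Q.psiStar n)) - c * n
        < Real.log (Q.model.lik [Q.imp n ω ℓ] ψ)}) atTop (𝓝 0)
  /-- meaning of `V̂` as a variance estimator, for the Wald device: to first order, it is the
  `θ`-block of the inverse observed information at the MLE -/
  variance_estimator : d = Device.wald → ∀ S : Multiset (Fin m), S ≠ 0 → ∀ a b, Q.ToZeroInProb fun n ω =>
    (n : ℝ) * (Q.Vhat n (stack (Q.imp n ω) S) a b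
      - thetaVar (Q.model.info (stack (Q.imp n ω) S)
          (Q.psiHat n (stack (Q.imp n ω) S))) a b)
  measurable_thetaImp : ∀ ℓ n, Measurable (Q.thetaImp ℓ n)
  measurable_VImp : ∀ ℓ n a b, Measurable fun ω => Q.VImp ℓ n ω a b
  measurable_device : ∀ n (S : Multiset (Fin m)), S ≠ 0 →
    Measurable fun ω => Q.device d n (stack (Q.imp n ω) S)

/-- Asymptotic normality of the observed-data MLE: `√n (θ̂_obs - θ*) ⇒ N_k(0, T₁)`, with
`T₁ = lim n I_obs⁻¹`. -/
def ObsNormality (Jcom Jmis : Matrix (Fin k ⊕ Fin h) (Fin k ⊕ Fin h) ℝ) : Prop :=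
  TendstoInDistribution
    (fun (n : ℕ) (ω : Q.Ω n) =>
      WithLp.toLp 2 (Real.sqrt n • (Q.thetaObs n ω - theta (Q.psiStar n)) : Fin k → ℝ))
    atTop (fun x : EuclideanSpace ℝ (Fin k) => x) Q.P
    (multivariateGaussian 0 (thetaVar (Jcom - Jmis)))

/-- Proper imputation: the imputed statistics are conditionally independent given `X_obs`;
`√n (θ̂^ℓ - θ̂_obs) ∣ X_obs ⇒ N_k(0, B₁)` with `B₁ = lim n (I_obs⁻¹ - I_com⁻¹)`; and
`T⁻¹ (V̂^ℓ - V) → 0` in probability given `X_obs`, with `T = I_obs⁻¹` and `V = I_com⁻¹`. -/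
structure ProperImputation (Jcom Jmis : Matrix (Fin k ⊕ Fin h) (Fin k ⊕ Fin h) ℝ) : Prop where
  condIndep : ∀ n, iCondIndepFun (Q.obsAlg n) (Q.obsAlg_le n)
    (fun (ℓ : Fin m) (ω : Q.Ω n) =>
      ((Q.thetaImp ℓ n ω, fun a b => Q.VImp ℓ n ω a b) :
        (Fin k → ℝ) × (Fin k → Fin k → ℝ))) (Q.P n)
  posSemidef : (thetaVar (Jcom - Jmis) - thetaVar Jcom).PosSemidef
  normality : ∀ ℓ, Q.CondTendstoInDistribution
    (fun (n : ℕ) (ω : Q.Ω n) =>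
      WithLp.toLp 2 (Real.sqrt n • (Q.thetaImp ℓ n ω - Q.thetaObs n ω) : Fin k → ℝ))
    (multivariateGaussian 0 (thetaVar (Jcom - Jmis) - thetaVar Jcom))
  variance : ∀ ℓ a b, Q.CondToZeroInProb fun n ω =>
    (thetaInfo (Q.infoCom n - Q.infoMis n) *
      (Q.VImp ℓ n ω - thetaVar (Q.infoCom n))) a b

/-- Local alternatives: `√n A (θ* - θ₀) → δ` for some vector `δ` and some invertible matrix `A`. -/
def LocalAlternative : Prop :=
  ∃ (A : Matrix (Fin k) (Fin k) ℝ) (δ : Fin k → ℝ), IsUnit A ∧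
    Tendsto (fun n : ℕ => Real.sqrt n • (A *ᵥ (theta (Q.psiStar n) - Q.theta0))) atTop (𝓝 δ)

/-- Uniform integrability of `T̂_{S₁,S₂}^{2τ}` over the sample sizes `n ≥ 1`, for all non-empty
non-identical `S₁`, `S₂`. -/
def UnifIntegrableSMI (d : Device) (τ : ℕ) : Prop :=
  ∀ S₁ S₂ : Finset (Fin m), S₁.Nonempty → S₂.Nonempty → S₁ ≠ S₂ →
    Tendsto (fun C : ℝ => ⨆ (n : ℕ) (_ : 1 ≤ n),
      ∫⁻ ω in {ω | C < |Q.smi d S₁ S₂ n ω|},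
        ENNReal.ofReal (Q.smi d S₁ S₂ n ω ^ (2 * τ)) ∂Q.P n) atTop (𝓝 0)

end MIProblem

/-! ### Limiting variances -/

/-- Leading term `2 (6 k² R₄ - 8 k R₃ R₁ + k² R₂² + 4 R₁² R₂) / (k⁴ m)`. -/
def leadVar (k m : ℝ) (R : ℕ → ℝ) : ℝ :=
  2 * (6 * k ^ 2 * R 4 - 8 * k * R 3 * R 1 + k ^ 2 * R 2 ^ 2 + 4 * R 1 ^ 2 * R 2) / (k ^ 4 * m)

/-- Closed form of the limiting variance. -/
def exactVar (k m : ℝ) (R : ℕ → ℝ) : ℝ :=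
  2 / (k ^ 4 * (m - 1) ^ 3 * (m - 2)) *
    (2 * ((m - 1) ^ 2 * (3 * m - 7) * k ^ 2 - 4 * (m - 1) * k - 4) * R 4
      - 8 * (m - 1) ^ 2 * (m - 2) * k * (R 3 * R 1)
      + (m - 2) * ((m - 1) ^ 2 * k ^ 2 + 4 * (m - 1) * k + 4 * m) * R 2 ^ 2
      + 4 * (m - 1) ^ 2 * (m - 2) * (R 1 ^ 2 * R 2))

end StackedMI

end

/-! Near the truth every imputed-data log-likelihood is quadratic at scale n^(-1/2), with the same
curvature `Jcom` for all imputations. The log-likelihood of a stack is a sum, so its maximizer is to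
first order the average of the single-imputation maximizers. Let b_ℓ be the limit of √n(θ̂^ℓ - θ₀),
let b̄_S be its average over S, and let V = `thetaVar Jcom`. Each of the three devices on X^S,
divided by |S|, then has the limit b̄_Sᵀ V⁻¹ b̄_S (`exists_limit_dHat`). For a jackknife pair these
forms combine to m/(m-1) (b_ℓ - b̄)ᵀ V⁻¹ (b_ℓ - b̄) (`quadForm_jackknife`). The centring removes θ₀,
the local alternative and θ̂_obs, so the statistics depend asymptotically only on the noises √n(θ̂^ℓ
- θ̂_obs) (`tendsto_smi_sub_jackLim`).

Limits in probability are treated as deterministic limits along ultrafilters on the pairs (n, ω)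
finer than `whp`. Along such an ultrafilter bounded quantities converge, and
`eventually_whp_of_ultrafilter` carries the conclusion back to probabilities.

Conditional independence given the observed data, together with conditional normality, makes the
noises jointly converge to m independent N(0, B₁) vectors (`tendsto_noiseVec`). Writing V = G Gᵀ and
B₁ = G diag(r) Gᵀ identifies the r_j with the odds of missing information (`omi_eq_map`). The
limiting statistic becomes m/(m-1) ∑_j r_j (Z_ℓj - Z̄_j)² with independent standard normal Z
(`jackLim_rowMap`).

The variance estimator is quadratic in the statistics and its square is quartic, so uniform
integrability of fourth powers yields convergence of its first two moments
(`tendsto_integral_of_uiFour`). The limits are expectations of polynomials in Gaussian variables.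
They are found by iterating Gaussian integration by parts (`sLim_mean`, `sLim_sq`), which gives the
closed form of the variance. Its difference from the leading term is a rational function of 1/m of
smaller order. -/

noncomputable section

namespace StackedMI

/-! ### Polynomial moments of centred Gaussian arrays -/

section Wick

open MvPolynomial

/-- The `(a, b)` entry of the centring matrix of order `m`. -/
def cmat (m : ℕ) (a b : Fin m) : ℝ := (if a = b then 1 else 0) - 1 / (m : ℝ)

lemma cmat_comm {m : ℕ} (a b : Fin m) : cmat m a b = cmat m b a := by
  simp [cmat, eq_comm]

lemma cmat_self {m : ℕ} (a : Fin m) : cmat m a a = 1 - 1 / m := by simp [cmat]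

lemma cmat_ne {m : ℕ} {a b : Fin m} (h : a ≠ b) : cmat m a b = - (1 / m) := by simp [cmat, h]

lemma sum_cmat {m : ℕ} (a : Fin m) : ∑ b, cmat m a b = 0 := by
  have : (m : ℝ) ≠ 0 := by
    have := a.pos; positivity
  simp [cmat, Finset.sum_sub_distrib, this]

/-- The centring matrix is a symmetric projection. Hence it is also the covariance matrix of a
centred standard normal sample. -/
lemma sum_cmat_mul {m : ℕ} (a b : Fin m) : ∑ c, cmat m a c * cmat m b c = cmat m a b := by
  have h : ∀ c, cmat m a c * cmat m b c =
      (if a = c then cmat m b c else 0) - 1 / (m : ℝ) * cmat m b c := by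
    intro c
    rw [cmat]
    split_ifs <;> ring
  simp_rw [h, Finset.sum_sub_distrib, ← Finset.mul_sum, sum_cmat]
  simp [cmat_comm]

lemma sum_cmat_self (m : ℕ) (hm : m ≠ 0) : ∑ a : Fin m, cmat m a a = m - 1 := by
  have : (m : ℝ) ≠ 0 := by exact_mod_cast hm
  simp only [cmat_self]
  simp
  field_simp

variable {m k : ℕ}

lemma derivation_sum_apply {σ ι : Type*} (s : Finset ι)
    (D : ι → Derivation ℝ (MvPolynomial σ ℝ) (MvPolynomial σ ℝ)) (F : MvPolynomial σ ℝ) :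
    (∑ i ∈ s, D i) F = ∑ i ∈ s, D i F := by
  classical
  induction s using Finset.induction_on with
  | empty => simp
  | insert i s hi ih => simp [Finset.sum_insert hi, ih]

/-- Column-centred variables of an `m × k` array. -/
def cvar (a : Fin m) (j : Fin k) : MvPolynomial (Fin m × Fin k) ℝ :=
  ∑ b, C (cmat m a b) * X (b, j)

/-- The derivation dual to a centred variable. -/
def cder (a : Fin m) (j : Fin k) :
    Derivation ℝ (MvPolynomial (Fin m × Fin k) ℝ) (MvPolynomial (Fin m × Fin k) ℝ) :=
  ∑ b, cmat m a b • pderiv (b, j)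

lemma cder_apply (a : Fin m) (j : Fin k) (F : MvPolynomial (Fin m × Fin k) ℝ) :
    cder a j F = ∑ b, cmat m a b • pderiv (b, j) F := by
  simp [cder, derivation_sum_apply]

/-- Idempotence of the centring matrix collapses the double sum to a covariance. This makes Stein's
identity usable directly on the dependent centred variables. -/
lemma cder_cvar (a b : Fin m) (i j : Fin k) :
    cder a i (cvar b j) = if i = j then C (cmat m a b) else 0 := by
  rw [cder_apply]
  simp only [cvar, map_sum, pderiv_C_mul, pderiv_X, Pi.single_apply, Prod.mk.injEq]
  by_cases h : i = j
  · simp only [h, and_true, eq_comm (b := (_ : Fin m)), if_true]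
    rw [← sum_cmat_mul, map_sum]
    simp [MvPolynomial.smul_eq_C_mul]
  · simp [h, Ne.symm h, eq_comm]

lemma sum_cvar (j : Fin k) : ∑ a : Fin m, cvar a j = 0 := by
  simp only [cvar]
  rw [Finset.sum_comm]
  refine Finset.sum_eq_zero fun b _ => ?_
  rw [← Finset.sum_mul, ← map_sum]
  simp_rw [cmat_comm _ b, sum_cmat]
  simp

lemma sum_cmat_cvar (a : Fin m) (j : Fin k) : ∑ b, C (cmat m b a) * cvar b j = cvar a j := by
  have h : ∀ b, C (cmat m b a) * cvar b j =
      (if b = a then cvar b j else 0) - C (1 / (m : ℝ)) * cvar b j := by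
    intro b
    rw [cmat, C_sub, sub_mul]
    split_ifs <;> simp
  simp_rw [h, Finset.sum_sub_distrib, ← Finset.mul_sum, sum_cvar]
  simp

/-- Weighted cross products `∑ⱼ rⱼ ^ p x_{cj} x_{dj}` of the centred variables. -/
def crossT (r : Fin k → ℝ) (p : ℕ) (c d : Fin m) : MvPolynomial (Fin m × Fin k) ℝ :=
  ∑ j, C (r j ^ p) * (cvar c j * cvar d j)

lemma crossT_comm (r : Fin k → ℝ) (p : ℕ) (c d : Fin m) : crossT r p c d = crossT r p d c := by
  simp [crossT, mul_comm (cvar c _)]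

/-- The derivation of the integration by parts formula for `crossT`. -/
def crossD (r : Fin k → ℝ) (q : ℕ) (e a : Fin m) :
    Derivation ℝ (MvPolynomial (Fin m × Fin k) ℝ) (MvPolynomial (Fin m × Fin k) ℝ) :=
  ∑ j, (C (r j ^ q) * cvar a j) • cder e j

lemma crossD_apply (r : Fin k → ℝ) (q : ℕ) (e a : Fin m) (F : MvPolynomial (Fin m × Fin k) ℝ) :
    crossD r q e a F = ∑ j, C (r j ^ q) * cvar a j * cder e j F := by
  simp [crossD, derivation_sum_apply]

/-- A Wick contraction: the derivation replaces one of the two factors, and the weights multiply, so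
the exponents of r add. The family `crossT` is therefore closed under integration by parts, which
turns moments into a finite recursion. -/
lemma crossD_crossT (r : Fin k → ℝ) (q p : ℕ) (e a c d : Fin m) :
    crossD r q e a (crossT r p c d) =
      C (cmat m e c) * crossT r (p + q) a d + C (cmat m e d) * crossT r (p + q) a c := by
  rw [crossD_apply]
  have h : ∀ j, cder e j (crossT r p c d) =
      C (r j ^ p) * (C (cmat m e c) * cvar d j + C (cmat m e d) * cvar c j) := by
    intro j
    simp only [crossT, map_sum, Derivation.leibniz, cder_cvar, smul_eq_mul, derivation_C,
      mul_zero, add_zero]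
    rw [Finset.sum_eq_single j]
    · simp only [if_true]; ring
    · intro b _ hb; simp [hb.symm]
    · simp
  simp_rw [h, crossT, Finset.mul_sum, ← Finset.sum_add_distrib]
  refine Finset.sum_congr rfl fun j _ => ?_
  rw [pow_add, C_mul]
  ring

/-- Total sums of squares. -/
def totT (r : Fin k → ℝ) (p : ℕ) : MvPolynomial (Fin m × Fin k) ℝ := ∑ a : Fin m, crossT r p a a

/-- The derivation of the integration by parts formula for `totT`. -/
def totD (r : Fin k → ℝ) (q : ℕ) :
    Derivation ℝ (MvPolynomial (Fin m × Fin k) ℝ) (MvPolynomial (Fin m × Fin k) ℝ) :=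
  ∑ a : Fin m, crossD r q a a

lemma totD_apply (r : Fin k → ℝ) (q : ℕ) (F : MvPolynomial (Fin m × Fin k) ℝ) :
    totD r q F = ∑ a : Fin m, crossD r q a a F := by
  simp [totD, derivation_sum_apply]

/-- On centred variables `totD` acts as an Euler operator weighted by r_j^q, so a form of degree two
picks up a factor 2 and a shift of the exponent. Row indices are left untouched. -/
lemma totD_crossT (r : Fin k → ℝ) (q p : ℕ) (c d : Fin m) :
    totD r q (crossT r p c d) = 2 * crossT r (p + q) c d := by
  rw [totD_apply]
  simp_rw [crossD_crossT, Finset.sum_add_distrib]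
  have h : ∀ c d : Fin m, ∑ a, C (cmat m a c) * crossT r (p + q) a d = crossT r (p + q) c d := by
    intro c d
    simp_rw [crossT, Finset.mul_sum]
    rw [Finset.sum_comm]
    refine Finset.sum_congr rfl fun j _ => ?_
    rw [← sum_cmat_cvar c j, Finset.sum_mul, Finset.mul_sum]
    refine Finset.sum_congr rfl fun a _ => ?_
    ring
  rw [h, h, crossT_comm r _ d c]
  ring

lemma totD_totT (r : Fin k → ℝ) (q p : ℕ) :
    totD r q (totT (m := m) r p) = 2 * totT r (p + q) := by
  simp [totT, totD_crossT, Finset.mul_sum]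

/-- A normalized linear functional on polynomials obeying Gaussian integration by parts. -/
structure IsGaussFunctional {ι : Type*} (E : MvPolynomial ι ℝ →ₗ[ℝ] ℝ) : Prop where
  one : E 1 = 1
  stein : ∀ i F, E (X i * F) = E (pderiv i F)

/-- Power sums of a vector. -/
def psum (r : Fin k → ℝ) (p : ℕ) : ℝ := ∑ j, r j ^ p

/-- The statistic `t₁` of the Gaussian limit. -/
def tOne (r : Fin k → ℝ) : MvPolynomial (Fin m × Fin k) ℝ := C (1 / (m - 1 : ℝ)) * totT r 1

/-- The statistic `t₂` of the Gaussian limit. -/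
def tTwo (r : Fin k → ℝ) : MvPolynomial (Fin m × Fin k) ℝ :=
  C ((m : ℝ) / (m - 1) ^ 2) * ∑ a : Fin m, crossT r 1 a a ^ 2

/-- The bias-corrected variance of the Gaussian limit. -/
def sLim (r : Fin k → ℝ) : MvPolynomial (Fin m × Fin k) ℝ :=
  C (((k : ℝ) * (m - 1) + 2) / (2 * (k : ℝ) ^ 2 * (m - 2))) * tTwo r -
    C (((m : ℝ) - 1) * (k + 2) / (2 * (k : ℝ) ^ 2 * (m - 2))) * tOne r ^ 2

/-- The bias-corrected variance as a function of the values of the stacked statistics. -/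
def sigmaFn (k m : ℕ) (t : Fin m → ℝ) : ℝ :=
  (((k : ℝ) * (m - 1) + 2) * ((m : ℝ)⁻¹ * ∑ a, t a ^ 2) -
    ((m : ℝ) - 1) * (k + 2) * ((m : ℝ)⁻¹ * ∑ a, t a) ^ 2) / (2 * (k : ℝ) ^ 2 * (m - 2))

/-- The prefactors of `tOne` and `tTwo` are 1/m times the first and second power of m/(m-1), the
factor carried by each limiting jackknife statistic. -/
lemma eval_sLim (hm : 3 ≤ m) (r : Fin k → ℝ) (x : Fin m × Fin k → ℝ) :
    eval x (sLim r) = sigmaFn k m fun a => (m : ℝ) / (m - 1) * eval x (crossT r 1 a a) := by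
  have hm' : (3 : ℝ) ≤ m := by exact_mod_cast hm
  have h0 : (m : ℝ) ≠ 0 := by positivity
  have h1 : (m : ℝ) - 1 ≠ 0 := by linarith
  simp only [sLim, tOne, tTwo, totT, sigmaFn, map_sub, map_mul, map_pow, map_sum, eval_C, mul_pow,
    ← Finset.mul_sum]
  generalize ∑ a : Fin m, eval x (crossT r 1 a a) ^ 2 = A
  generalize ∑ a : Fin m, eval x (crossT r 1 a a) = B
  field_simp

lemma eval_cvar (a : Fin m) (j : Fin k) (x : Fin m × Fin k → ℝ) :
    eval x (cvar a j) = x (a, j) - (m : ℝ)⁻¹ * ∑ b, x (b, j) := by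
  simp only [cvar, map_sum, map_mul, eval_C, eval_X, cmat, sub_mul, Finset.sum_sub_distrib,
    ← Finset.mul_sum]
  simp

lemma eval_crossT (r : Fin k → ℝ) (a : Fin m) (x : Fin m × Fin k → ℝ) :
    eval x (crossT r 1 a a) = ∑ j, r j * (x (a, j) - (m : ℝ)⁻¹ * ∑ b, x (b, j)) ^ 2 := by
  simp [crossT, eval_cvar, pow_two]

/-! ### Moments of the limit by iterated integration by parts -/

namespace IsGaussFunctional

variable {E : MvPolynomial (Fin m × Fin k) ℝ →ₗ[ℝ] ℝ} (hE : IsGaussFunctional E) (r : Fin k → ℝ)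
include hE

omit hE in
lemma map_C_mul_apply (E : MvPolynomial (Fin m × Fin k) ℝ →ₗ[ℝ] ℝ) (c : ℝ)
    (F : MvPolynomial (Fin m × Fin k) ℝ) : E (C c * F) = c * E F := by
  rw [← MvPolynomial.smul_eq_C_mul, map_smul, smul_eq_mul]

lemma cvar_mul (a : Fin m) (j : Fin k) (F : MvPolynomial (Fin m × Fin k) ℝ) :
    E (cvar a j * F) = E (cder a j F) := by
  rw [cvar, cder_apply, Finset.sum_mul, map_sum, map_sum]
  refine Finset.sum_congr rfl fun b _ => ?_
  rw [mul_assoc, map_C_mul_apply, hE.stein, map_smul, smul_eq_mul]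

/-- Stein's identity is applied to the first factor of each product. The derivative hits either the
companion factor, giving the covariance term, or `F`, giving `crossD`. -/
lemma crossT_mul (q : ℕ) (e a : Fin m) (F : MvPolynomial (Fin m × Fin k) ℝ) :
    E (crossT r q e a * F) = cmat m e a * psum r q * E F + E (crossD r q e a F) := by
  rw [crossT, crossD_apply, Finset.sum_mul, map_sum, map_sum, psum, Finset.mul_sum, Finset.sum_mul,
    ← Finset.sum_add_distrib]
  refine Finset.sum_congr rfl fun j _ => ?_
  rw [mul_assoc, mul_assoc, map_C_mul_apply, hE.cvar_mul, Derivation.leibniz, cder_cvar, if_pos rfl,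
    map_add, smul_eq_mul, smul_eq_mul, mul_comm F, map_C_mul_apply, mul_assoc (C _), map_C_mul_apply]
  ring

lemma totT_mul (hm : m ≠ 0) (q : ℕ) (F : MvPolynomial (Fin m × Fin k) ℝ) :
    E (totT r q * F) = (m - 1) * psum r q * E F + E (totD r q F) := by
  rw [totT, totD_apply, Finset.sum_mul, map_sum, map_sum]
  simp_rw [hE.crossT_mul, Finset.sum_add_distrib, ← Finset.sum_mul, sum_cmat_self m hm]

lemma crossT_one (q : ℕ) (e a : Fin m) : E (crossT r q e a) = cmat m e a * psum r q := by
  have := hE.crossT_mul r q e a 1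
  simpa [hE.one] using this

lemma crossT_two (p q : ℕ) (a b c d : Fin m) :
    E (crossT r p a b * crossT r q c d) = cmat m a b * cmat m c d * (psum r p * psum r q)
      + (cmat m a c * cmat m b d + cmat m a d * cmat m b c) * psum r (q + p) := by
  rw [hE.crossT_mul, crossD_crossT, map_add, map_C_mul_apply, map_C_mul_apply, hE.crossT_one, hE.crossT_one,
    hE.crossT_one]
  ring

/-- Row indices and exponents stay general because contractions of diagonal terms produce mixed
terms with two different rows and larger exponents. Right-nested products let the recursion be
chained by rewriting. -/
lemma crossT_three (p q s : ℕ) (a b c d e f : Fin m) :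
    E (crossT r p a b * (crossT r q c d * crossT r s e f)) =
      cmat m a b * psum r p * E (crossT r q c d * crossT r s e f)
      + (cmat m a c * E (crossT r (q + p) b d * crossT r s e f)
        + cmat m a d * E (crossT r (q + p) b c * crossT r s e f))
      + (cmat m a e * E (crossT r q c d * crossT r (s + p) b f)
        + cmat m a f * E (crossT r q c d * crossT r (s + p) b e)) := by
  have h : crossD r p a b (crossT r q c d * crossT r s e f) =
      C (cmat m a c) * (crossT r (q + p) b d * crossT r s e f)
      + C (cmat m a d) * (crossT r (q + p) b c * crossT r s e f)
      + C (cmat m a e) * (crossT r q c d * crossT r (s + p) b f)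
      + C (cmat m a f) * (crossT r q c d * crossT r (s + p) b e) := by
    rw [Derivation.leibniz, crossD_crossT, crossD_crossT, smul_eq_mul, smul_eq_mul]
    ring
  rw [hE.crossT_mul, h]
  simp only [map_add, map_C_mul_apply]
  ring

lemma crossT_four (p q s t : ℕ) (a b c d e f g h : Fin m) :
    E (crossT r p a b * (crossT r q c d * (crossT r s e f * crossT r t g h))) =
      cmat m a b * psum r p * E (crossT r q c d * (crossT r s e f * crossT r t g h))
      + (cmat m a c * E (crossT r (q + p) b d * (crossT r s e f * crossT r t g h))
        + cmat m a d * E (crossT r (q + p) b c * (crossT r s e f * crossT r t g h)))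
      + (cmat m a e * E (crossT r q c d * (crossT r (s + p) b f * crossT r t g h))
        + cmat m a f * E (crossT r q c d * (crossT r (s + p) b e * crossT r t g h)))
      + (cmat m a g * E (crossT r q c d * (crossT r s e f * crossT r (t + p) b h))
        + cmat m a h * E (crossT r q c d * (crossT r s e f * crossT r (t + p) b g))) := by
  have h : crossD r p a b (crossT r q c d * (crossT r s e f * crossT r t g h)) =
      C (cmat m a c) * (crossT r (q + p) b d * (crossT r s e f * crossT r t g h))
      + C (cmat m a d) * (crossT r (q + p) b c * (crossT r s e f * crossT r t g h))
      + C (cmat m a e) * (crossT r q c d * (crossT r (s + p) b f * crossT r t g h))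
      + C (cmat m a f) * (crossT r q c d * (crossT r (s + p) b e * crossT r t g h))
      + C (cmat m a g) * (crossT r q c d * (crossT r s e f * crossT r (t + p) b h))
      + C (cmat m a h) * (crossT r q c d * (crossT r s e f * crossT r (t + p) b g)) := by
    rw [Derivation.leibniz, Derivation.leibniz, crossD_crossT, crossD_crossT, crossD_crossT]
    simp only [smul_eq_mul]
    ring
  rw [hE.crossT_mul, h]
  simp only [map_add, map_C_mul_apply]
  ring

/-- All Wick pairings are collected as a polynomial in the covariances, valid for equal and distinct
rows alike. The two cases are separated only when the formula is summed. -/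
lemma sq_mul_sq (a b : Fin m) :
    E (crossT r 1 a a ^ 2 * crossT r 1 b b ^ 2) =
      (cmat m a a * cmat m b b) ^ 2 * psum r 1 ^ 4
      + (4 * (cmat m a a * cmat m b b) ^ 2 + 8 * (cmat m a a * cmat m b b) * cmat m a b ^ 2) *
        (psum r 1 ^ 2 * psum r 2)
      + (4 * (cmat m a a * cmat m b b) ^ 2 + 8 * cmat m a b ^ 4) * psum r 2 ^ 2
      + 32 * (cmat m a a * cmat m b b) * cmat m a b ^ 2 * (psum r 3 * psum r 1)
      + 16 * (2 * (cmat m a a * cmat m b b) * cmat m a b ^ 2 + cmat m a b ^ 4) * psum r 4 := by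
  have : crossT r 1 a a ^ 2 * crossT r 1 b b ^ 2 =
    crossT r 1 a a * (crossT r 1 a a * (crossT r 1 b b * crossT r 1 b b)) := by ring
  rw [this, hE.crossT_four]
  simp only [hE.crossT_three, hE.crossT_two, cmat_comm b a, Nat.reduceAdd]
  ring

lemma totT_sq (hm : m ≠ 0) :
    E (totT r 1 ^ 2) = (m - 1) ^ 2 * psum r 1 ^ 2 + 2 * (m - 1) * psum r 2 := by
  have h1 : ∀ p, E (totT r p) = (m - 1) * psum r p := by
    intro p
    have := hE.totT_mul r hm p 1
    simpa [hE.one] using this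
  rw [pow_two, hE.totT_mul r hm, totD_totT, h1, show (2 : MvPolynomial (Fin m × Fin k) ℝ) = C 2 from
    (map_ofNat C 2).symm, map_C_mul_apply, h1]
  ring

lemma totT_pow_four (hm : m ≠ 0) :
    E (totT r 1 ^ 4) = (m - 1) ^ 4 * psum r 1 ^ 4 + 12 * (m - 1) ^ 3 * (psum r 1 ^ 2 * psum r 2)
      + 12 * (m - 1) ^ 2 * psum r 2 ^ 2 + 32 * (m - 1) ^ 2 * (psum r 3 * psum r 1)
      + 48 * (m - 1) * psum r 4 := by
  have h1 : ∀ p, E (totT r p) = (m - 1) * psum r p := by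
    intro p
    have := hE.totT_mul r hm p 1
    simpa [hE.one] using this
  have h2 : ∀ p q, E (totT r p * totT r q) = (m - 1) * psum r p * ((m - 1) * psum r q)
      + 2 * ((m - 1) * psum r (q + p)) := by
    intro p q
    rw [hE.totT_mul r hm, totD_totT, show (2 : MvPolynomial (Fin m × Fin k) ℝ) = C 2 from (map_ofNat C 2).symm,
      map_C_mul_apply, h1, h1]
  have h3 : ∀ p q s, E (totT r p * (totT r q * totT r s)) =
      (m - 1) * psum r p * E (totT r q * totT r s) + 2 * E (totT r q * totT r (s + p))
      + 2 * E (totT r s * totT r (q + p)) := by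
    intro p q s
    have h : totD r p (totT r q * totT r s) = C 2 * (totT (m := m) r q * totT r (s + p))
        + C 2 * (totT r s * totT r (q + p)) := by
      rw [Derivation.leibniz, totD_totT, totD_totT, smul_eq_mul, smul_eq_mul,
        show (C 2 : MvPolynomial (Fin m × Fin k) ℝ) = 2 from map_ofNat C 2]
      ring
    rw [hE.totT_mul r hm, h, map_add, map_C_mul_apply, map_C_mul_apply]
    ring
  -- The factor 6 is three choices of a factor times the 2 from the Euler operator.
  have h : totD r 1 (totT r 1 * (totT r 1 * totT r 1)) =
      C 6 * (totT (m := m) r 2 * (totT r 1 * totT r 1)) := by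
    rw [Derivation.leibniz, Derivation.leibniz, totD_totT]
    simp only [smul_eq_mul]
    rw [show (C 6 : MvPolynomial (Fin m × Fin k) ℝ) = 6 from map_ofNat C 6]
    ring
  rw [show totT (m := m) r 1 ^ 4 = totT r 1 * (totT r 1 * (totT r 1 * totT r 1)) by ring,
    hE.totT_mul r hm, h, map_C_mul_apply, h3, h3]
  simp only [h2, Nat.reduceAdd]
  ring

lemma sum_sq : E (∑ a : Fin m, crossT r 1 a a ^ 2) =
    m * (1 - 1 / (m : ℝ)) ^ 2 * (psum r 1 ^ 2 + 2 * psum r 2) := by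
  simp_rw [map_sum, pow_two, hE.crossT_two, cmat_self]
  simp
  ring

/-- Since `totD` preserves row indices, both total factors can be removed before any product of two
different rows appears. The mixed moment then reduces to moments within a single row. -/
lemma totT_sq_mul_sum_sq (hm : m ≠ 0) :
    E (totT r 1 ^ 2 * ∑ a : Fin m, crossT r 1 a a ^ 2) = m * (1 - 1 / (m : ℝ)) ^ 2 *
      ((m - 1) ^ 2 * psum r 1 ^ 4 + (2 * (m - 1) ^ 2 + 10 * (m - 1)) * (psum r 1 ^ 2 * psum r 2)
      + (4 * (m - 1) + 8) * psum r 2 ^ 2 + (16 * (m - 1) + 16) * (psum r 3 * psum r 1)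
      + 48 * psum r 4) := by
  have hc : ∀ p q, E (∑ a : Fin m, crossT r p a a * crossT r q a a) =
      m * (1 - 1 / (m : ℝ)) ^ 2 * (psum r p * psum r q + 2 * psum r (q + p)) := by
    intro p q
    simp_rw [map_sum, hE.crossT_two, cmat_self]
    simp
    ring
  have hD : ∀ s p q, totD r s (∑ a : Fin m, crossT r p a a * crossT r q a a) =
      C 2 * (∑ a : Fin m, crossT r p a a * crossT r (q + s) a a)
      + C 2 * (∑ a : Fin m, crossT r (p + s) a a * crossT r q a a) := by
    intro s p q
    rw [map_sum, Finset.mul_sum, Finset.mul_sum, ← Finset.sum_add_distrib]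
    refine Finset.sum_congr rfl fun a _ => ?_
    rw [Derivation.leibniz, totD_crossT, totD_crossT, smul_eq_mul, smul_eq_mul,
      show (C 2 : MvPolynomial (Fin m × Fin k) ℝ) = 2 from map_ofNat C 2]
    ring
  have h1 : ∀ s p q, E (totT r s * ∑ a : Fin m, crossT r p a a * crossT r q a a) =
      (m - 1) * psum r s * E (∑ a : Fin m, crossT r p a a * crossT r q a a)
      + 2 * E (∑ a : Fin m, crossT r p a a * crossT r (q + s) a a)
      + 2 * E (∑ a : Fin m, crossT r (p + s) a a * crossT r q a a) := by
    intro s p q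
    rw [hE.totT_mul r hm, hD, map_add, map_C_mul_apply, map_C_mul_apply]
    ring
  have h2 : totD r 1 (totT r 1 * ∑ a : Fin m, crossT r 1 a a * crossT r 1 a a) =
      C 2 * (totT r 2 * ∑ a : Fin m, crossT r 1 a a * crossT r 1 a a)
      + C 2 * (totT r 1 * ∑ a : Fin m, crossT r 1 a a * crossT r 2 a a)
      + C 2 * (totT r 1 * ∑ a : Fin m, crossT r 2 a a * crossT r 1 a a) := by
    rw [Derivation.leibniz, totD_totT, hD, smul_eq_mul, smul_eq_mul,
      show (C 2 : MvPolynomial (Fin m × Fin k) ℝ) = 2 from map_ofNat C 2]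
    ring
  simp_rw [pow_two (crossT r 1 _ _)]
  rw [pow_two (totT r 1), mul_assoc, hE.totT_mul r hm, h2]
  simp only [map_add, map_C_mul_apply, h1, hc, Nat.reduceAdd]
  ring

omit hE in
lemma sum_sq_sq (E : MvPolynomial (Fin m × Fin k) ℝ →ₗ[ℝ] ℝ) : E ((∑ a : Fin m, crossT r 1 a a ^ 2) ^ 2) =
    ∑ a : Fin m, ∑ b : Fin m, E (crossT r 1 a a ^ 2 * crossT r 1 b b ^ 2) := by
  rw [pow_two, Finset.sum_mul_sum, map_sum]
  simp_rw [map_sum]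

lemma sum_sq_sq_eq : E ((∑ a : Fin m, crossT r 1 a a ^ 2) ^ 2) =
    m * ((1 - 1 / (m : ℝ)) ^ 4 * (psum r 1 ^ 4 + 12 * (psum r 1 ^ 2 * psum r 2) + 12 * psum r 2 ^ 2
      + 32 * (psum r 3 * psum r 1) + 48 * psum r 4))
    + m * (m - 1) * ((1 - 1 / (m : ℝ)) ^ 4 * psum r 1 ^ 4
      + (4 * (1 - 1 / (m : ℝ)) ^ 4 + 8 * (1 - 1 / (m : ℝ)) ^ 2 * (1 / (m : ℝ)) ^ 2) *
        (psum r 1 ^ 2 * psum r 2)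
      + (4 * (1 - 1 / (m : ℝ)) ^ 4 + 8 * (1 / (m : ℝ)) ^ 4) * psum r 2 ^ 2
      + 32 * (1 - 1 / (m : ℝ)) ^ 2 * (1 / (m : ℝ)) ^ 2 * (psum r 3 * psum r 1)
      + 16 * (2 * (1 - 1 / (m : ℝ)) ^ 2 * (1 / (m : ℝ)) ^ 2 + (1 / (m : ℝ)) ^ 4) * psum r 4) := by
  rw [sum_sq_sq]
  -- The centring matrix has one value on the diagonal and one off it, so the double sum has m equal
  -- diagonal terms and m(m-1) equal off-diagonal ones.
  have hsum : ∀ u v : ℝ, ∑ a : Fin m, ∑ b : Fin m, (if a = b then u else v) =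
      m * u + m * (m - 1) * v := by
    intro u v
    have h : ∀ a b : Fin m, (if a = b then u else v) = (if a = b then u - v else 0) + v := by
      intro a b
      split_ifs <;> ring
    simp_rw [h, Finset.sum_add_distrib]
    simp
    ring
  rw [← hsum]
  refine Finset.sum_congr rfl fun a _ => Finset.sum_congr rfl fun b _ => ?_
  rw [hE.sq_mul_sq, cmat_self, cmat_self]
  split_ifs with hab
  · subst hab
    rw [cmat_self]
    ring
  · rw [cmat_ne hab]
    ring

/-- Here E t₂ = R₁² + 2R₂ and E t₁² = R₁² + 2R₂/(m-1). The two weights in the estimator are exactly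
those that turn this pair into R₂/k - R₁²/k². -/
lemma sLim_mean (hm : 3 ≤ m) (hk : 1 ≤ k) :
    E (sLim r) = psum r 2 / k - psum r 1 ^ 2 / k ^ 2 := by
  have hm' : (3 : ℝ) ≤ m := by exact_mod_cast hm
  have h0 : (m : ℝ) ≠ 0 := by positivity
  have h1 : (m : ℝ) - 1 ≠ 0 := by linarith
  have h2 : (m : ℝ) - 2 ≠ 0 := by linarith
  have h3 : (k : ℝ) ≠ 0 := by positivity
  rw [sLim, tOne, tTwo, mul_pow, ← C_pow, map_sub, map_C_mul_apply, map_C_mul_apply, map_C_mul_apply, map_C_mul_apply,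
    hE.totT_sq r (by omega), hE.sum_sq]
  field_simp
  ring

lemma sLim_sq (hm : 3 ≤ m) (hk : 1 ≤ k) :
    E (sLim r ^ 2) = exactVar k m (psum r) + (psum r 2 / k - psum r 1 ^ 2 / k ^ 2) ^ 2 := by
  have hm' : (3 : ℝ) ≤ m := by exact_mod_cast hm
  have h0 : (m : ℝ) ≠ 0 := by positivity
  have h1 : (m : ℝ) - 1 ≠ 0 := by linarith
  have h2 : (m : ℝ) - 2 ≠ 0 := by linarith
  have h3 : (k : ℝ) ≠ 0 := by positivity
  -- Expanding with opaque coefficients leaves exactly the three moments of degree eight computed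
  -- above.
  have key : ∀ (a b c d : ℝ) (t q : MvPolynomial (Fin m × Fin k) ℝ),
      (C a * (C b * q) - C c * (C d * t) ^ 2) ^ 2 =
        C ((a * b) ^ 2) * q ^ 2 - C (2 * (a * b) * (c * d ^ 2)) * (t ^ 2 * q)
          + C ((c * d ^ 2) ^ 2) * t ^ 4 := by
    intro a b c d t q
    simp only [C_mul, C_pow, show (C 2 : MvPolynomial (Fin m × Fin k) ℝ) = 2 from map_ofNat C 2]
    ring
  rw [sLim, tOne, tTwo, key, map_add, map_sub, map_C_mul_apply, map_C_mul_apply, map_C_mul_apply,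
    hE.totT_pow_four r (by omega), hE.totT_sq_mul_sum_sq r (by omega), hE.sum_sq_sq_eq r,
    exactVar]
  field_simp
  ring

end IsGaussFunctional
end Wick

/-! ### The standard Gaussian functional on polynomials -/

section GaussianFunctional

open MvPolynomial

lemma integrable_pow_gaussianReal (n : ℕ) : Integrable (fun x : ℝ => x ^ n) (gaussianReal 0 1) := by
  rcases Nat.eq_zero_or_pos n with rfl | hn
  · simp
  · have h := (memLp_id_gaussianReal (μ := 0) (v := 1) n).integrable_norm_rpow
      (by simpa using hn.ne') (by simp)
    have h' := h.congr (g := fun x : ℝ => ‖x ^ n‖) (by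
      filter_upwards with x
      simp)
    exact (integrable_norm_iff (by fun_prop)).1 h'

/-- The derivative of x^n times the density integrates to zero. For n = 0 the truncated exponent n -
1 does no harm, since its coefficient vanishes. -/
lemma integral_pow_succ_gaussianReal (n : ℕ) :
    ∫ x : ℝ, x ^ (n + 1) ∂gaussianReal 0 1 = n * ∫ x : ℝ, x ^ (n - 1) ∂gaussianReal 0 1 := by
  have hint : ∀ n : ℕ, Integrable (fun x : ℝ => gaussianPDFReal 0 1 x * x ^ n) := by
    intro n
    have := integrable_pow_gaussianReal n
    rw [gaussianReal_of_var_ne_zero _ one_ne_zero, gaussianPDF_def,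
      integrable_withDensity_iff_integrable_smul' (by fun_prop) (by simp)] at this
    refine this.congr ?_
    filter_upwards with x
    simp [ENNReal.toReal_ofReal (gaussianPDFReal_nonneg 0 1 x)]
  have hder : ∀ x : ℝ, HasDerivAt (fun x : ℝ => gaussianPDFReal 0 1 x * x ^ n)
      (n * (gaussianPDFReal 0 1 x * x ^ (n - 1)) - gaussianPDFReal 0 1 x * x ^ (n + 1)) x := by
    intro x
    have h1 : HasDerivAt (gaussianPDFReal 0 1) (gaussianPDFReal 0 1 x * (- x)) x := by
      have h2 : HasDerivAt (fun x : ℝ => - (x - 0) ^ 2 / (2 * ((1 : NNReal) : ℝ))) (-x) x := by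
        have := (((hasDerivAt_id x).sub_const 0).pow 2).neg.div_const (2 * ((1 : NNReal) : ℝ))
        refine this.congr_deriv ?_
        simp
        ring
      have := (h2.exp).const_mul (√(2 * Real.pi * ((1 : NNReal) : ℝ)))⁻¹
      rw [gaussianPDFReal_def]
      refine this.congr_deriv ?_
      ring
    refine (h1.mul (hasDerivAt_pow n x)).congr_deriv ?_
    ring
  have h0 := integral_eq_zero_of_hasDerivAt_of_integrable hder
    (((hint (n - 1)).const_mul _).sub (hint (n + 1))) (hint n)
  rw [integral_sub ((hint (n - 1)).const_mul _) (hint (n + 1)), integral_const_mul] at h0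
  rw [integral_gaussianReal_eq_integral_smul one_ne_zero,
    integral_gaussianReal_eq_integral_smul one_ne_zero]
  simp only [smul_eq_mul]
  linarith

variable {ι : Type*} [Fintype ι]

lemma eval_monomial_eq_prod (s : ι →₀ ℕ) (x : ι → ℝ) :
    eval x (monomial s 1) = ∏ i, x i ^ s i := by
  rw [eval_monomial, one_mul, Finsupp.prod_fintype _ _ (by simp)]

lemma integrable_eval_gaussian (F : MvPolynomial ι ℝ) :
    Integrable (fun x => eval x F) (Measure.pi fun _ : ι => gaussianReal 0 1) := by
  induction F using MvPolynomial.induction_on' with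
  | monomial s a =>
    have h : (fun x : ι → ℝ => eval x (monomial s a)) = fun x => a * ∏ i, x i ^ s i := by
      ext x
      rw [eval_monomial, Finsupp.prod_fintype _ _ (by simp)]
    rw [h]
    exact (Integrable.fintype_prod (f := fun i (x : ℝ) => x ^ s i)
      fun i => integrable_pow_gaussianReal _).const_mul a
  | add p q hp hq => simpa only [map_add] using! hp.add hq

/-- Expectation of a polynomial in independent standard Gaussian variables. -/
def gaussE (ι : Type*) [Fintype ι] : MvPolynomial ι ℝ →ₗ[ℝ] ℝ where
  toFun F := ∫ x, eval x F ∂Measure.pi fun _ : ι => gaussianReal 0 1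
  map_add' F G := by
    simp only [map_add]
    exact integral_add (integrable_eval_gaussian F) (integrable_eval_gaussian G)
  map_smul' c F := by
    simp [smul_eval, integral_const_mul]

lemma gaussE_monomial (s : ι →₀ ℕ) :
    gaussE ι (monomial s 1) = ∏ i, ∫ x : ℝ, x ^ s i ∂gaussianReal 0 1 := by
  simp only [gaussE, LinearMap.coe_mk, AddHom.coe_mk, eval_monomial_eq_prod]
  exact integral_fintype_prod_eq_prod fun i (x : ℝ) => x ^ s i

/-- By linearity monomials suffice. Their expectations factor over coordinates, and only coordinate
`i` changes on the two sides, so the one-dimensional moment recursion is enough. -/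
lemma isGaussFunctional_gaussE : IsGaussFunctional (gaussE ι) where
  one := by simp [gaussE]
  stein i F := by
    classical
    induction F using MvPolynomial.induction_on' with
    | monomial s a =>
      have h1 : monomial s a = a • monomial s (1 : ℝ) := by simp [smul_monomial]
      have h2 : (X i : MvPolynomial ι ℝ) * monomial s 1 = monomial (s + Finsupp.single i 1) 1 := by
        rw [X, monomial_mul, add_comm, one_mul]
      have h3 : pderiv i (monomial s (1 : ℝ)) = (s i : ℝ) • monomial (s - Finsupp.single i 1) 1 := by
        rw [pderiv_monomial, smul_monomial]
        simp
      rw [h1, mul_smul_comm, map_smul, Derivation.map_smul, map_smul, h2, h3, map_smul, gaussE_monomial,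
        gaussE_monomial]
      congr 1
      have h4 : ∀ t : ι →₀ ℕ, ∏ j, ∫ x : ℝ, x ^ t j ∂gaussianReal 0 1 =
          (∫ x : ℝ, x ^ t i ∂gaussianReal 0 1) *
            ∏ j ∈ Finset.univ.erase i, ∫ x : ℝ, x ^ t j ∂gaussianReal 0 1 :=
        fun t => (Finset.mul_prod_erase _ _ (Finset.mem_univ i)).symm
      rw [h4, h4 (s - _), smul_eq_mul, ← mul_assoc]
      congr 1
      · simp [integral_pow_succ_gaussianReal]
      · refine Finset.prod_congr rfl fun j hj => ?_
        have hj' : i ≠ j := (Finset.ne_of_mem_erase hj).symm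
        simp [hj']
    | add p q hp hq => simp [mul_add, hp, hq]

end GaussianFunctional

/-! ### Convergence of moments under uniform integrability -/

section MomentConvergence

variable {m : ℕ}

/-- Continuous cutoff, equal to `1` on the ball of radius `C` and to `0` off the ball of radius
`C + 1`. -/
def cutoff (C : ℝ) (t : Fin m → ℝ) : ℝ := max 0 (min 1 (C + 1 - ‖t‖))

lemma continuous_cutoff (C : ℝ) : Continuous (cutoff (m := m) C) := by
  unfold cutoff; fun_prop

lemma cutoff_nonneg (C : ℝ) (t : Fin m → ℝ) : 0 ≤ cutoff C t := le_max_left _ _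

lemma cutoff_le_one (C : ℝ) (t : Fin m → ℝ) : cutoff C t ≤ 1 :=
  max_le zero_le_one (min_le_left _ _)

lemma cutoff_eq_one {C : ℝ} {t : Fin m → ℝ} (h : ‖t‖ ≤ C) : cutoff C t = 1 := by
  rw [cutoff, min_eq_left (by linarith), max_eq_right zero_le_one]

lemma cutoff_eq_zero {C : ℝ} {t : Fin m → ℝ} (h : C + 1 < ‖t‖) : cutoff C t = 0 := by
  rw [cutoff, max_eq_left]
  exact (min_le_right _ _).trans (by linarith)

lemma hasCompactSupport_cutoff_mul (C : ℝ) (G : (Fin m → ℝ) → ℝ) :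
    HasCompactSupport fun t => cutoff C t * G t := by
  refine HasCompactSupport.intro (isCompact_closedBall (0 : Fin m → ℝ) (C + 1)) fun t ht => ?_
  rw [mem_closedBall_zero_iff, not_le] at ht
  rw [cutoff_eq_zero ht, zero_mul]

variable {Ω : ℕ → Type*} [∀ n, MeasurableSpace (Ω n)] {P : ∀ n, Measure (Ω n)}
  [∀ n, IsProbabilityMeasure (P n)]

/-- A Slutsky step for variables on changing probability spaces. Where the two variables are close,
uniform continuity bounds the difference; elsewhere boundedness of `g` and the small probability do.
-/
lemma tendsto_integral_sub_of_uniformContinuous {F : Type*} [PseudoMetricSpace F]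
    [MeasurableSpace F] [OpensMeasurableSpace F]
    {T S : ∀ n, Ω n → F} (hT : ∀ n, Measurable (T n)) (hS : ∀ n, Measurable (S n))
    (hTS : ∀ ε : ℝ, 0 < ε → Tendsto (fun n => P n {ω | ε ≤ dist (T n ω) (S n ω)}) atTop (𝓝 0))
    {g : F → ℝ} (hg : UniformContinuous g) {b : ℝ} (hb : ∀ x, |g x| ≤ b) :
    Tendsto (fun n => ∫ ω, g (T n ω) ∂P n - ∫ ω, g (S n ω) ∂P n) atTop (𝓝 0) := by
  have hint : ∀ {n} {U : Ω n → F}, Measurable U → Integrable (fun ω => g (U ω)) (P n) := by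
    intro n U hU
    refine Integrable.of_bound (hg.continuous.measurable.comp hU).aestronglyMeasurable b ?_
    filter_upwards with ω using by simpa using hb _
  rw [Metric.tendsto_atTop]
  intro ε hε
  obtain ⟨δ, hδ, hδ'⟩ := Metric.uniformContinuous_iff.1 hg (ε / 2) (by positivity)
  have hb0 : 0 ≤ b ∨ IsEmpty F := by
    rcases isEmpty_or_nonempty F with h | ⟨⟨x⟩⟩
    · exact Or.inr h
    · exact Or.inl ((abs_nonneg _).trans (hb x))
  have hev := (ENNReal.tendsto_nhds_zero.1 (hTS δ hδ))
    -- The bad event contributes at most its probability times 2|b|, which this bound keeps below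
    -- ε/2. The added 1 covers b = 0.
    (ENNReal.ofReal (ε / (4 * (|b| + 1)))) (by simp; positivity)
  obtain ⟨N, hN⟩ := eventually_atTop.1 hev
  refine ⟨N, fun n hn => ?_⟩
  -- Without second countability of `F` the distance need not be measurable, so a measurable hull of
  -- the same measure replaces the bad event.
  set A := toMeasurable (P n) {ω | δ ≤ dist (T n ω) (S n ω)} with hA
  have hAm : MeasurableSet A := measurableSet_toMeasurable _ _
  have hPA : (P n).real A ≤ ε / (4 * (|b| + 1)) := by
    refine ENNReal.toReal_le_of_le_ofReal (by positivity) ?_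
    rw [hA, measure_toMeasurable]
    exact hN n hn
  rw [dist_zero_right, ← integral_sub (hint (hT n)) (hint (hS n))]
  have hle : ∀ ω, ‖g (T n ω) - g (S n ω)‖ ≤ ε / 2 + A.indicator (fun _ => 2 * |b|) ω := by
    intro ω
    by_cases h : ω ∈ A
    · rw [Set.indicator_of_mem h, Real.norm_eq_abs]
      have h1 := abs_sub (g (T n ω)) (g (S n ω))
      have := hb (T n ω); have := hb (S n ω); have := le_abs_self b
      linarith
    · rw [Set.indicator_of_notMem h, add_zero]
      have : ¬ δ ≤ dist (T n ω) (S n ω) := fun h' => h (subset_toMeasurable _ _ h')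
      exact (hδ' (not_le.1 this)).le
  calc ‖∫ ω, g (T n ω) - g (S n ω) ∂P n‖
      ≤ ∫ ω, ε / 2 + A.indicator (fun _ => 2 * |b|) ω ∂P n :=
        norm_integral_le_of_norm_le
          ((integrable_const _).add ((integrable_const _).indicator hAm))
          (Eventually.of_forall hle)
    _ = ε / 2 + (P n).real A * (2 * |b|) := by
        rw [integral_add (integrable_const _) ((integrable_const _).indicator hAm),
          integral_indicator_const _ hAm]
        simp
    _ ≤ ε / 2 + ε / (4 * (|b| + 1)) * (2 * |b|) := by gcongr
    _ < ε := by
        have : ε / (4 * (|b| + 1)) * (2 * |b|) = ε / 2 * (|b| / (|b| + 1)) := by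
          field_simp
          ring
        rw [this]
        have : |b| / (|b| + 1) < 1 := by
          rw [div_lt_one (by positivity)]; linarith
        nlinarith

/-- Uniform integrability of the fourth powers along `n ≥ 1`. -/
def UIFour (P : ∀ n, Measure (Ω n)) (T : ∀ n, Ω n → ℝ) : Prop :=
  Tendsto (fun C : ℝ => ⨆ (n : ℕ) (_ : 1 ≤ n),
    ∫⁻ ω in {ω | C < |T n ω|}, ENNReal.ofReal (T n ω ^ 4) ∂P n) atTop (𝓝 0)

lemma UIFour.integrable {T : ∀ n, Ω n → ℝ} (h : UIFour P T) (hT : ∀ n, Measurable (T n)) {n : ℕ}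
    (hn : 1 ≤ n) : Integrable (fun ω => T n ω ^ 4) (P n) := by
  obtain ⟨C, hC⟩ := ((ENNReal.tendsto_nhds_zero.1 h) 1 one_pos).exists
  have hC' : ∫⁻ ω in {ω | C < |T n ω|}, ENNReal.ofReal (T n ω ^ 4) ∂P n ≤ 1 :=
    (le_iSup₂ (f := fun (n : ℕ) (_ : 1 ≤ n) =>
      ∫⁻ ω in {ω | C < |T n ω|}, ENNReal.ofReal (T n ω ^ 4) ∂P n) n hn).trans hC
  have hm : MeasurableSet {ω | C < |T n ω|} := measurableSet_lt measurable_const (hT n).abs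
  refine ⟨((hT n).pow_const 4).aestronglyMeasurable, ?_⟩
  rw [hasFiniteIntegral_iff_ofReal (Eventually.of_forall fun ω => by positivity),
    ← lintegral_add_compl _ hm]
  refine ENNReal.add_lt_top.2 ⟨hC'.trans_lt (by simp), ?_⟩
  calc ∫⁻ ω in {ω | C < |T n ω|}ᶜ, ENNReal.ofReal (T n ω ^ 4) ∂P n
      ≤ ∫⁻ ω in {ω | C < |T n ω|}ᶜ, ENNReal.ofReal (C ^ 4) ∂P n := by
        refine setLIntegral_mono measurable_const fun ω hω => ?_
        refine ENNReal.ofReal_le_ofReal ?_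
        rw [← Even.pow_abs (by decide : Even 4)]
        exact pow_le_pow_left₀ (abs_nonneg _) (not_lt.1 (show ¬ C < |T n ω| from hω)) 4
    _ < ∞ := by
        rw [setLIntegral_const]
        exact ENNReal.mul_lt_top (by simp) (measure_lt_top _ _)

/-- Where the cutoff acts, the largest coordinate exceeds C ≥ 1 in absolute value. Its fourth power
then dominates the constant 1 and all other fourth powers in the growth bound. -/
lemma cutoff_error {G : (Fin m → ℝ) → ℝ} {K : ℝ} (hK : 0 ≤ K)
    (hGK : ∀ t, |G t| ≤ K * (1 + ∑ ℓ, t ℓ ^ 4)) {C : ℝ} (hC : 1 ≤ C) (t : Fin m → ℝ) :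
    |G t - cutoff C t * G t| ≤ K * (1 + m) * ∑ ℓ, if C < |t ℓ| then t ℓ ^ 4 else 0 := by
  have hnn : ∀ ℓ, 0 ≤ if C < |t ℓ| then t ℓ ^ 4 else 0 := fun ℓ => by split_ifs <;> positivity
  by_cases h : ‖t‖ ≤ C
  · rw [cutoff_eq_one h, one_mul, sub_self, abs_zero]
    exact mul_nonneg (by positivity) (Finset.sum_nonneg fun ℓ _ => hnn ℓ)
  · rw [not_le] at h
    obtain ⟨ℓ, hℓ⟩ : ∃ ℓ, C < |t ℓ| := by
      by_contra! hcon
      exact absurd ((pi_norm_le_iff_of_nonneg (by linarith)).2 hcon) (not_le.2 h)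
    have hne : (Finset.univ : Finset (Fin m)).Nonempty := ⟨ℓ, Finset.mem_univ _⟩
    obtain ⟨j, -, hj⟩ := Finset.exists_max_image Finset.univ (fun ℓ => |t ℓ|) hne
    have hCj : C < |t j| := hℓ.trans_le (hj ℓ (Finset.mem_univ _))
    have h4 : ∀ i, t i ^ 4 ≤ t j ^ 4 := by
      intro i
      rw [← Even.pow_abs (by decide : Even 4) (t i), ← Even.pow_abs (by decide : Even 4) (t j)]
      exact pow_le_pow_left₀ (abs_nonneg _) (hj i (Finset.mem_univ _)) 4
    have h1 : 1 ≤ t j ^ 4 := by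
      rw [← Even.pow_abs (by decide : Even 4) (t j)]
      exact one_le_pow₀ (hC.trans hCj.le)
    have h5 : t j ^ 4 ≤ ∑ ℓ, if C < |t ℓ| then t ℓ ^ 4 else 0 := by
      refine le_trans ?_ (Finset.single_le_sum (fun i _ => hnn i) (Finset.mem_univ j))
      rw [if_pos hCj]
    have h6 : |G t - cutoff C t * G t| ≤ |G t| := by
      rw [show G t - cutoff C t * G t = (1 - cutoff C t) * G t by ring, abs_mul]
      refine mul_le_of_le_one_left (abs_nonneg _) ?_
      rw [abs_of_nonneg (by linarith [cutoff_le_one C t])]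
      linarith [cutoff_nonneg C t]
    calc |G t - cutoff C t * G t| ≤ K * (1 + ∑ ℓ, t ℓ ^ 4) := h6.trans (hGK t)
      _ ≤ K * (t j ^ 4 + ∑ _ℓ : Fin m, t j ^ 4) := by
          refine mul_le_mul_of_nonneg_left (add_le_add h1 ?_) hK
          exact Finset.sum_le_sum fun i _ => h4 i
      _ = K * (1 + m) * t j ^ 4 := by simp; ring
      _ ≤ _ := by gcongr

/-- After truncation the test function has compact support, hence is bounded and uniformly
continuous, so `T` may be replaced by Φ(Y) and weak convergence of `Y` applies. Uniform
integrability removes the truncation uniformly in n, and dominated convergence removes it in the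
limit. -/
theorem tendsto_integral_of_uiFour {E : Type*} [TopologicalSpace E] [MeasurableSpace E]
    [BorelSpace E] {T : ∀ n, Ω n → Fin m → ℝ} (hT : ∀ n, Measurable (T n))
    {Y : ∀ n, Ω n → E} (hY : ∀ n, Measurable (Y n)) {ν : Measure E} [IsProbabilityMeasure ν]
    (hYν : ∀ g : BoundedContinuousFunction E ℝ,
      Tendsto (fun n => ∫ ω, g (Y n ω) ∂P n) atTop (𝓝 (∫ y, g y ∂ν)))
    {Φ : E → Fin m → ℝ} (hΦ : Continuous Φ)
    (hTΦ : ∀ ε : ℝ, 0 < ε → Tendsto (fun n => P n {ω | ε ≤ dist (T n ω) (Φ (Y n ω))}) atTop (𝓝 0))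
    (hui : ∀ ℓ, UIFour P fun n ω => T n ω ℓ)
    {G : (Fin m → ℝ) → ℝ} (hG : Continuous G) {K : ℝ} (hK : 0 ≤ K)
    (hGK : ∀ t, |G t| ≤ K * (1 + ∑ ℓ, t ℓ ^ 4)) (hint : Integrable (fun y => G (Φ y)) ν) :
    Tendsto (fun n => ∫ ω, G (T n ω) ∂P n) atTop (𝓝 (∫ y, G (Φ y) ∂ν)) := by
  have hTm : ∀ n ℓ, Measurable fun ω => T n ω ℓ := fun n ℓ => (measurable_pi_apply ℓ).comp (hT n)
  -- truncated functionals
  have htrunc : ∀ C, Tendsto (fun n => ∫ ω, cutoff C (T n ω) * G (T n ω) ∂P n) atTop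
      (𝓝 (∫ y, cutoff C (Φ y) * G (Φ y) ∂ν)) := by
    intro C
    have hcont : Continuous fun t => cutoff C t * G t := (continuous_cutoff C).mul hG
    have hcs := hasCompactSupport_cutoff_mul C G
    obtain ⟨b, hb⟩ := hcs.exists_bound_of_continuous hcont
    have huc := hcs.uniformContinuous_of_continuous hcont
    have h1 := tendsto_integral_sub_of_uniformContinuous (P := P) hT
      (fun n => hΦ.measurable.comp (hY n)) hTΦ huc hb
    have h2 := hYν (BoundedContinuousFunction.ofNormedAddCommGroup
      (fun y => cutoff C (Φ y) * G (Φ y)) (hcont.comp hΦ) b fun y => hb _)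
    simpa using h1.add h2
  -- limit of the truncated integrals
  have hlim : Tendsto (fun C : ℝ => ∫ y, cutoff C (Φ y) * G (Φ y) ∂ν) atTop
      (𝓝 (∫ y, G (Φ y) ∂ν)) := by
    refine tendsto_integral_filter_of_dominated_convergence (fun y => ‖G (Φ y)‖) ?_ ?_ hint.norm ?_
    · exact Eventually.of_forall fun C =>
        (((continuous_cutoff C).comp hΦ).mul (hG.comp hΦ)).aestronglyMeasurable
    · refine Eventually.of_forall fun C => Eventually.of_forall fun y => ?_
      rw [norm_mul, Real.norm_of_nonneg (cutoff_nonneg _ _)]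
      exact mul_le_of_le_one_left (norm_nonneg _) (cutoff_le_one _ _)
    · refine Eventually.of_forall fun y => ?_
      refine tendsto_const_nhds.congr' ?_
      filter_upwards [eventually_ge_atTop ‖Φ y‖] with C hC
      rw [cutoff_eq_one hC, one_mul]
  -- uniform tail estimate
  have hGint : ∀ n, 1 ≤ n → Integrable (fun ω => G (T n ω)) (P n) := by
    intro n hn
    refine Integrable.mono' (g := fun ω => K * (1 + ∑ ℓ, T n ω ℓ ^ 4)) ?_
      (hG.measurable.comp (hT n)).aestronglyMeasurable (Eventually.of_forall fun ω => hGK _)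
    exact ((integrable_const _).add (integrable_finsetSum _ fun ℓ _ =>
      (hui ℓ).integrable (fun n => hTm n ℓ) hn)).const_mul K
  have htail : ∀ ε : ℝ, 0 < ε → ∀ᶠ C : ℝ in atTop, ∀ n, 1 ≤ n →
      |∫ ω, G (T n ω) ∂P n - ∫ ω, cutoff C (T n ω) * G (T n ω) ∂P n| ≤ ε := by
    intro ε hε
    have hev : ∀ᶠ C : ℝ in atTop, ∀ ℓ : Fin m, (⨆ (n : ℕ) (_ : 1 ≤ n),
        ∫⁻ ω in {ω | C < |T n ω ℓ|}, ENNReal.ofReal (T n ω ℓ ^ 4) ∂P n) ≤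
          -- The first factor of the denominator absorbs the constant of `cutoff_error`, the second
          -- the sum over m coordinates.
          ENNReal.ofReal (ε / ((K * (1 + m) + 1) * (m + 1))) := by
      rw [eventually_all]
      intro ℓ
      exact (ENNReal.tendsto_nhds_zero.1 (hui ℓ)) _ (by simp; positivity)
    filter_upwards [hev, eventually_ge_atTop 1] with C hC hC1 n hn
    have hset : ∀ ℓ, MeasurableSet {ω | C < |T n ω ℓ|} := fun ℓ =>
      measurableSet_lt measurable_const (hTm n ℓ).abs
    have h4 : ∀ ℓ, Integrable (fun ω => T n ω ℓ ^ 4) (P n) := fun ℓ =>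
      (hui ℓ).integrable (fun n => hTm n ℓ) hn
    have hcint : Integrable (fun ω => cutoff C (T n ω) * G (T n ω)) (P n) := by
      refine (hGint n hn).norm.mono' (((continuous_cutoff C).mul hG).measurable.comp
        (hT n)).aestronglyMeasurable (Eventually.of_forall fun ω => ?_)
      rw [norm_mul, Real.norm_of_nonneg (cutoff_nonneg _ _)]
      exact mul_le_of_le_one_left (norm_nonneg _) (cutoff_le_one _ _)
    have hind : ∀ ℓ, (fun ω => if C < |T n ω ℓ| then T n ω ℓ ^ 4 else 0) =
        {ω | C < |T n ω ℓ|}.indicator fun ω => T n ω ℓ ^ 4 := by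
      intro ℓ; ext ω; simp [Set.indicator]
    have hsmall : ∀ ℓ, ∫ ω, (if C < |T n ω ℓ| then T n ω ℓ ^ 4 else 0) ∂P n ≤
        ε / ((K * (1 + m) + 1) * (m + 1)) := by
      intro ℓ
      rw [hind, integral_indicator (hset ℓ), integral_eq_lintegral_of_nonneg_ae
        (Eventually.of_forall fun ω => by positivity) (h4 ℓ).aestronglyMeasurable.restrict]
      refine ENNReal.toReal_le_of_le_ofReal (by positivity) ?_
      exact (le_iSup₂ (f := fun (n : ℕ) (_ : 1 ≤ n) =>
        ∫⁻ ω in {ω | C < |T n ω ℓ|}, ENNReal.ofReal (T n ω ℓ ^ 4) ∂P n) n hn).trans (hC ℓ)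
    have hii : ∀ ℓ ∈ Finset.univ, Integrable
        (fun ω => if C < |T n ω ℓ| then T n ω ℓ ^ 4 else 0) (P n) := by
      intro ℓ _
      rw [hind]
      exact (h4 ℓ).indicator (hset ℓ)
    rw [← integral_sub (hGint n hn) hcint]
    calc |∫ ω, G (T n ω) - cutoff C (T n ω) * G (T n ω) ∂P n|
        ≤ ∫ ω, K * (1 + m) * ∑ ℓ, (if C < |T n ω ℓ| then T n ω ℓ ^ 4 else 0) ∂P n := by
          rw [← Real.norm_eq_abs]
          exact norm_integral_le_of_norm_le ((integrable_finsetSum _ hii).const_mul _)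
            (Eventually.of_forall fun ω => cutoff_error hK hGK hC1 _)
      _ = K * (1 + m) * ∑ ℓ, ∫ ω, (if C < |T n ω ℓ| then T n ω ℓ ^ 4 else 0) ∂P n := by
          rw [integral_const_mul, integral_finsetSum _ hii]
      _ ≤ K * (1 + m) * ∑ _ℓ : Fin m, ε / ((K * (1 + m) + 1) * (m + 1)) := by
          gcongr with ℓ
          exact hsmall ℓ
      _ = ε * ((K * (1 + m)) / (K * (1 + m) + 1)) * (m / (m + 1)) := by
          simp
          field_simp
      _ ≤ ε * 1 * 1 := by
          gcongr
          · rw [div_le_one (by positivity)]; linarith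
          · rw [div_le_one (by positivity)]; linarith
      _ = ε := by ring
  rw [Metric.tendsto_atTop]
  intro ε hε
  have e1 := htail (ε / 4) (by positivity)
  have e2 := (Metric.tendsto_nhds.1 hlim) (ε / 4) (by positivity)
  obtain ⟨C, hC1, hC2⟩ := (e1.and e2).exists
  obtain ⟨N, hN⟩ := (Metric.tendsto_atTop.1 (htrunc C)) (ε / 4) (by positivity)
  -- The tail estimate is available only from n = 1 on.
  refine ⟨max N 1, fun n hn => ?_⟩
  have h1 := hC1 n ((le_max_right _ _).trans hn)
  have h2 := hN n ((le_max_left _ _).trans hn)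
  rw [Real.dist_eq] at h2 hC2 ⊢
  have h3 := abs_le.1 h1
  have h4 := abs_lt.1 h2
  have h5 := abs_lt.1 hC2
  rw [abs_lt]
  constructor <;> linarith [h3.1, h3.2, h4.1, h4.2, h5.1, h5.2]

end MomentConvergence

/-! ### Conditional independence and joint weak convergence -/

section CondIndep

/-- Independence under a kernel gives product formulas outside a null set that may depend on the
chosen sets. A countable generating algebra is a π-system, so countably many formulas suffice and a
single null set serves them all. -/
lemma ae_iIndepFun_of_kernel {α Ω ι : Type*} [Countable ι] {mα : MeasurableSpace α}
    {mΩ : MeasurableSpace Ω} {κ : Kernel α Ω} {μ : Measure α} {F : ι → Type*}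
    [∀ i, MeasurableSpace (F i)] [∀ i, MeasurableSpace.CountablyGenerated (F i)]
    {f : ∀ i, Ω → F i} (hf : ∀ i, Measurable (f i)) (h : Kernel.iIndepFun f κ μ) :
    ∀ᵐ a ∂μ, iIndepFun f (κ a) := by
  set Gen : ∀ i, Set (Set (F i)) := fun i =>
    generateSetAlgebra (MeasurableSpace.countableGeneratingSet (F i)) with hGen
  have hcount : ∀ i, (Gen i).Countable := fun i =>
    countable_generateSetAlgebra MeasurableSpace.countable_countableGeneratingSet
  have hgenF : ∀ i, MeasurableSpace.generateFrom (Gen i) = ‹∀ i, MeasurableSpace (F i)› i := fun i => by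
    rw [hGen, generateFrom_generateSetAlgebra_eq, MeasurableSpace.generateFrom_countableGeneratingSet]
  have hmeas : ∀ i, ∀ B ∈ Gen i, MeasurableSet B := by
    intro i B hB
    rw [← hgenF i]
    exact MeasurableSpace.measurableSet_generateFrom hB
  have hpi : ∀ i, IsPiSystem (Gen i) := fun i s hs t ht _ =>
    isSetAlgebra_generateSetAlgebra.inter_mem hs ht
  have hc : ∀ s : Finset ι, ∀ᵐ a ∂μ, ∀ B : ∀ i : s, Gen i,
      κ a (⋂ i : s, f i ⁻¹' (B i : Set (F i))) = ∏ i : s, κ a (f i ⁻¹' (B i : Set (F i))) := by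
    intro s
    have : ∀ i : s, Countable (Gen i) := fun i => (hcount i).to_subtype
    rw [ae_all_iff]
    intro B
    classical
    have := h.meas_biInter (S := s) (s := fun i => if hi : i ∈ s then
      f i ⁻¹' (B ⟨i, hi⟩ : Set (F i)) else ∅) (fun i hi => by
        simp only [hi, dif_pos]
        exact ⟨_, hmeas _ _ (B ⟨i, hi⟩).2, rfl⟩)
    filter_upwards [this] with a ha
    rw [← Finset.prod_coe_sort] at ha
    have e : ⋂ i ∈ s, (if hi : i ∈ s then f i ⁻¹' (B ⟨i, hi⟩ : Set (F i)) else ∅) =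
        ⋂ i : s, f i ⁻¹' (B i : Set (F i)) := by
      rw [Set.iInter_subtype]
      exact Set.iInter₂_congr fun i hi => by simp [hi]
    rw [← e, ha]
    exact Finset.prod_congr rfl fun i _ => by simp
  have hall : ∀ᵐ a ∂μ, ∀ s : Finset ι, ∀ B : ∀ i : s, Gen i,
      κ a (⋂ i : s, f i ⁻¹' (B i : Set (F i))) = ∏ i : s, κ a (f i ⁻¹' (B i : Set (F i))) :=
    ae_all_iff.2 hc
  filter_upwards [hall] with a ha
  refine iIndepSets.iIndep (fun i => (hf i).comap_le)
    (fun i => {s | ∃ t ∈ Gen i, f i ⁻¹' t = s}) (fun i => (hpi i).comap (f i)) (fun i => ?_) ?_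
  · conv_lhs => rw [← hgenF i]
    rw [MeasurableSpace.comap_generateFrom]
    rfl
  · rw [iIndepSets_iff]
    intro s g hg
    choose! B hB hBg using hg
    have := ha s fun i => ⟨B i, hB i i.2⟩
    rw [← Finset.prod_coe_sort]
    have e : ⋂ i ∈ s, g i = ⋂ i : s, f i ⁻¹' B i := by
      rw [Set.iInter_subtype]
      exact Set.iInter₂_congr fun i hi => (hBg i hi).symm
    rw [e, this]
    exact Finset.prod_congr rfl fun i _ => by rw [← hBg i i.2]

open Complex in
/-- The conditional characteristic function. -/
def condChar {Ω F : Type*} (m' : MeasurableSpace Ω) [mΩ : MeasurableSpace Ω]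
    [StandardBorelSpace Ω] (P : Measure Ω) [IsFiniteMeasure P] [NormedAddCommGroup F]
    [InnerProductSpace ℝ F] (Z : Ω → F) (t : F) (ω : Ω) : ℂ :=
  ∫ ω', Complex.exp (inner ℝ (Z ω') t * I) ∂condExpKernel P m' ω

lemma norm_exp_inner_mul_I {F : Type*} [NormedAddCommGroup F] [InnerProductSpace ℝ F] (x t : F) :
    ‖Complex.exp (inner ℝ x t * Complex.I)‖ = 1 := by
  exact Complex.norm_exp_ofReal_mul_I _

lemma norm_prod_sub_prod_le_sum {ι : Type*} (s : Finset ι) (a b : ι → ℂ) (ha : ∀ i, ‖a i‖ ≤ 1)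
    (hb : ∀ i, ‖b i‖ ≤ 1) : ‖∏ i ∈ s, a i - ∏ i ∈ s, b i‖ ≤ ∑ i ∈ s, ‖a i - b i‖ := by
  classical
  induction s using Finset.induction_on with
  | empty => simp
  | insert i s hi ih =>
    rw [Finset.prod_insert hi, Finset.prod_insert hi, Finset.sum_insert hi]
    have h1 : ‖∏ j ∈ s, a j‖ ≤ 1 := by
      rw [norm_prod]
      exact Finset.prod_le_one (fun _ _ => norm_nonneg _) fun j _ => ha j
    calc ‖a i * ∏ j ∈ s, a j - b i * ∏ j ∈ s, b j‖
        = ‖(a i - b i) * ∏ j ∈ s, a j + b i * (∏ j ∈ s, a j - ∏ j ∈ s, b j)‖ := by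
          congr 1; ring
      _ ≤ ‖a i - b i‖ * ‖∏ j ∈ s, a j‖ + ‖b i‖ * ‖∏ j ∈ s, a j - ∏ j ∈ s, b j‖ := by
          rw [← norm_mul, ← norm_mul]; exact norm_add_le _ _
      _ ≤ ‖a i - b i‖ * 1 + 1 * ∑ j ∈ s, ‖a j - b j‖ := by
          gcongr
          exact hb i
      _ = _ := by ring

variable {Ω : Type*} {m' mΩ : MeasurableSpace Ω} [StandardBorelSpace Ω] {hm' : m' ≤ mΩ}
  {P : Measure Ω} [IsProbabilityMeasure P] {m : ℕ}
  {F : Type*} [NormedAddCommGroup F] [InnerProductSpace ℝ F] [MeasurableSpace F] [BorelSpace F]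
  [SecondCountableTopology F]

omit [MeasurableSpace F] [BorelSpace F] [SecondCountableTopology F] in
lemma norm_condChar_le (Z : Ω → F) (t : F) (ω : Ω) : ‖condChar m' P Z t ω‖ ≤ 1 := by
  have : IsProbabilityMeasure (condExpKernel P m' ω) := inferInstance
  refine (norm_integral_le_integral_norm _).trans ?_
  simp_rw [norm_exp_inner_mul_I]
  simp

omit [StandardBorelSpace Ω] [SecondCountableTopology F] in
lemma integrable_exp_inner {Z : Ω → F} (hZ : Measurable Z) (t : F) :
    Integrable (fun ω => Complex.exp (inner ℝ (Z ω) t * Complex.I)) P := by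
  refine Integrable.of_bound (Measurable.aestronglyMeasurable ?_) 1
    (Eventually.of_forall fun ω => (norm_exp_inner_mul_I _ _).le)
  have h : Measurable fun x : F => Complex.exp (inner ℝ x t * Complex.I) :=
    (by fun_prop : Continuous fun x : F => Complex.exp (inner ℝ x t * Complex.I)).measurable
  exact h.comp hZ

/-- Factorization of the joint characteristic function of conditionally independent variables,
centred at a variable that is known given the conditioning σ-algebra. -/
theorem integral_prod_exp_eq_integral_prod_condChar {f : Fin m → Ω → F}
    (hf : ∀ ℓ, Measurable (f ℓ)) (hind : iCondIndepFun m' hm' f P) {g : Ω → F}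
    (hg : Measurable[m'] g) (t : Fin m → F) :
    ∫ ω, ∏ ℓ, Complex.exp (inner ℝ (f ℓ ω - g ω) (t ℓ) * Complex.I) ∂P =
      ∫ ω, ∏ ℓ, condChar m' P (fun ω => f ℓ ω - g ω) (t ℓ) ω ∂P := by
  have hcont : ∀ t : F, Measurable fun x : F => Complex.exp (inner ℝ x t * Complex.I) := fun t =>
    (by fun_prop : Continuous fun x : F => Complex.exp (inner ℝ x t * Complex.I)).measurable
  have hgm : Measurable g := hg.mono hm' le_rfl
  -- Each centred character splits into `H ℓ`, which is known given `m'`, and `φ ℓ`, which involves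
  -- only `f ℓ`. Conditional independence is thus needed only for the uncentred variables.
  set H : Fin m → Ω → ℂ := fun ℓ ω => Complex.exp (inner ℝ (-g ω) (t ℓ) * Complex.I) with hH
  have hHm : ∀ ℓ, Measurable[m'] (H ℓ) := fun ℓ => (hcont (t ℓ)).comp hg.neg
  have hHn : ∀ ℓ ω, ‖H ℓ ω‖ = 1 := fun ℓ ω => norm_exp_inner_mul_I _ _
  set φ : Fin m → Ω → ℂ := fun ℓ ω => Complex.exp (inner ℝ (f ℓ ω) (t ℓ) * Complex.I) with hφ
  have hφm : ∀ ℓ, Measurable (φ ℓ) := fun ℓ => (hcont (t ℓ)).comp (hf ℓ)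
  have hφn : ∀ ℓ ω, ‖φ ℓ ω‖ = 1 := fun ℓ ω => norm_exp_inner_mul_I _ _
  have hsplit : ∀ ℓ ω, Complex.exp (inner ℝ (f ℓ ω - g ω) (t ℓ) * Complex.I) = H ℓ ω * φ ℓ ω := by
    intro ℓ ω
    rw [hH, hφ, ← Complex.exp_add, sub_eq_add_neg, inner_add_left]
    push_cast
    congr 1
    ring
  have hφi : ∀ ℓ, Integrable (φ ℓ) P := fun ℓ => integrable_exp_inner (hf ℓ) _
  have hHφi : ∀ ℓ, Integrable (fun ω => H ℓ ω * φ ℓ ω) P := by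
    intro ℓ
    refine Integrable.of_bound (((hHm ℓ).mono hm' le_rfl).mul (hφm ℓ)).aestronglyMeasurable 1
      (Eventually.of_forall fun ω => ?_)
    rw [norm_mul, hHn, hφn, one_mul]
  -- pulling out the known factors
  have hpull : ∀ ℓ, (fun ω => condChar m' P (fun ω => f ℓ ω - g ω) (t ℓ) ω) =ᵐ[P]
      fun ω => H ℓ ω * (P[φ ℓ | m']) ω := by
    intro ℓ
    have h1 := condExp_ae_eq_integral_condExpKernel hm' (hHφi ℓ)
    have h2 := condExp_bilin_of_stronglyMeasurable_left (ContinuousLinearMap.mul ℝ ℂ)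
      (hHm ℓ).stronglyMeasurable (by simpa using hHφi ℓ) (hφi ℓ)
    filter_upwards [h1, h2] with ω h1 h2
    simp only [condChar, hsplit]
    rw [← h1]
    simpa using h2
  -- conditional independence
  have hae := ae_iIndepFun_of_kernel hf hind
  have hprod : (P[fun ω => ∏ ℓ, φ ℓ ω | m']) =ᵐ[P] fun ω => ∏ ℓ, (P[φ ℓ | m']) ω := by
    have hpi : Integrable (fun ω => ∏ ℓ, φ ℓ ω) P := by
      refine Integrable.of_bound (Finset.measurable_fun_prod _ fun ℓ _ => hφm ℓ).aestronglyMeasurable 1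
        (Eventually.of_forall fun ω => ?_)
      rw [norm_prod]; simp [hφn]
    have h1 := condExp_ae_eq_integral_condExpKernel hm' hpi
    have h2 : ∀ᵐ ω ∂P, ∀ ℓ, (P[φ ℓ | m']) ω = ∫ y, φ ℓ y ∂condExpKernel P m' ω :=
      ae_all_iff.2 fun ℓ => condExp_ae_eq_integral_condExpKernel hm' (hφi ℓ)
    filter_upwards [h1, h2, ae_of_ae_trim hm' hae] with ω h1 h2 h3
    rw [h1]
    simp_rw [h2]
    exact h3.integral_fun_prod_comp (f := fun ℓ x => Complex.exp (inner ℝ x (t ℓ) * Complex.I))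
      (fun ℓ => (hf ℓ).aemeasurable) (fun ℓ => (hcont (t ℓ)).aestronglyMeasurable)
  have hHpm : StronglyMeasurable[m'] fun ω => ∏ ℓ, H ℓ ω :=
    (Finset.measurable_fun_prod _ fun ℓ _ => hHm ℓ).stronglyMeasurable
  have hφp : Integrable (fun ω => ∏ ℓ, φ ℓ ω) P := by
    refine Integrable.of_bound (Finset.measurable_fun_prod _ fun ℓ _ => hφm ℓ).aestronglyMeasurable 1
      (Eventually.of_forall fun ω => ?_)
    rw [norm_prod]; simp [hφn]
  have hHφp : Integrable (fun ω => (∏ ℓ, H ℓ ω) * ∏ ℓ, φ ℓ ω) P := by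
    refine Integrable.of_bound ((hHpm.measurable.mono hm' le_rfl).mul
      (Finset.measurable_fun_prod _ fun ℓ _ => hφm ℓ)).aestronglyMeasurable 1
      (Eventually.of_forall fun ω => ?_)
    rw [norm_mul, norm_prod, norm_prod]; simp [hφn, hHn]
  have h2 := condExp_bilin_of_stronglyMeasurable_left (ContinuousLinearMap.mul ℝ ℂ)
      hHpm (by simpa using hHφp) hφp
  calc ∫ ω, ∏ ℓ, Complex.exp (inner ℝ (f ℓ ω - g ω) (t ℓ) * Complex.I) ∂P
      = ∫ ω, (∏ ℓ, H ℓ ω) * ∏ ℓ, φ ℓ ω ∂P := by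
        simp_rw [hsplit, Finset.prod_mul_distrib]
    _ = ∫ ω, (P[fun ω => (∏ ℓ, H ℓ ω) * ∏ ℓ, φ ℓ ω | m']) ω ∂P := (integral_condExp hm').symm
    _ = ∫ ω, (∏ ℓ, H ℓ ω) * ∏ ℓ, (P[φ ℓ | m']) ω ∂P := by
        refine integral_congr_ae ?_
        filter_upwards [h2, hprod] with ω h2 h3
        rw [← h3]
        simpa using h2
    _ = ∫ ω, ∏ ℓ, condChar m' P (fun ω => f ℓ ω - g ω) (t ℓ) ω ∂P := by
        refine integral_congr_ae ?_
        filter_upwards [ae_all_iff.2 hpull] with ω h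
        rw [← Finset.prod_mul_distrib]
        exact Finset.prod_congr rfl fun ℓ _ => (h ℓ).symm

end CondIndep

section JointConvergence

variable {p k h m : ℕ} (Q : MIProblem p k h m)

/-- The normalized imputation noise `√n (θ̂^ℓ - θ̂_obs)`. -/
def MIProblem.noise (ℓ : Fin m) (n : ℕ) (ω : Q.Ω n) : EuclideanSpace ℝ (Fin k) :=
  WithLp.toLp 2 (Real.sqrt n • (Q.thetaImp ℓ n ω - Q.thetaObs n ω) : Fin k → ℝ)

lemma measurable_theta : Measurable (theta (k := k) (h := h)) :=
  measurable_pi_lambda _ fun _ => measurable_pi_apply _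

lemma MIProblem.measurable_thetaObs (n : ℕ) : Measurable[Q.obsAlg n] (Q.thetaObs n) := by
  have h1 : Measurable fun z : Pattern n p × Dataset n p => theta (Q.psiObs n z.1 z.2) :=
    measurable_theta.comp (Q.measurable_psiObs n)
  exact h1.comp (comap_measurable (Q.obsData n))

variable {Q}

lemma MIProblem.measurable_noise (hθ : ∀ ℓ n, Measurable (Q.thetaImp ℓ n)) (ℓ : Fin m) (n : ℕ) :
    Measurable (Q.noise ℓ n) := by
  refine (WithLp.measurable_toLp 2 _).comp ((measurable_const_smul (Real.sqrt n)).comp ?_)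
  exact (hθ ℓ n).sub ((Q.measurable_thetaObs n).mono (Q.obsAlg_le n) le_rfl)

/-- Real part of a character as a bounded continuous function. -/
def cosInner (t : EuclideanSpace ℝ (Fin k)) :
    BoundedContinuousFunction (EuclideanSpace ℝ (Fin k)) ℝ :=
  BoundedContinuousFunction.ofNormedAddCommGroup (fun x => Real.cos (inner ℝ x t)) (by fun_prop) 1
    (fun _ => Real.abs_cos_le_one _)

/-- Imaginary part of a character as a bounded continuous function. -/
def sinInner (t : EuclideanSpace ℝ (Fin k)) :
    BoundedContinuousFunction (EuclideanSpace ℝ (Fin k)) ℝ :=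
  BoundedContinuousFunction.ofNormedAddCommGroup (fun x => Real.sin (inner ℝ x t)) (by fun_prop) 1
    (fun _ => Real.abs_sin_le_one _)

lemma integral_exp_inner_mul_I {t : EuclideanSpace ℝ (Fin k)} {α : Type*} [MeasurableSpace α]
    {μ : Measure α} [IsProbabilityMeasure μ] {Z : α → EuclideanSpace ℝ (Fin k)} (hZ : Measurable Z) :
    ∫ a, Complex.exp (inner ℝ (Z a) t * Complex.I) ∂μ =
      ((∫ a, cosInner t (Z a) ∂μ : ℝ) : ℂ) + ((∫ a, sinInner t (Z a) ∂μ : ℝ) : ℂ) * Complex.I := by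
  have hexp : ∀ x : EuclideanSpace ℝ (Fin k), Complex.exp (inner ℝ x t * Complex.I) =
      (cosInner t x : ℂ) + (sinInner t x : ℂ) * Complex.I := by
    intro x
    rw [Complex.exp_mul_I]
    simp [cosInner, sinInner]
  have hi : ∀ g : BoundedContinuousFunction (EuclideanSpace ℝ (Fin k)) ℝ,
      Integrable (fun a => (g (Z a) : ℂ)) μ := fun g =>
    (Integrable.of_bound (g.continuous.measurable.comp hZ).aestronglyMeasurable ‖g‖
      (Eventually.of_forall fun a => g.norm_coe_le_norm _)).ofReal
  simp_rw [hexp]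
  rw [integral_add (hi _) ((hi _).mul_const _), integral_mul_const]
  simp only [integral_complex_ofReal]

/-- Testing the conditional laws against cosine and sine gives convergence in probability of the
conditional characteristic functions. These lie in the unit disc, so the convergence also holds in
mean. -/
lemma MIProblem.tendsto_condChar (hθ : ∀ ℓ n, Measurable (Q.thetaImp ℓ n))
    {N : Measure (EuclideanSpace ℝ (Fin k))} [IsProbabilityMeasure N] {ℓ : Fin m}
    (hN : Q.CondTendstoInDistribution (Q.noise ℓ) N) (t : EuclideanSpace ℝ (Fin k)) :
    Tendsto (fun n => ∫ ω, ‖condChar (Q.obsAlg n) (Q.P n) (Q.noise ℓ n) t ω - charFun N t‖ ∂Q.P n)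
      atTop (𝓝 0) := by
  set gc := cosInner t with hgc
  set gs := sinInner t with hgs
  have hmeas : ∀ n, Measurable (condChar (Q.obsAlg n) (Q.P n) (Q.noise ℓ n) t) := by
    intro n
    have h1 : Measurable fun ω => Complex.exp (inner ℝ (Q.noise ℓ n ω) t * Complex.I) :=
      (by fun_prop : Continuous fun x : EuclideanSpace ℝ (Fin k) =>
        Complex.exp (inner ℝ x t * Complex.I)).measurable.comp (Q.measurable_noise hθ ℓ n)
    exact (h1.stronglyMeasurable.integral_condExpKernel (μ := Q.P n)
      (m := Q.obsAlg n)).measurable.mono (Q.obsAlg_le n) le_rfl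
  have hcond : ∀ (g : BoundedContinuousFunction (EuclideanSpace ℝ (Fin k)) ℝ) (n : ℕ),
      ∀ᵐ ω ∂Q.P n, ((Q.P n)[fun ω' => g (Q.noise ℓ n ω') | Q.obsAlg n]) ω =
        ∫ y, g (Q.noise ℓ n y) ∂condExpKernel (Q.P n) (Q.obsAlg n) ω := by
    intro g n
    exact condExp_ae_eq_integral_condExpKernel (Q.obsAlg_le n)
      (Integrable.of_bound (g.continuous.measurable.comp
        (Q.measurable_noise hθ ℓ n)).aestronglyMeasurable ‖g‖
        (Eventually.of_forall fun a => g.norm_coe_le_norm _))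
  have hprob : ∀ ε : ℝ, 0 < ε → Tendsto (fun n => Q.P n {ω | ε ≤
      dist (condChar (Q.obsAlg n) (Q.P n) (Q.noise ℓ n) t ω) (charFun N t)}) atTop (𝓝 0) := by
    intro ε hε
    have h1 := hN gc (ε / 2) (by positivity)
    have h2 := hN gs (ε / 2) (by positivity)
    have h3 := h1.add h2
    rw [add_zero] at h3
    refine tendsto_of_tendsto_of_tendsto_of_le_of_le tendsto_const_nhds h3 (fun _ => zero_le)
      fun n => ?_
    refine (measure_mono_ae ?_).trans (measure_union_le _ _)
    filter_upwards [hcond gc n, hcond gs n] with ω hc hs hω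
    by_contra hcon
    have hcon' : ¬ (ε / 2 ≤ |((Q.P n)[fun ω' => gc (Q.noise ℓ n ω') | Q.obsAlg n]) ω - ∫ y, gc y ∂N|
      ∨ ε / 2 ≤ |((Q.P n)[fun ω' => gs (Q.noise ℓ n ω') | Q.obsAlg n]) ω - ∫ y, gs y ∂N|) := hcon
    rw [hc, hs, not_or, not_le, not_le] at hcon'
    have hω' : ε ≤ dist (condChar (Q.obsAlg n) (Q.P n) (Q.noise ℓ n) t ω) (charFun N t) := hω
    rw [dist_eq_norm, charFun_apply, condChar, integral_exp_inner_mul_I (Q.measurable_noise hθ ℓ n),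
      integral_exp_inner_mul_I (Z := fun x => x) measurable_id] at hω'
    have e : ∀ a b c d : ℝ, (a : ℂ) + b * Complex.I - (c + d * Complex.I) =
        ((a - c : ℝ) : ℂ) + ((b - d : ℝ) : ℂ) * Complex.I := by
      intros; push_cast; ring
    rw [e] at hω'
    have := (norm_add_le _ _).trans' hω'
    rw [norm_mul, Complex.norm_I, mul_one, Complex.norm_real, Complex.norm_real, Real.norm_eq_abs,
      Real.norm_eq_abs] at this
    linarith [hcon'.1, hcon'.2]
  -- The truncation at 2 is invisible for two points of the unit disc, but it makes the test
  -- function bounded.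
  have huc : UniformContinuous fun z : ℂ => min ‖z - charFun N t‖ 2 := by
    have h1 : UniformContinuous fun z : ℂ => ‖z - charFun N t‖ :=
      uniformContinuous_norm.comp (uniformContinuous_id.sub uniformContinuous_const)
    have h2 : LipschitzWith 1 fun x : ℝ => min x 2 := LipschitzWith.id.min_const 2
    exact h2.uniformContinuous.comp h1
  have hfin := tendsto_integral_sub_of_uniformContinuous (P := Q.P) hmeas
    (fun n => measurable_const (a := charFun N t)) hprob huc (b := 2) (fun z => by
      rw [abs_of_nonneg (le_min (norm_nonneg _) zero_le_two)]
      exact min_le_right _ _)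
  refine hfin.congr fun n => ?_
  simp only [sub_self, norm_zero, min_eq_left zero_le_two, integral_zero, sub_zero]
  refine integral_congr_ae (Eventually.of_forall fun ω => ?_)
  refine min_eq_left ?_
  refine (norm_sub_le _ _).trans ?_
  have h1 := norm_condChar_le (m' := Q.obsAlg n) (P := Q.P n) (Q.noise ℓ n) t ω
  have h2 := norm_charFun_le_one (μ := N) t
  linarith

/-- The vector of all normalized imputation noises. -/
def MIProblem.noiseVec (Q : MIProblem p k h m) (n : ℕ) (ω : Q.Ω n) :
    PiLp 2 fun _ : Fin m => EuclideanSpace ℝ (Fin k) :=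
  WithLp.toLp 2 fun ℓ => Q.noise ℓ n ω

lemma MIProblem.measurable_noiseVec (hθ : ∀ ℓ n, Measurable (Q.thetaImp ℓ n)) (n : ℕ) :
    Measurable (Q.noiseVec n) :=
  (WithLp.measurable_toLp 2 _).comp
    (measurable_pi_lambda _ fun ℓ => Q.measurable_noise hθ ℓ n)

/-- By Lévy's continuity theorem it suffices to treat joint characteristic functions. Each is the
mean of a product of conditional ones, whose factors converge in mean to constants. The noises are
therefore asymptotically independent although they share the random centre θ̂_obs. -/
theorem MIProblem.tendsto_noiseVec (hθ : ∀ ℓ n, Measurable (Q.thetaImp ℓ n))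
    (hind : ∀ n, iCondIndepFun (Q.obsAlg n) (Q.obsAlg_le n)
      (fun (ℓ : Fin m) (ω : Q.Ω n) =>
        ((Q.thetaImp ℓ n ω, fun a b => Q.VImp ℓ n ω a b) :
          (Fin k → ℝ) × (Fin k → Fin k → ℝ))) (Q.P n))
    {N : Measure (EuclideanSpace ℝ (Fin k))} [IsProbabilityMeasure N]
    (hN : ∀ ℓ, Q.CondTendstoInDistribution (Q.noise ℓ) N)
    (g : BoundedContinuousFunction (PiLp 2 fun _ : Fin m => EuclideanSpace ℝ (Fin k)) ℝ) :
    Tendsto (fun n => ∫ ω, g (Q.noiseVec n ω) ∂Q.P n) atTop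
      (𝓝 (∫ y, g y ∂(Measure.pi fun _ : Fin m => N).map (WithLp.toLp 2))) := by
  have hprobν : IsProbabilityMeasure ((Measure.pi fun _ : Fin m => N).map
      (WithLp.toLp 2 : _ → PiLp 2 fun _ : Fin m => EuclideanSpace ℝ (Fin k))) :=
    Measure.isProbabilityMeasure_map (WithLp.measurable_toLp 2 _).aemeasurable
  have hprobμ : ∀ n, IsProbabilityMeasure ((Q.P n).map (Q.noiseVec n)) := fun n =>
    Measure.isProbabilityMeasure_map (Q.measurable_noiseVec hθ n).aemeasurable
  let μs : ℕ → ProbabilityMeasure (PiLp 2 fun _ : Fin m => EuclideanSpace ℝ (Fin k)) :=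
    fun n => ⟨(Q.P n).map (Q.noiseVec n), hprobμ n⟩
  let μ₀ : ProbabilityMeasure (PiLp 2 fun _ : Fin m => EuclideanSpace ℝ (Fin k)) := ⟨_, hprobν⟩
  have hkey : Tendsto μs atTop (𝓝 μ₀) := by
    refine ProbabilityMeasure.tendsto_of_tendsto_charFun fun t => ?_
    simp only [μs, μ₀, ProbabilityMeasure.coe_mk]
    rw [charFun_pi]
    have hchar : ∀ n, charFun ((Q.P n).map (Q.noiseVec n)) t =
        ∫ ω, ∏ ℓ, condChar (Q.obsAlg n) (Q.P n) (Q.noise ℓ n) (t ℓ) ω ∂Q.P n := by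
      intro n
      -- Independence is transported to the scaled but uncentred estimators. The centre √n θ̂_obs is
      -- measurable for the observed σ-algebra and enters later as the known variable `g`.
      have hind' : iCondIndepFun (Q.obsAlg n) (Q.obsAlg_le n)
          (fun (ℓ : Fin m) (ω : Q.Ω n) =>
            (WithLp.toLp 2 (Real.sqrt n • Q.thetaImp ℓ n ω) : EuclideanSpace ℝ (Fin k))) (Q.P n) :=
        Kernel.iIndepFun.comp (hind n) (fun _ z => WithLp.toLp 2 (Real.sqrt n • z.1))
          (fun _ => (WithLp.measurable_toLp 2 _).comp ((measurable_const_smul (Real.sqrt n)).comp measurable_fst))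
      have h1 := integral_prod_exp_eq_integral_prod_condChar
        (f := fun (ℓ : Fin m) (ω : Q.Ω n) =>
          (WithLp.toLp 2 (Real.sqrt n • Q.thetaImp ℓ n ω) : EuclideanSpace ℝ (Fin k)))
        (fun ℓ => (WithLp.measurable_toLp 2 _).comp
          ((measurable_const_smul (Real.sqrt n)).comp (hθ ℓ n))) hind'
        (g := fun ω => (WithLp.toLp 2 (Real.sqrt n • Q.thetaObs n ω) : EuclideanSpace ℝ (Fin k)))
        ((WithLp.measurable_toLp 2 _).comp ((measurable_const_smul (Real.sqrt n)).comp (Q.measurable_thetaObs n))) fun ℓ => t ℓ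
      have h2 : ∀ ℓ ω, (WithLp.toLp 2 (Real.sqrt n • Q.thetaImp ℓ n ω) : EuclideanSpace ℝ (Fin k)) -
          WithLp.toLp 2 (Real.sqrt n • Q.thetaObs n ω) = Q.noise ℓ n ω := by
        intro ℓ ω
        rw [MIProblem.noise, smul_sub, WithLp.toLp_sub]
      simp only [h2] at h1
      rw [charFun_apply, integral_map (Q.measurable_noiseVec hθ n).aemeasurable
        (by fun_prop : Continuous fun x : PiLp 2 fun _ : Fin m => EuclideanSpace ℝ (Fin k) =>
          Complex.exp (inner ℝ x t * Complex.I)).aestronglyMeasurable]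
      refine Eq.trans ?_ h1
      refine integral_congr_ae (Eventually.of_forall fun ω => ?_)
      simp only
      rw [PiLp.inner_apply, Complex.ofReal_sum, Finset.sum_mul, Complex.exp_sum]
      rfl
    simp_rw [hchar]
    rw [tendsto_iff_norm_sub_tendsto_zero]
    have hsum := tendsto_finsetSum (Finset.univ : Finset (Fin m)) fun ℓ _ =>
      MIProblem.tendsto_condChar hθ (hN ℓ) (t ℓ)
    rw [Finset.sum_const_zero] at hsum
    refine squeeze_zero (fun _ => norm_nonneg _) (fun n => ?_) hsum
    have hmeas : ∀ ℓ, Measurable (condChar (Q.obsAlg n) (Q.P n) (Q.noise ℓ n) (t ℓ)) := by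
      intro ℓ
      have h1 : Measurable fun ω => Complex.exp (inner ℝ (Q.noise ℓ n ω) (t ℓ) * Complex.I) :=
        (by fun_prop : Continuous fun x : EuclideanSpace ℝ (Fin k) =>
          Complex.exp (inner ℝ x (t ℓ) * Complex.I)).measurable.comp (Q.measurable_noise hθ ℓ n)
      exact (h1.stronglyMeasurable.integral_condExpKernel (μ := Q.P n)
        (m := Q.obsAlg n)).measurable.mono (Q.obsAlg_le n) le_rfl
    have hi1 : Integrable (fun ω => ∏ ℓ, condChar (Q.obsAlg n) (Q.P n) (Q.noise ℓ n) (t ℓ) ω)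
        (Q.P n) := by
      refine Integrable.of_bound (Finset.measurable_fun_prod _ fun ℓ _ => hmeas ℓ).aestronglyMeasurable
        1 (Eventually.of_forall fun ω => ?_)
      rw [norm_prod]
      exact Finset.prod_le_one (fun _ _ => norm_nonneg _) fun ℓ _ => norm_condChar_le _ _ _
    have hi2 : ∀ ℓ ∈ Finset.univ, Integrable (fun ω =>
        ‖condChar (Q.obsAlg n) (Q.P n) (Q.noise ℓ n) (t ℓ) ω - charFun N (t ℓ)‖) (Q.P n) := by
      intro ℓ _
      refine Integrable.norm (Integrable.sub ?_ (integrable_const _))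
      exact Integrable.of_bound (hmeas ℓ).aestronglyMeasurable 1
        (Eventually.of_forall fun ω => norm_condChar_le _ _ _)
    rw [← integral_finsetSum _ hi2]
    have hconst : ∏ ℓ, charFun N (t ℓ) = ∫ _ω, ∏ ℓ, charFun N (t ℓ) ∂Q.P n := by simp
    rw [hconst, ← integral_sub hi1 (integrable_const _)]
    refine norm_integral_le_of_norm_le (integrable_finsetSum _ hi2) (Eventually.of_forall fun ω => ?_)
    exact norm_prod_sub_prod_le_sum _ _ _ (fun ℓ => norm_condChar_le _ _ _)
      fun ℓ => norm_charFun_le_one _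
  have := ProbabilityMeasure.tendsto_iff_forall_integral_tendsto.1 hkey g
  simp only [μs, μ₀, ProbabilityMeasure.coe_mk] at this
  refine this.congr fun n => ?_
  rw [integral_map (Q.measurable_noiseVec hθ n).aemeasurable
    g.continuous.measurable.aestronglyMeasurable]

end JointConvergence

/-! ### Quadratic expansions of smooth functions -/

section Expansion

variable {k h : ℕ} {L : Par k h → ℝ} {Ψ : Set (Par k h)}

lemma fderiv_apply_eq_sum_grad (L : Par k h → ℝ) (ψ v : Par k h) :
    fderiv ℝ L ψ v = ∑ b, v b * grad L ψ b := by
  have := LinearMap.pi_apply_eq_sum_univ (fderiv ℝ L ψ : Par k h →ₗ[ℝ] ℝ) v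
  refine this.trans (Finset.sum_congr rfl fun b _ => ?_)
  have e : (fun j => if b = j then (1 : ℝ) else 0) = Pi.single b 1 := by
    ext j; simp [Pi.single_apply, eq_comm]
  rw [e]
  rfl

lemma contDiffOn_grad (hΨ : IsOpen Ψ) (hL : ContDiffOn ℝ 2 L Ψ) (b : Fin k ⊕ Fin h) :
    ContDiffOn ℝ 1 (fun ψ => grad L ψ b) Ψ :=
  (hL.fderiv_of_isOpen (m := 1) hΨ (by norm_num)).clm_apply contDiffOn_const

lemma hasDerivAt_comp_line {F : Par k h → ℝ} {ψ y : Par k h} {t : ℝ}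
    (hF : DifferentiableAt ℝ F (ψ + t • y)) :
    HasDerivAt (fun t : ℝ => F (ψ + t • y)) (∑ a, y a * grad F (ψ + t • y) a) t := by
  have h1 : HasDerivAt (fun t : ℝ => ψ + t • y) y t := by
    simpa using ((hasDerivAt_id t).smul_const y).const_add ψ
  have := hF.hasFDerivAt.comp_hasDerivAt t h1
  rwa [fderiv_apply_eq_sum_grad] at this

lemma abs_sum_mul_le {ι : Type*} [Fintype ι] (y c : ι → ℝ) {ε : ℝ} (hc : ∀ a, |c a| ≤ ε) :
    |∑ a, y a * c a| ≤ ε * Fintype.card ι * ‖y‖ := by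
  calc |∑ a, y a * c a| ≤ ∑ a, |y a * c a| := Finset.abs_sum_le_sum_abs _ _
    _ ≤ ∑ _a : ι, ‖y‖ * ε := by
        refine Finset.sum_le_sum fun a _ => ?_
        rw [abs_mul]
        exact mul_le_mul (norm_le_pi_norm y a) (hc a) (abs_nonneg _) (norm_nonneg _)
    _ = _ := by simp; ring

variable {ψ₀ y : Par k h} {ε : ℝ} {M : Matrix (Fin k ⊕ Fin h) (Fin k ⊕ Fin h) ℝ}

lemma line_mem_closedBall {ψ₀ y : Par k h} {t : ℝ} (ht : t ∈ Set.Icc (0 : ℝ) 1) :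
    ψ₀ + t • y ∈ Metric.closedBall ψ₀ ‖y‖ := by
  rw [mem_closedBall_iff_norm, add_sub_cancel_left, norm_smul, Real.norm_of_nonneg ht.1]
  exact mul_le_of_le_one_left (norm_nonneg _) ht.2

/-- Along the segment, the gradient component compensated by its linear model has derivative ∑ y_a
(M - negHess)_ab. The mean value inequality turns the Hessian bound into the stated one. -/
lemma grad_expansion (hΨ : IsOpen Ψ) (hL : ContDiffOn ℝ 2 L Ψ)
    (hball : Metric.closedBall ψ₀ ‖y‖ ⊆ Ψ)
    (hH : ∀ ψ ∈ Metric.closedBall ψ₀ ‖y‖, ∀ a b, |negHess L ψ a b - M a b| ≤ ε)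
    (b : Fin k ⊕ Fin h) :
    |grad L (ψ₀ + y) b - grad L ψ₀ b + ∑ a, y a * M a b| ≤
      ε * Fintype.card (Fin k ⊕ Fin h) * ‖y‖ := by
  have hder : ∀ t ∈ Set.Icc (0 : ℝ) 1, HasDerivWithinAt
      (fun t : ℝ => grad L (ψ₀ + t • y) b + t * ∑ a, y a * M a b)
      (∑ a, y a * (M a b - negHess L (ψ₀ + t • y) a b)) (Set.Icc 0 1) t := by
    intro t ht
    have hd : DifferentiableAt ℝ (fun φ => grad L φ b) (ψ₀ + t • y) :=
      ((contDiffOn_grad hΨ hL b).differentiableOn one_ne_zero).differentiableAt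
        (hΨ.mem_nhds (hball (line_mem_closedBall ht)))
    have h1 := hasDerivAt_comp_line hd
    have h2 := (h1.add ((hasDerivAt_id t).mul_const (∑ a, y a * M a b))).hasDerivWithinAt
      (s := Set.Icc 0 1)
    refine h2.congr_deriv ?_
    rw [one_mul, ← Finset.sum_add_distrib]
    refine Finset.sum_congr rfl fun a _ => ?_
    simp only [negHess, Matrix.of_apply, grad]
    ring
  have hle := norm_image_sub_le_of_norm_deriv_le_segment_01' hder
    (C := ε * Fintype.card (Fin k ⊕ Fin h) * ‖y‖) fun t ht => by
      rw [Real.norm_eq_abs]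
      refine abs_sum_mul_le y _ fun a => ?_
      rw [abs_sub_comm]
      exact hH _ (line_mem_closedBall ⟨ht.1, ht.2.le⟩) a b
  simp only [one_smul, one_mul, zero_smul, add_zero, zero_mul, Real.norm_eq_abs] at hle
  convert hle using 2
  ring

/-- The compensated value has as derivative along the segment the remainder of `grad_expansion` at t
• y, so a second use of the mean value inequality suffices. -/
lemma value_expansion (hΨ : IsOpen Ψ) (hL : ContDiffOn ℝ 2 L Ψ) (hε : 0 ≤ ε)
    (hball : Metric.closedBall ψ₀ ‖y‖ ⊆ Ψ)
    (hH : ∀ ψ ∈ Metric.closedBall ψ₀ ‖y‖, ∀ a b, |negHess L ψ a b - M a b| ≤ ε) :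
    |L (ψ₀ + y) - L ψ₀ - ∑ b, y b * grad L ψ₀ b + 1 / 2 * ∑ b, y b * ∑ a, y a * M a b| ≤
      ε * (Fintype.card (Fin k ⊕ Fin h)) ^ 2 * ‖y‖ ^ 2 := by
  have hder : ∀ t ∈ Set.Icc (0 : ℝ) 1, HasDerivWithinAt
      (fun t : ℝ => L (ψ₀ + t • y) - t * ∑ b, y b * grad L ψ₀ b
        + t ^ 2 * (1 / 2 * ∑ b, y b * ∑ a, y a * M a b))
      (∑ b, y b * (grad L (ψ₀ + t • y) b - grad L ψ₀ b + ∑ a, (t • y) a * M a b)) (Set.Icc 0 1) t := by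
    intro t ht
    have hd : DifferentiableAt ℝ L (ψ₀ + t • y) :=
      (hL.differentiableOn two_ne_zero).differentiableAt
        (hΨ.mem_nhds (hball (line_mem_closedBall ht)))
    have h1 := hasDerivAt_comp_line hd
    have h2 := ((h1.sub ((hasDerivAt_id t).mul_const (∑ b, y b * grad L ψ₀ b))).add
      ((hasDerivAt_pow 2 t).mul_const (1 / 2 * ∑ b, y b * ∑ a, y a * M a b))).hasDerivWithinAt
      (s := Set.Icc 0 1)
    refine h2.congr_deriv ?_
    simp only [Pi.smul_apply, smul_eq_mul, mul_assoc t, ← Finset.mul_sum, mul_add, mul_sub,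
      Finset.sum_add_distrib, Finset.sum_sub_distrib, mul_left_comm _ t]
    norm_num
    ring
  have hle := norm_image_sub_le_of_norm_deriv_le_segment_01' hder
    (C := ε * (Fintype.card (Fin k ⊕ Fin h)) ^ 2 * ‖y‖ ^ 2) fun t ht => by
      have ht' : t ∈ Set.Icc (0 : ℝ) 1 := ⟨ht.1, ht.2.le⟩
      have hy : ‖t • y‖ ≤ ‖y‖ := by
        rw [norm_smul, Real.norm_of_nonneg ht.1]
        exact mul_le_of_le_one_left (norm_nonneg _) ht.2.le
      have hsub : Metric.closedBall ψ₀ ‖t • y‖ ⊆ Metric.closedBall ψ₀ ‖y‖ :=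
        Metric.closedBall_subset_closedBall hy
      rw [Real.norm_eq_abs]
      refine (abs_sum_mul_le y _ (ε := ε * Fintype.card (Fin k ⊕ Fin h) * ‖y‖) fun b => ?_).trans
        (le_of_eq (by ring))
      refine (grad_expansion hΨ hL (hsub.trans hball) (fun ψ hψ => hH ψ (hsub hψ)) b).trans ?_
      gcongr
  simp only [one_smul, one_mul, zero_smul, add_zero, zero_mul, Real.norm_eq_abs, one_pow] at hle
  convert hle using 2
  norm_num
  ring

end Expansion

/-! ### Regular log-likelihoods along a filter -/

section Along

variable {k h : ℕ} {X : Type*}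

/-- Local asymptotic regularity of the log-likelihoods `L x` along a filter, with rate `r`, centre
`ψs`, limiting information `J` and limiting score `s`. -/
structure RegularAlong (l : Filter X) (r : X → ℝ) (Ψ : Set (Par k h)) (ψs : X → Par k h)
    (J : Matrix (Fin k ⊕ Fin h) (Fin k ⊕ Fin h) ℝ) (s : Par k h) (L : X → Par k h → ℝ) : Prop where
  smooth : ∀ᶠ x in l, ContDiffOn ℝ 2 (L x) Ψ
  score : Tendsto (fun x => (r x)⁻¹ • grad (L x) (ψs x)) l (𝓝 s)
  info : ∀ ρ : X → ℝ, Tendsto ρ l (𝓝 0) → ∀ ε : ℝ, 0 < ε → ∀ᶠ x in l, ∀ ψ ∈ Ψ,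
    ‖ψ - ψs x‖ ≤ ρ x → ∀ a b, |(r x ^ 2)⁻¹ * negHess (L x) ψ a b - J a b| ≤ ε
  sep : ∀ ρ : ℝ, 0 < ρ → ∃ c : ℝ, 0 < c ∧ ∀ᶠ x in l, ∀ ψ ∈ Ψ, ρ ≤ ‖ψ - ψs x‖ →
    L x ψ ≤ L x (ψs x) - c * r x ^ 2

/-- The localization data: diverging rate and a centre converging inside the open set `Ψ`. -/
structure Localized (l : Filter X) (r : X → ℝ) (Ψ : Set (Par k h)) (ψs : X → Par k h) : Prop where
  isOpen : IsOpen Ψ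
  rate : Tendsto r l atTop
  centre : ∃ ψ ∈ Ψ, Tendsto ψs l (𝓝 ψ)

variable {l : Filter X} {r : X → ℝ} {Ψ : Set (Par k h)} {ψs : X → Par k h}
  {J : Matrix (Fin k ⊕ Fin h) (Fin k ⊕ Fin h) ℝ} {s : Par k h} {L : X → Par k h → ℝ}

lemma Localized.exists_ball (hl : Localized l r Ψ ψs) :
    ∃ ρ : ℝ, 0 < ρ ∧ ∀ᶠ x in l, Metric.closedBall (ψs x) ρ ⊆ Ψ := by
  obtain ⟨ψ, hψ, hψs⟩ := hl.centre
  obtain ⟨δ, hδ, hδΨ⟩ := Metric.isOpen_iff.1 hl.isOpen ψ hψ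
  refine ⟨δ / 3, by positivity, ?_⟩
  filter_upwards [(Metric.tendsto_nhds.1 hψs) (δ / 3) (by positivity)] with x hx φ hφ
  refine hδΨ ?_
  rw [Metric.mem_closedBall] at hφ
  rw [Metric.mem_ball]
  linarith [dist_triangle φ (ψs x) ψ]

lemma Localized.centre_mem (hl : Localized l r Ψ ψs) : ∀ᶠ x in l, ψs x ∈ Ψ := by
  obtain ⟨ρ, hρ, h⟩ := hl.exists_ball
  filter_upwards [h] with x hx using hx (Metric.mem_closedBall_self hρ.le)

/-- The deterministic expansions are applied with matrix r² J and error r² ε, then rescaled. The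
norm of ψ - ψs itself serves as the shrinking radius. -/
lemma RegularAlong.eventually_expansion (hR : RegularAlong l r Ψ ψs J s L)
    (hl : Localized l r Ψ ψs) {ψ : X → Par k h} (hψ : Tendsto (fun x => ψ x - ψs x) l (𝓝 0))
    {ε : ℝ} (hε : 0 < ε) :
    ∀ᶠ x in l, (∀ b, |(r x)⁻¹ * grad (L x) (ψ x) b - (r x)⁻¹ * grad (L x) (ψs x) b
        + ∑ a, (r x • (ψ x - ψs x)) a * J a b| ≤
          ε * Fintype.card (Fin k ⊕ Fin h) * ‖r x • (ψ x - ψs x)‖) ∧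
      |L x (ψ x) - L x (ψs x) - ∑ b, (r x • (ψ x - ψs x)) b * ((r x)⁻¹ * grad (L x) (ψs x) b)
        + 1 / 2 * ∑ b, (r x • (ψ x - ψs x)) b * ∑ a, (r x • (ψ x - ψs x)) a * J a b| ≤
          ε * (Fintype.card (Fin k ⊕ Fin h)) ^ 2 * ‖r x • (ψ x - ψs x)‖ ^ 2 := by
  obtain ⟨ρ, hρ, hball⟩ := hl.exists_ball
  have hn : Tendsto (fun x => ‖ψ x - ψs x‖) l (𝓝 0) := by simpa using hψ.norm
  filter_upwards [hR.smooth, hball, hR.info _ hn ε hε, (hn.eventually (gt_mem_nhds hρ)),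
    hl.rate.eventually_gt_atTop 0] with x hs hb hi hx hr
  have hsub : Metric.closedBall (ψs x) ‖ψ x - ψs x‖ ⊆ Ψ :=
    (Metric.closedBall_subset_closedBall hx.le).trans hb
  have hH : ∀ φ ∈ Metric.closedBall (ψs x) ‖ψ x - ψs x‖, ∀ a b,
      |negHess (L x) φ a b - (r x ^ 2 • J) a b| ≤ r x ^ 2 * ε := by
    intro φ hφ a b
    have := hi φ (hsub hφ) (by rwa [mem_closedBall_iff_norm] at hφ) a b
    have e : negHess (L x) φ a b - (r x ^ 2 • J) a b =
        r x ^ 2 * ((r x ^ 2)⁻¹ * negHess (L x) φ a b - J a b) := by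
      simp only [Matrix.smul_apply, smul_eq_mul]
      field_simp
    rw [e, abs_mul, abs_of_pos (by positivity : 0 < r x ^ 2)]
    gcongr
  have hψx : ψs x + (ψ x - ψs x) = ψ x := by abel
  have hnorm : ‖r x • (ψ x - ψs x)‖ = r x * ‖ψ x - ψs x‖ := by
    rw [norm_smul, Real.norm_of_nonneg hr.le]
  refine ⟨fun b => ?_, ?_⟩
  · have := grad_expansion hl.isOpen hs hsub hH b
    rw [hψx] at this
    have e : (r x)⁻¹ * grad (L x) (ψ x) b - (r x)⁻¹ * grad (L x) (ψs x) b
        + ∑ a, (r x • (ψ x - ψs x)) a * J a b = (r x)⁻¹ * (grad (L x) (ψ x) b - grad (L x) (ψs x) b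
        + ∑ a, (ψ x - ψs x) a * (r x ^ 2 • J) a b) := by
      rw [mul_add, mul_sub, Finset.mul_sum]
      congr 1
      refine Finset.sum_congr rfl fun a _ => ?_
      simp only [Matrix.smul_apply, Pi.smul_apply, smul_eq_mul]
      field_simp
    rw [e, abs_mul, abs_of_pos (by positivity : 0 < (r x)⁻¹), hnorm]
    calc _ ≤ (r x)⁻¹ * (r x ^ 2 * ε * Fintype.card (Fin k ⊕ Fin h) * ‖ψ x - ψs x‖) := by gcongr
      _ = _ := by field_simp
  · have := value_expansion hl.isOpen hs (by positivity) hsub hH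
    rw [hψx] at this
    have e1 : ∑ b, (r x • (ψ x - ψs x)) b * ((r x)⁻¹ * grad (L x) (ψs x) b) =
        ∑ b, (ψ x - ψs x) b * grad (L x) (ψs x) b := by
      refine Finset.sum_congr rfl fun a _ => ?_
      simp only [Pi.smul_apply, smul_eq_mul]
      field_simp
    have e2 : ∑ b, (r x • (ψ x - ψs x)) b * ∑ a, (r x • (ψ x - ψs x)) a * J a b =
        ∑ b, (ψ x - ψs x) b * ∑ a, (ψ x - ψs x) a * (r x ^ 2 • J) a b := by
      refine Finset.sum_congr rfl fun b _ => ?_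
      rw [Finset.mul_sum, Finset.mul_sum]
      refine Finset.sum_congr rfl fun a _ => ?_
      simp only [Matrix.smul_apply, Pi.smul_apply, smul_eq_mul]
      ring
    rw [e1, e2, hnorm]
    refine this.trans (le_of_eq ?_)
    ring

lemma tendsto_sub_of_scaled (hl : Localized l r Ψ ψs) {ψ : X → Par k h} {C : ℝ}
    (hψ : ∀ᶠ x in l, ‖r x • (ψ x - ψs x)‖ ≤ C) : Tendsto (fun x => ψ x - ψs x) l (𝓝 0) := by
  have h0 : Tendsto (fun x => (r x)⁻¹ * C) l (𝓝 0) := by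
    simpa using hl.rate.inv_tendsto_atTop.mul_const C
  refine squeeze_zero_norm' ?_ h0
  filter_upwards [hψ, hl.rate.eventually_gt_atTop 0] with x hx hr
  rw [norm_smul, Real.norm_of_nonneg hr.le] at hx
  rw [← div_eq_inv_mul, le_div_iff₀ hr]
  linarith

lemma tendsto_sub_of_tendsto_scaled (hl : Localized l r Ψ ψs) {ψ : X → Par k h} {y : Par k h}
    (hψ : Tendsto (fun x => r x • (ψ x - ψs x)) l (𝓝 y)) :
    Tendsto (fun x => ψ x - ψs x) l (𝓝 0) :=
  tendsto_sub_of_scaled hl (C := ‖y‖ + 1) <| by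
    filter_upwards [hψ.norm.eventually (gt_mem_nhds (lt_add_one ‖y‖))] with x hx using hx.le

lemma tendsto_zero_of_forall_le_mul {f g : X → ℝ} {c : ℝ} (hg : Tendsto g l (𝓝 c))
    (hf : ∀ ε : ℝ, 0 < ε → ∀ᶠ x in l, |f x| ≤ ε * g x) : Tendsto f l (𝓝 0) := by
  rw [Metric.tendsto_nhds]
  intro ε hε
  have hc : c < |c| + 1 := by linarith [le_abs_self c]
  filter_upwards [hf (ε / (2 * (|c| + 1))) (by positivity), hg.eventually (gt_mem_nhds hc)]
    with x hx hx'
  rw [Real.dist_eq, sub_zero]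
  calc |f x| ≤ ε / (2 * (|c| + 1)) * g x := hx
    _ ≤ ε / (2 * (|c| + 1)) * (|c| + 1) := by gcongr
    _ = ε / 2 := by field_simp
    _ < ε := by linarith

lemma RegularAlong.tendsto_grad (hR : RegularAlong l r Ψ ψs J s L) (hl : Localized l r Ψ ψs)
    {ψ : X → Par k h} {y : Par k h} (hψ : Tendsto (fun x => r x • (ψ x - ψs x)) l (𝓝 y)) :
    Tendsto (fun x => (r x)⁻¹ • grad (L x) (ψ x)) l (𝓝 (s - y ᵥ* J)) := by
  have h0 := tendsto_sub_of_tendsto_scaled hl hψ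
  rw [tendsto_pi_nhds]
  intro b
  have hyb : Tendsto (fun x => ∑ a, (r x • (ψ x - ψs x)) a * J a b) l (𝓝 ((y ᵥ* J) b)) := by
    refine tendsto_finsetSum _ fun a _ => ?_
    exact ((tendsto_pi_nhds.1 hψ) a).mul_const _
  have hsb := (tendsto_pi_nhds.1 hR.score) b
  have hz : Tendsto (fun x => (r x)⁻¹ * grad (L x) (ψ x) b - (r x)⁻¹ * grad (L x) (ψs x) b
        + ∑ a, (r x • (ψ x - ψs x)) a * J a b) l (𝓝 0) := by
    refine tendsto_zero_of_forall_le_mul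
      (hψ.norm.const_mul (Fintype.card (Fin k ⊕ Fin h) : ℝ)) fun ε hε => ?_
    filter_upwards [hR.eventually_expansion hl h0 hε] with x hx
    refine (hx.1 b).trans (le_of_eq (by ring))
  have := (hz.add hsb).sub hyb
  rw [zero_add] at this
  refine this.congr fun x => ?_
  simp only [Pi.smul_apply, smul_eq_mul]
  ring

lemma RegularAlong.tendsto_value (hR : RegularAlong l r Ψ ψs J s L) (hl : Localized l r Ψ ψs)
    {ψ : X → Par k h} {y : Par k h} (hψ : Tendsto (fun x => r x • (ψ x - ψs x)) l (𝓝 y)) :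
    Tendsto (fun x => L x (ψ x) - L x (ψs x)) l (𝓝 (y ⬝ᵥ s - 1 / 2 * (y ⬝ᵥ (y ᵥ* J)))) := by
  have h0 := tendsto_sub_of_tendsto_scaled hl hψ
  have hyb : ∀ b, Tendsto (fun x => ∑ a, (r x • (ψ x - ψs x)) a * J a b) l (𝓝 ((y ᵥ* J) b)) := by
    intro b
    refine tendsto_finsetSum _ fun a _ => ?_
    exact ((tendsto_pi_nhds.1 hψ) a).mul_const _
  have h1 : Tendsto (fun x => ∑ b, (r x • (ψ x - ψs x)) b * ((r x)⁻¹ * grad (L x) (ψs x) b)) l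
      (𝓝 (y ⬝ᵥ s)) :=
    tendsto_finsetSum _ fun b _ => ((tendsto_pi_nhds.1 hψ) b).mul ((tendsto_pi_nhds.1 hR.score) b)
  have h2 : Tendsto (fun x => ∑ b, (r x • (ψ x - ψs x)) b *
      ∑ a, (r x • (ψ x - ψs x)) a * J a b) l (𝓝 (y ⬝ᵥ (y ᵥ* J))) :=
    tendsto_finsetSum _ fun b _ => ((tendsto_pi_nhds.1 hψ) b).mul (hyb b)
  have hz : Tendsto (fun x => L x (ψ x) - L x (ψs x)
      - ∑ b, (r x • (ψ x - ψs x)) b * ((r x)⁻¹ * grad (L x) (ψs x) b)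
      + 1 / 2 * ∑ b, (r x • (ψ x - ψs x)) b * ∑ a, (r x • (ψ x - ψs x)) a * J a b) l (𝓝 0) := by
    refine tendsto_zero_of_forall_le_mul
      ((hψ.norm.pow 2).const_mul ((Fintype.card (Fin k ⊕ Fin h) : ℝ) ^ 2)) fun ε hε => ?_
    filter_upwards [hR.eventually_expansion hl h0 hε] with x hx
    refine hx.2.trans (le_of_eq (by ring))
  have := (hz.add h1).sub (h2.const_mul (1 / 2))
  rw [zero_add] at this
  refine this.congr fun x => ?_
  ring

lemma RegularAlong.tendsto_info (hR : RegularAlong l r Ψ ψs J s L)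
    {ψ : X → Par k h} (hψ : Tendsto (fun x => ψ x - ψs x) l (𝓝 0)) (hmem : ∀ᶠ x in l, ψ x ∈ Ψ) :
    Tendsto (fun x => (r x ^ 2)⁻¹ • negHess (L x) (ψ x)) l (𝓝 J) := by
  refine tendsto_pi_nhds.2 fun a => tendsto_pi_nhds.2 fun b => ?_
  rw [Metric.tendsto_nhds]
  intro ε hε
  filter_upwards [hR.info _ (by simpa using hψ.norm) (ε / 2) (by positivity), hmem] with x hx hm
  have := hx (ψ x) hm le_rfl a b
  rw [Real.dist_eq]
  exact this.trans_lt (by linarith)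

/-- The constant is the minimum over the compact unit sphere, extended by homogeneity. The empty
sphere (no coordinates) is treated apart. -/
lemma exists_quadForm_lower_bound {ι : Type*} [Fintype ι] {J : Matrix ι ι ℝ}
    (hJ : J.PosDef) : ∃ c : ℝ, 0 < c ∧ ∀ y : ι → ℝ, c * ‖y‖ ^ 2 ≤ y ⬝ᵥ (y ᵥ* J) := by
  have hpos : ∀ y : ι → ℝ, y ≠ 0 → 0 < y ⬝ᵥ (y ᵥ* J) := by
    intro y hy
    have := hJ.dotProduct_mulVec_pos hy
    rwa [star_trivial, Matrix.dotProduct_mulVec, dotProduct_comm] at this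
  have hcont : Continuous fun y : ι → ℝ => y ⬝ᵥ (y ᵥ* J) := by
    refine Continuous.dotProduct continuous_id ?_
    exact Continuous.matrix_vecMul continuous_id continuous_const
  rcases (Metric.sphere (0 : ι → ℝ) 1).eq_empty_or_nonempty with hemp | hne
  · refine ⟨1, one_pos, fun y => ?_⟩
    have hy : y = 0 := by
      by_contra hy
      have : ‖y‖⁻¹ • y ∈ Metric.sphere (0 : ι → ℝ) 1 := by
        rw [mem_sphere_zero_iff_norm, norm_smul, norm_inv, norm_norm,
          inv_mul_cancel₀ (norm_ne_zero_iff.2 hy)]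
      rw [hemp] at this
      exact this
    simp [hy]
  · obtain ⟨z, hz, hmin⟩ := (isCompact_sphere (0 : ι → ℝ) 1).exists_isMinOn hne hcont.continuousOn
    have hz0 : z ≠ 0 := by
      rintro rfl
      simp at hz
    refine ⟨_, hpos z hz0, fun y => ?_⟩
    by_cases hy : y = 0
    · simp [hy]
    have hny : ‖y‖ ≠ 0 := norm_ne_zero_iff.2 hy
    have hmem : ‖y‖⁻¹ • y ∈ Metric.sphere (0 : ι → ℝ) 1 := by
      rw [mem_sphere_zero_iff_norm, norm_smul, norm_inv, norm_norm, inv_mul_cancel₀ hny]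
    have h1 : z ⬝ᵥ (z ᵥ* J) ≤ (‖y‖⁻¹ • y) ⬝ᵥ ((‖y‖⁻¹ • y) ᵥ* J) := hmin hmem
    rw [Matrix.smul_vecMul, smul_dotProduct, dotProduct_smul, smul_eq_mul, smul_eq_mul] at h1
    calc z ⬝ᵥ (z ᵥ* J) * ‖y‖ ^ 2
        ≤ ‖y‖⁻¹ * (‖y‖⁻¹ * (y ⬝ᵥ (y ᵥ* J))) * ‖y‖ ^ 2 := by gcongr
      _ = y ⬝ᵥ (y ᵥ* J) := by field_simp

/-- Near-maximizers are consistent. -/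
lemma RegularAlong.consistent (hR : RegularAlong l r Ψ ψs J s L) (hl : Localized l r Ψ ψs)
    {ψ : X → Par k h} (hmem : ∀ᶠ x in l, ψ x ∈ Ψ) {K : ℝ}
    (hK : ∀ᶠ x in l, L x (ψs x) - K ≤ L x (ψ x)) : Tendsto (fun x => ψ x - ψs x) l (𝓝 0) := by
  rw [tendsto_zero_iff_norm_tendsto_zero, Metric.tendsto_nhds]
  intro ε hε
  obtain ⟨c, hc, hsep⟩ := hR.sep ε hε
  have hr2 : Tendsto (fun x => c * r x ^ 2) l atTop :=
    ((tendsto_pow_atTop two_ne_zero).comp hl.rate).const_mul_atTop hc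
  filter_upwards [hmem, hK, hsep, hr2.eventually_gt_atTop K] with x h1 h2 h3 h4
  rw [Real.dist_eq, sub_zero, abs_of_nonneg (norm_nonneg _)]
  by_contra hcon
  have := h3 _ h1 (not_lt.1 hcon)
  linarith

/-- Near-maximizers are bounded at rate `r`. -/
lemma RegularAlong.bounded (hR : RegularAlong l r Ψ ψs J s L) (hl : Localized l r Ψ ψs)
    (hJ : J.PosDef) {ψ : X → Par k h} (hmem : ∀ᶠ x in l, ψ x ∈ Ψ) {K : ℝ}
    (hK : ∀ᶠ x in l, L x (ψs x) - K ≤ L x (ψ x)) :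
    ∃ C : ℝ, ∀ᶠ x in l, ‖r x • (ψ x - ψs x)‖ ≤ C := by
  obtain ⟨c, hc, hcJ⟩ := exists_quadForm_lower_bound hJ
  have h0 := hR.consistent hl hmem hK
  set D : ℝ := (Fintype.card (Fin k ⊕ Fin h) : ℝ) with hD
  have hD0 : 0 ≤ D := by positivity
  -- With this ε the remainder uses at most c/4 of the curvature gain (c/2)‖y‖². What is left bounds
  -- ‖y‖, and the summand 1 in the final constant allows ‖y‖ ≥ 1 to be assumed.
  set ε : ℝ := c / (4 * (D ^ 2 + 1)) with hε
  have hε0 : 0 < ε := by positivity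
  set B : ℝ := ‖s‖ + 1
  refine ⟨4 / c * (D * B + |K|) + 1, ?_⟩
  filter_upwards [hR.eventually_expansion hl h0 hε0, hK,
    hR.score.norm.eventually (gt_mem_nhds (lt_add_one ‖s‖))] with x hx hK hs
  set y := r x • (ψ x - ψs x) with hy
  have h1 := hx.2
  have h2 : |∑ b, y b * ((r x)⁻¹ * grad (L x) (ψs x) b)| ≤ B * D * ‖y‖ := by
    refine abs_sum_mul_le y _ fun b => ?_
    exact (norm_le_pi_norm ((r x)⁻¹ • grad (L x) (ψs x)) b).trans hs.le
  have h3 : c * ‖y‖ ^ 2 ≤ ∑ b, y b * ∑ a, y a * J a b := hcJ y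
  have h4 : ε * D ^ 2 ≤ c / 4 := by
    rw [hε, div_mul_eq_mul_div, div_le_div_iff₀ (by positivity) (by positivity)]
    nlinarith
  have h5 : ε * D ^ 2 * ‖y‖ ^ 2 ≤ c / 4 * ‖y‖ ^ 2 := by gcongr
  have h6 := (abs_le.1 h1).2
  have h7 := (abs_le.1 h2).2
  have h8 : c / 4 * ‖y‖ ^ 2 ≤ |K| + B * D * ‖y‖ := by
    linarith [le_abs_self K]
  by_contra hcon
  rw [not_le] at hcon
  have h9 : 1 ≤ ‖y‖ := by
    have : 0 ≤ 4 / c * (D * B + |K|) := by positivity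
    linarith
  have h10 : |K| ≤ |K| * ‖y‖ := le_mul_of_one_le_right (abs_nonneg _) h9
  have h11 : c / 4 * ‖y‖ * ‖y‖ ≤ (|K| + B * D) * ‖y‖ := by nlinarith
  have h12 : c / 4 * ‖y‖ ≤ |K| + B * D := le_of_mul_le_mul_right h11 (by linarith)
  have h13 : c / 4 * (4 / c * (D * B + |K|) + 1) < c / 4 * ‖y‖ :=
    mul_lt_mul_of_pos_left hcon (by positivity)
  have h14 : c / 4 * (4 / c * (D * B + |K|) + 1) = D * B + |K| + c / 4 := by field_simp
  linarith

/-- Existence of constrained maximizers. -/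
lemma RegularAlong.exists_max (hR : RegularAlong l r Ψ ψs J s L) (hl : Localized l r Ψ ψs)
    {A : X → Set (Par k h)} (hA : ∀ x, IsClosed (A x)) {φ : X → Par k h} (hφA : ∀ x, φ x ∈ A x)
    {y : Par k h} (hφ : Tendsto (fun x => r x • (φ x - ψs x)) l (𝓝 y)) :
    ∀ᶠ x in l, φ x ∈ Ψ ∧ ∃ ψ ∈ Ψ ∩ A x, ∀ χ ∈ Ψ ∩ A x, L x χ ≤ L x ψ := by
  obtain ⟨ρ, hρ, hball⟩ := hl.exists_ball
  obtain ⟨c, hc, hsep⟩ := hR.sep ρ hρ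
  have h0 := tendsto_sub_of_tendsto_scaled hl hφ
  have hn : Tendsto (fun x => ‖φ x - ψs x‖) l (𝓝 0) := by simpa using h0.norm
  have hv := hR.tendsto_value hl hφ
  set v := y ⬝ᵥ s - 1 / 2 * (y ⬝ᵥ (y ᵥ* J))
  have hr2 : Tendsto (fun x => c * r x ^ 2) l atTop :=
    ((tendsto_pow_atTop two_ne_zero).comp hl.rate).const_mul_atTop hc
  filter_upwards [hball, hsep, hn.eventually (gt_mem_nhds hρ),
    hv.eventually (lt_mem_nhds (sub_one_lt v)), hr2.eventually_gt_atTop (1 - v), hR.smooth]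
    with x h1 h2 h3 h4 h5 h6
  have hφb : φ x ∈ Metric.closedBall (ψs x) ρ := by
    rw [mem_closedBall_iff_norm]; exact h3.le
  have hcomp : IsCompact (Metric.closedBall (ψs x) ρ ∩ A x) :=
    (isCompact_closedBall _ _).inter_right (hA x)
  obtain ⟨ψ, hψ, hmax⟩ := hcomp.exists_isMaxOn ⟨φ x, hφb, hφA x⟩
    (h6.continuousOn.mono (Set.inter_subset_left.trans h1))
  refine ⟨h1 hφb, ψ, ⟨h1 hψ.1, hψ.2⟩, fun χ hχ => ?_⟩
  -- Inside the ball compactness decides. Outside, separation puts χ more than 1 - v below the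
  -- centre, whereas the feasible point `φ x` lies less than 1 - v below it.
  by_cases hχb : ‖χ - ψs x‖ ≤ ρ
  · exact hmax ⟨mem_closedBall_iff_norm.2 hχb, hχ.2⟩
  · have h7 := h2 χ hχ.1 (not_le.1 hχb).le
    have h8 : L x (φ x) ≤ L x ψ := hmax ⟨hφb, hφA x⟩
    linarith

end Along

/-! ### Sums of regular log-likelihoods -/

section Sums

variable {k h : ℕ} {X : Type*} {l : Filter X} {r : X → ℝ} {Ψ : Set (Par k h)} {ψs : X → Par k h}

lemma grad_congr {L L' : Par k h → ℝ} (hΨ : IsOpen Ψ) (hL : Set.EqOn L L' Ψ) {ψ : Par k h}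
    (hψ : ψ ∈ Ψ) : grad L ψ = grad L' ψ := by
  have : L =ᶠ[𝓝 ψ] L' := by
    filter_upwards [hΨ.mem_nhds hψ] with φ hφ using hL hφ
  funext a
  rw [grad, grad, this.fderiv_eq]

lemma negHess_congr {L L' : Par k h → ℝ} (hΨ : IsOpen Ψ) (hL : Set.EqOn L L' Ψ) {ψ : Par k h}
    (hψ : ψ ∈ Ψ) : negHess L ψ = negHess L' ψ := by
  ext a b
  have : (fun φ => grad L φ b) =ᶠ[𝓝 ψ] fun φ => grad L' φ b := by
    filter_upwards [hΨ.mem_nhds hψ] with φ hφ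
    rw [grad_congr hΨ hL hφ]
  simp only [negHess, Matrix.of_apply]
  rw [this.fderiv_eq]

lemma grad_add {L L' : Par k h → ℝ} (hΨ : IsOpen Ψ) (hL : ContDiffOn ℝ 2 L Ψ)
    (hL' : ContDiffOn ℝ 2 L' Ψ) {ψ : Par k h} (hψ : ψ ∈ Ψ) :
    grad (fun φ => L φ + L' φ) ψ = grad L ψ + grad L' ψ := by
  have h1 := (hL.contDiffAt (hΨ.mem_nhds hψ)).differentiableAt (by norm_num)
  have h2 := (hL'.contDiffAt (hΨ.mem_nhds hψ)).differentiableAt (by norm_num)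
  funext a
  simp only [grad, Pi.add_apply]
  rw [fderiv_fun_add h1 h2]
  rfl

lemma negHess_add {L L' : Par k h → ℝ} (hΨ : IsOpen Ψ) (hL : ContDiffOn ℝ 2 L Ψ)
    (hL' : ContDiffOn ℝ 2 L' Ψ) {ψ : Par k h} (hψ : ψ ∈ Ψ) :
    negHess (fun φ => L φ + L' φ) ψ = negHess L ψ + negHess L' ψ := by
  ext a b
  have h1 := ((contDiffOn_grad hΨ hL b).contDiffAt (hΨ.mem_nhds hψ)).differentiableAt (by norm_num)
  have h2 := ((contDiffOn_grad hΨ hL' b).contDiffAt (hΨ.mem_nhds hψ)).differentiableAt (by norm_num)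
  have : (fun φ => grad (fun φ => L φ + L' φ) φ b) =ᶠ[𝓝 ψ] fun φ => grad L φ b + grad L' φ b := by
    filter_upwards [hΨ.mem_nhds hψ] with φ hφ
    rw [grad_add hΨ hL hL' hφ]
    rfl
  simp only [negHess, Matrix.of_apply, Matrix.add_apply]
  rw [this.fderiv_eq, fderiv_fun_add h1 h2]
  simp only [add_apply]
  ring

variable {J J' : Matrix (Fin k ⊕ Fin h) (Fin k ⊕ Fin h) ℝ} {s s' : Par k h}
  {L L' : X → Par k h → ℝ}


lemma RegularAlong.congr (hR : RegularAlong l r Ψ ψs J s L) (hl : Localized l r Ψ ψs)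
    (hL : ∀ᶠ x in l, Set.EqOn (L x) (L' x) Ψ) : RegularAlong l r Ψ ψs J s L' where
  smooth := by
    filter_upwards [hR.smooth, hL] with x h1 h2 using h1.congr fun ψ hψ => (h2 hψ).symm
  score := by
    refine hR.score.congr' ?_
    filter_upwards [hL, hl.centre_mem] with x h1 h2
    rw [grad_congr hl.isOpen h1 h2]
  info := by
    intro ρ hρ ε hε
    filter_upwards [hR.info ρ hρ ε hε, hL] with x h1 h2 ψ hψ hn
    rw [← negHess_congr hl.isOpen h2 hψ]
    exact h1 ψ hψ hn
  sep := by
    intro ρ hρ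
    obtain ⟨c, hc, h⟩ := hR.sep ρ hρ
    refine ⟨c, hc, ?_⟩
    filter_upwards [h, hL, hl.centre_mem] with x h1 h2 h3 ψ hψ hn
    rw [← h2 hψ, ← h2 h3]
    exact h1 ψ hψ hn

lemma RegularAlong.add (hR : RegularAlong l r Ψ ψs J s L) (hR' : RegularAlong l r Ψ ψs J' s' L')
    (hl : Localized l r Ψ ψs) :
    RegularAlong l r Ψ ψs (J + J') (s + s') fun x ψ => L x ψ + L' x ψ where
  smooth := by
    filter_upwards [hR.smooth, hR'.smooth] with x h1 h2 using h1.add h2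
  score := by
    refine (hR.score.add hR'.score).congr' ?_
    filter_upwards [hR.smooth, hR'.smooth, hl.centre_mem] with x h1 h2 h3
    rw [grad_add hl.isOpen h1 h2 h3, smul_add]
  info := by
    intro ρ hρ ε hε
    filter_upwards [hR.info ρ hρ (ε / 2) (by positivity), hR'.info ρ hρ (ε / 2) (by positivity),
      hR.smooth, hR'.smooth] with x h1 h2 h3 h4 ψ hψ hn a b
    rw [negHess_add hl.isOpen h3 h4 hψ]
    have e : (r x ^ 2)⁻¹ * (negHess (L x) ψ + negHess (L' x) ψ) a b - (J + J') a b =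
        ((r x ^ 2)⁻¹ * negHess (L x) ψ a b - J a b) +
          ((r x ^ 2)⁻¹ * negHess (L' x) ψ a b - J' a b) := by
      simp only [Matrix.add_apply]
      ring
    rw [e]
    linarith [abs_add_le ((r x ^ 2)⁻¹ * negHess (L x) ψ a b - J a b)
      ((r x ^ 2)⁻¹ * negHess (L' x) ψ a b - J' a b), h1 ψ hψ hn a b, h2 ψ hψ hn a b]
  sep := by
    intro ρ hρ
    obtain ⟨c, hc, h⟩ := hR.sep ρ hρ
    obtain ⟨c', hc', h'⟩ := hR'.sep ρ hρ
    refine ⟨c + c', by positivity, ?_⟩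
    filter_upwards [h, h'] with x h1 h2 ψ hψ hn
    linarith [h1 ψ hψ hn, h2 ψ hψ hn]

/-- Scores, informations and separation constants add up, so regularity of single imputed datasets
passes to every stack. The empty stack is excluded because the zero function has no separated
maximum. -/
lemma RegularAlong.multiset_sum {ι : Type*} {L : ι → X → Par k h → ℝ} {s : ι → Par k h}
    (hl : Localized l r Ψ ψs) (hR : ∀ i, RegularAlong l r Ψ ψs J (s i) (L i)) (S : Multiset ι)
    (hS : S ≠ 0) :
    RegularAlong l r Ψ ψs ((S.card : ℝ) • J) (S.map s).sum
      fun x ψ => (S.map fun i => L i x ψ).sum := by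
  induction S using Multiset.induction_on with
  | empty => exact absurd rfl hS
  | cons a S ih =>
    rcases eq_or_ne S 0 with rfl | h0
    · simpa using hR a
    · have := (hR a).add (ih h0) hl
      have e : J + (S.card : ℝ) • J = ((a ::ₘ S).card : ℝ) • J := by
        rw [Multiset.card_cons]
        push_cast
        rw [add_smul, one_smul, add_comm]
      rw [e] at this
      simpa using this

end Sums

/-! ### Limits of the testing devices along an ultrafilter -/

section Limits

variable {k h : ℕ} {X : Type*} {u : Ultrafilter X} {r : X → ℝ} {Ψ : Set (Par k h)}
  {ψs : X → Par k h} {J : Matrix (Fin k ⊕ Fin h) (Fin k ⊕ Fin h) ℝ} {s : Par k h}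
  {L : X → Par k h → ℝ}

/-- This is the reason for working with ultrafilters: compactness gives limits of all bounded
quantities at once, without passing to subsequences. -/
lemma exists_tendsto_of_bounded {E : Type*} [SeminormedAddCommGroup E] [ProperSpace E] {y : X → E}
    {C : ℝ} (hy : ∀ᶠ x in (u : Filter X), ‖y x‖ ≤ C) : ∃ z, Tendsto y u (𝓝 z) := by
  have h : ((u.map y : Ultrafilter E) : Filter E) ≤ 𝓟 (Metric.closedBall 0 C) := by
    rw [le_principal_iff, Ultrafilter.coe_map, mem_map]
    filter_upwards [hy] with x hx
    simpa using hx
  obtain ⟨z, -, hz⟩ := (isCompact_closedBall (0 : E) C).ultrafilter_le_nhds _ h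
  exact ⟨z, hz⟩

lemma tendsto_matrix_inv {ι : Type*} [Fintype ι] [DecidableEq ι] {l : Filter X}
    {A : X → Matrix ι ι ℝ} {B : Matrix ι ι ℝ} (hA : Tendsto A l (𝓝 B)) (hB : B.det ≠ 0) :
    Tendsto (fun x => (A x)⁻¹) l (𝓝 B⁻¹) := by
  have h1 : Tendsto (fun x => (A x).det) l (𝓝 B.det) :=
    (Continuous.matrix_det continuous_id).continuousAt.tendsto.comp hA
  have h2 : Tendsto (fun x => (A x).adjugate) l (𝓝 B.adjugate) :=
    (Continuous.matrix_adjugate continuous_id).continuousAt.tendsto.comp hA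
  simp_rw [Matrix.inv_def, Ring.inverse_eq_inv']
  exact (h1.inv₀ hB).smul h2

lemma matrix_inv_smul {ι : Type*} [Fintype ι] [DecidableEq ι] (A : Matrix ι ι ℝ) {c : ℝ}
    (hc : c ≠ 0) : (c • A)⁻¹ = c⁻¹ • A⁻¹ := by
  by_cases hA : IsUnit A.det
  · exact Matrix.inv_eq_left_inv (by
      rw [Matrix.smul_mul, Matrix.mul_smul, smul_smul, inv_mul_cancel₀ hc, one_smul,
        Matrix.nonsing_inv_mul _ hA])
  · have hA' : ¬ IsUnit (c • A).det := by
      rw [Matrix.det_smul]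
      simpa [hc] using hA
    rw [Matrix.nonsing_inv_apply_not_isUnit _ hA, Matrix.nonsing_inv_apply_not_isUnit _ hA',
      smul_zero]

lemma quadForm_smul {ι : Type*} [Fintype ι] [DecidableEq ι] (A : Matrix ι ι ℝ) (v : ι → ℝ) {c : ℝ}
    (hc : c ≠ 0) : (c • v) ⬝ᵥ ((c ^ 2 • A)⁻¹ *ᵥ (c • v)) = v ⬝ᵥ (A⁻¹ *ᵥ v) := by
  rw [matrix_inv_smul _ (pow_ne_zero 2 hc), Matrix.smul_mulVec, Matrix.mulVec_smul,
    smul_dotProduct, dotProduct_smul, dotProduct_smul]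
  simp only [smul_eq_mul]
  field_simp

lemma tendsto_quadForm {ι : Type*} [Fintype ι] [DecidableEq ι] {l : Filter X}
    {A : X → Matrix ι ι ℝ} {B : Matrix ι ι ℝ} {v : X → ι → ℝ} {w : ι → ℝ}
    (hA : Tendsto A l (𝓝 B)) (hB : B.det ≠ 0) (hv : Tendsto v l (𝓝 w)) :
    Tendsto (fun x => v x ⬝ᵥ ((A x)⁻¹ *ᵥ v x)) l (𝓝 (w ⬝ᵥ (B⁻¹ *ᵥ w))) := by
  have hc : Continuous fun p : Matrix ι ι ℝ × (ι → ℝ) => p.2 ⬝ᵥ (p.1 *ᵥ p.2) :=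
    continuous_snd.dotProduct (continuous_fst.matrix_mulVec continuous_snd)
  exact (hc.tendsto (B⁻¹, w)).comp ((tendsto_matrix_inv hA hB).prodMk_nhds hv)

lemma posDef_thetaVar (hJ : J.PosDef) : (thetaVar J).PosDef := by
  have := hJ.inv.submatrix (e := (Sum.inl : Fin k → Fin k ⊕ Fin h)) Sum.inl_injective
  exact this

lemma thetaVar_smul (J : Matrix (Fin k ⊕ Fin h) (Fin k ⊕ Fin h) ℝ) {c : ℝ} (hc : c ≠ 0) :
    thetaVar (c • J) = c⁻¹ • thetaVar J := by
  rw [thetaVar, matrix_inv_smul _ hc]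
  rfl

/-- Unrestricted maximizers. -/
lemma RegularAlong.tendsto_max (hR : RegularAlong u r Ψ ψs J s L) (hl : Localized u r Ψ ψs)
    (hJ : J.PosDef) {ψ : X → Par k h}
    (hψ : ∀ᶠ x in (u : Filter X), ψ x ∈ Ψ ∧ ∀ χ ∈ Ψ, L x χ ≤ L x (ψ x)) :
    ∃ y, Tendsto (fun x => r x • (ψ x - ψs x)) u (𝓝 y) ∧ s = y ᵥ* J := by
  obtain ⟨C, hC⟩ := hR.bounded hl hJ (hψ.mono fun x hx => hx.1) (K := 0) (by
    filter_upwards [hψ, hl.centre_mem] with x hx hc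
    rw [sub_zero]
    exact hx.2 _ hc)
  obtain ⟨y, hy⟩ := exists_tendsto_of_bounded hC
  refine ⟨y, hy, ?_⟩
  have h1 := hR.tendsto_grad hl hy
  have h2 : Tendsto (fun x => (r x)⁻¹ • grad (L x) (ψ x)) u (𝓝 0) := by
    refine tendsto_const_nhds.congr' ?_
    filter_upwards [hψ] with x hx
    have hmax : IsLocalMax (L x) (ψ x) := by
      filter_upwards [hl.isOpen.mem_nhds hx.1] with χ hχ using hx.2 χ hχ
    have : grad (L x) (ψ x) = 0 := by
      funext a
      simp [grad, hmax.fderiv_eq_zero]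
    rw [this, smul_zero]
  exact sub_eq_zero.1 (tendsto_nhds_unique h1 h2)

/-- The centre, shifted to satisfy the null hypothesis. -/
def nullShift (θ₀ : Fin k → ℝ) (ψ : Par k h) : Par k h := Sum.elim θ₀ fun j => ψ (Sum.inr j)

lemma tendsto_nullShift {θ₀ τ : Fin k → ℝ}
    (hτ : Tendsto (fun x => r x • (theta (ψs x) - θ₀)) u (𝓝 τ)) :
    Tendsto (fun x => r x • (nullShift θ₀ (ψs x) - ψs x)) u (𝓝 (Sum.elim (-τ) 0)) := by
  rw [tendsto_pi_nhds]
  rintro (j | j)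
  · have := ((tendsto_pi_nhds.1 hτ) j).neg
    refine this.congr fun x => ?_
    simp only [nullShift, Pi.smul_apply, Pi.sub_apply, theta, smul_eq_mul, Sum.elim_inl]
    ring
  · simp [nullShift]

lemma isClosed_theta_eq (θ₀ : Fin k → ℝ) : IsClosed {ψ : Par k h | theta ψ = θ₀} :=
  isClosed_eq (continuous_pi fun _ => continuous_apply _) continuous_const

/-- Maximizers under the null hypothesis. -/
lemma RegularAlong.tendsto_max_null (hR : RegularAlong u r Ψ ψs J s L) (hl : Localized u r Ψ ψs)
    (hJ : J.PosDef) {θ₀ τ : Fin k → ℝ}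
    (hτ : Tendsto (fun x => r x • (theta (ψs x) - θ₀)) u (𝓝 τ)) {ψ : X → Par k h}
    (hψ : ∀ᶠ x in (u : Filter X), ψ x ∈ Ψ ∧ theta (ψ x) = θ₀ ∧
      ∀ χ ∈ Ψ, theta χ = θ₀ → L x χ ≤ L x (ψ x)) :
    ∃ y, Tendsto (fun x => r x • (ψ x - ψs x)) u (𝓝 y) ∧ theta y = -τ ∧
      ∀ j, (s - y ᵥ* J) (Sum.inr j) = 0 := by
  have hφ := tendsto_nullShift hτ
  have hv := hR.tendsto_value hl hφ
  set v := (Sum.elim (-τ) 0 : Par k h) ⬝ᵥ s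
    - 1 / 2 * ((Sum.elim (-τ) 0 : Par k h) ⬝ᵥ ((Sum.elim (-τ) 0 : Par k h) ᵥ* J))
  have hφΨ := hR.exists_max hl (fun _ => isClosed_theta_eq θ₀)
    (fun x => (rfl : theta (nullShift θ₀ (ψs x)) = θ₀)) hφ
  -- The centre may violate the null hypothesis, so the comparison point is the shifted centre. Its
  -- log-likelihood ratio to the centre converges to v.
  obtain ⟨C, hC⟩ := hR.bounded hl hJ (hψ.mono fun x hx => hx.1) (K := 1 - v) (by
    filter_upwards [hψ, hφΨ, hv.eventually (lt_mem_nhds (sub_one_lt v))] with x hx h1 h2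
    linarith [hx.2.2 _ h1.1 rfl])
  obtain ⟨y, hy⟩ := exists_tendsto_of_bounded hC
  refine ⟨y, hy, ?_, fun j => ?_⟩
  · funext j
    have h1 := (tendsto_pi_nhds.1 hy) (Sum.inl j)
    have h2 := ((tendsto_pi_nhds.1 hτ) j).neg
    refine tendsto_nhds_unique h1 (h2.congr' ?_)
    filter_upwards [hψ] with x hx
    rw [← hx.2.1]
    simp only [theta, Pi.smul_apply, Pi.sub_apply, smul_eq_mul]
    ring
  · have h1 := (tendsto_pi_nhds.1 (hR.tendsto_grad hl hy)) (Sum.inr j)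
    have h2 : Tendsto (fun x => ((r x)⁻¹ • grad (L x) (ψ x)) (Sum.inr j)) u (𝓝 0) := by
      refine tendsto_const_nhds.congr' ?_
      filter_upwards [hψ, hR.smooth] with x hx hs
      have hd := (hs.contDiffAt (hl.isOpen.mem_nhds hx.1)).differentiableAt (by norm_num)
      -- Moving a nuisance coordinate preserves the constraint on θ, so stationarity is available in
      -- exactly these directions.
      set e : Par k h := Pi.single (Sum.inr j) 1 with he
      have hline : HasDerivAt (fun t : ℝ => ψ x + t • e) e 0 := by
        simpa using ((hasDerivAt_id (0 : ℝ)).smul_const e).const_add (ψ x)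
      have hd' : HasFDerivAt (L x) (fderiv ℝ (L x) (ψ x)) (ψ x + (0 : ℝ) • e) := by
        simpa using hd.hasFDerivAt
      have hder := hd'.comp_hasDerivAt (0 : ℝ) hline
      have hmax : IsLocalMax (L x ∘ fun t : ℝ => ψ x + t • e) 0 := by
        have hcont : ContinuousAt (fun t : ℝ => ψ x + t • e) 0 := hline.continuousAt
        have hmem : Ψ ∈ 𝓝 (ψ x + (0 : ℝ) • e) := by
          simpa using hl.isOpen.mem_nhds hx.1
        filter_upwards [hcont hmem] with t ht
        have : L x (ψ x + t • e) ≤ L x (ψ x) := by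
          refine hx.2.2 _ ht ?_
          rw [← hx.2.1]
          funext i
          simp [theta, he]
        simpa using this
      have := hmax.hasDerivAt_eq_zero hder
      simp only [Pi.smul_apply, grad, smul_eq_mul]
      rw [← he, this, mul_zero]
    exact tendsto_nhds_unique h1 h2

/-- Algebra of the limiting quadratic forms. -/
lemma quadForm_limits (hJ : J.PosDef) {y y₀ : Par k h} (hs : s = y ᵥ* J)
    (hw : ∀ j, (s - y₀ ᵥ* J) (Sum.inr j) = 0) :
    2 * ((y ⬝ᵥ s - 1 / 2 * (y ⬝ᵥ (y ᵥ* J))) - (y₀ ⬝ᵥ s - 1 / 2 * (y₀ ⬝ᵥ (y₀ ᵥ* J)))) =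
        theta (y - y₀) ⬝ᵥ ((thetaVar J)⁻¹ *ᵥ theta (y - y₀)) ∧
      (s - y₀ ᵥ* J) ⬝ᵥ (J⁻¹ *ᵥ (s - y₀ ᵥ* J)) =
        theta (y - y₀) ⬝ᵥ ((thetaVar J)⁻¹ *ᵥ theta (y - y₀)) := by
  set w := s - y₀ ᵥ* J with hwdef
  set z := y - y₀ with hz
  have hJT : Jᵀ = J := by simpa using hJ.isHermitian.eq
  have hdet : IsUnit J.det := hJ.det_pos.ne'.isUnit
  have hsym : ∀ v : Par k h, v ᵥ* J = J *ᵥ v := fun v => by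
    rw [← Matrix.mulVec_transpose, hJT]
  have hJz : J *ᵥ z = w := by
    rw [hz, hwdef, hs, Matrix.mulVec_sub, hsym, hsym]
  have hzw : z = J⁻¹ *ᵥ w := by
    rw [← hJz, Matrix.mulVec_mulVec, Matrix.nonsing_inv_mul _ hdet, Matrix.one_mulVec]
  -- By `hw` the limiting restricted score has no nuisance part, so only the θ-block of J⁻¹ acts on
  -- it.
  have hθ : theta z = thetaVar J *ᵥ theta w := by
    funext i
    rw [hzw]
    simp only [theta, thetaVar, Matrix.mulVec, dotProduct, Fintype.sum_sum_type,
      Matrix.toBlocks₁₁, Matrix.of_apply]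
    simp [hw]
  have hV : IsUnit (thetaVar J).det := (posDef_thetaVar hJ).det_pos.ne'.isUnit
  have hw1 : (thetaVar J)⁻¹ *ᵥ theta z = theta w := by
    rw [hθ, Matrix.mulVec_mulVec, Matrix.nonsing_inv_mul _ hV, Matrix.one_mulVec]
  have hzdw : z ⬝ᵥ w = theta z ⬝ᵥ theta w := by
    simp only [dotProduct, Fintype.sum_sum_type, theta]
    simp [hw]
  rw [hw1, ← hzdw]
  refine ⟨?_, by rw [← hzw, dotProduct_comm]⟩
  have hbil : ∀ a b : Par k h, a ⬝ᵥ (J *ᵥ b) = b ⬝ᵥ (J *ᵥ a) := by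
    intro a b
    rw [Matrix.dotProduct_mulVec, hsym, dotProduct_comm]
  rw [← hJz, hs, hsym, hsym, hz, Matrix.mulVec_sub]
  simp only [dotProduct_sub, sub_dotProduct]
  rw [hbil y₀ y]
  ring

variable {θ₀ τ : Fin k → ℝ} {ψ ψ₀ : X → Par k h}

/-- The scaled deviation of the maximizer from the null value. -/
lemma tendsto_theta_sub (hτ : Tendsto (fun x => r x • (theta (ψs x) - θ₀)) u (𝓝 τ)) {y : Par k h}
    (hy : Tendsto (fun x => r x • (ψ x - ψs x)) u (𝓝 y)) :
    Tendsto (fun x => r x • (theta (ψ x) - θ₀)) u (𝓝 (theta y + τ)) := by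
  have h1 : Tendsto (fun x => theta (r x • (ψ x - ψs x))) u (𝓝 (theta y)) :=
    tendsto_pi_nhds.2 fun j => (tendsto_pi_nhds.1 hy) (Sum.inl j)
  refine (h1.add hτ).congr fun x => ?_
  funext j
  simp only [theta, Pi.add_apply, Pi.smul_apply, Pi.sub_apply, smul_eq_mul]
  ring

/-- The two value limits differ by half the Wald-type form, by `quadForm_limits`. The offset τ
appears because the scaled restricted maximizer has θ-part -τ. -/
lemma RegularAlong.tendsto_lrt (hR : RegularAlong u r Ψ ψs J s L) (hl : Localized u r Ψ ψs)
    (hJ : J.PosDef) (hτ : Tendsto (fun x => r x • (theta (ψs x) - θ₀)) u (𝓝 τ))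
    (hψ : ∀ᶠ x in (u : Filter X), ψ x ∈ Ψ ∧ ∀ χ ∈ Ψ, L x χ ≤ L x (ψ x))
    (hψ₀ : ∀ᶠ x in (u : Filter X), ψ₀ x ∈ Ψ ∧ theta (ψ₀ x) = θ₀ ∧
      ∀ χ ∈ Ψ, theta χ = θ₀ → L x χ ≤ L x (ψ₀ x)) {y : Par k h}
    (hy : Tendsto (fun x => r x • (ψ x - ψs x)) u (𝓝 y)) :
    Tendsto (fun x => 2 * (L x (ψ x) - L x (ψ₀ x))) u
      (𝓝 ((theta y + τ) ⬝ᵥ ((thetaVar J)⁻¹ *ᵥ (theta y + τ)))) := by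
  obtain ⟨y', hy', hs⟩ := hR.tendsto_max hl hJ hψ
  obtain rfl := tendsto_nhds_unique hy hy'
  obtain ⟨y₀, hy₀, hθ, hw⟩ := hR.tendsto_max_null hl hJ hτ hψ₀
  have e : theta (y - y₀) = theta y + τ := by
    have : theta (y - y₀) = theta y - theta y₀ := rfl
    rw [this, hθ, sub_neg_eq_add]
  rw [← e, ← (quadForm_limits hJ hs hw).1]
  refine (((hR.tendsto_value hl hy).sub (hR.tendsto_value hl hy₀)).const_mul 2).congr fun x => ?_
  ring

/-- The scaled score at the restricted maximizer tends to s - y₀J, whose nuisance part vanishes. Its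
form in J⁻¹ is therefore the same Wald-type form. -/
lemma RegularAlong.tendsto_rao (hR : RegularAlong u r Ψ ψs J s L) (hl : Localized u r Ψ ψs)
    (hJ : J.PosDef) (hτ : Tendsto (fun x => r x • (theta (ψs x) - θ₀)) u (𝓝 τ))
    (hψ : ∀ᶠ x in (u : Filter X), ψ x ∈ Ψ ∧ ∀ χ ∈ Ψ, L x χ ≤ L x (ψ x))
    (hψ₀ : ∀ᶠ x in (u : Filter X), ψ₀ x ∈ Ψ ∧ theta (ψ₀ x) = θ₀ ∧
      ∀ χ ∈ Ψ, theta χ = θ₀ → L x χ ≤ L x (ψ₀ x)) {y : Par k h}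
    (hy : Tendsto (fun x => r x • (ψ x - ψs x)) u (𝓝 y)) :
    Tendsto (fun x => grad (L x) (ψ₀ x) ⬝ᵥ ((negHess (L x) (ψ₀ x))⁻¹ *ᵥ grad (L x) (ψ₀ x))) u
      (𝓝 ((theta y + τ) ⬝ᵥ ((thetaVar J)⁻¹ *ᵥ (theta y + τ)))) := by
  obtain ⟨y', hy', hs⟩ := hR.tendsto_max hl hJ hψ
  obtain rfl := tendsto_nhds_unique hy hy'
  obtain ⟨y₀, hy₀, hθ, hw⟩ := hR.tendsto_max_null hl hJ hτ hψ₀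
  have e : theta (y - y₀) = theta y + τ := by
    have : theta (y - y₀) = theta y - theta y₀ := rfl
    rw [this, hθ, sub_neg_eq_add]
  rw [← e, ← (quadForm_limits hJ hs hw).2]
  have hI := hR.tendsto_info (tendsto_sub_of_tendsto_scaled hl hy₀) (hψ₀.mono fun x hx => hx.1)
  refine (tendsto_quadForm hI hJ.det_pos.ne' (hR.tendsto_grad hl hy₀)).congr' ?_
  filter_upwards [hl.rate.eventually_gt_atTop 0] with x hx
  rw [← inv_pow, quadForm_smul _ _ (inv_ne_zero hx.ne')]

lemma RegularAlong.tendsto_wald (hR : RegularAlong u r Ψ ψs J s L) (hl : Localized u r Ψ ψs)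
    (hJ : J.PosDef) (hτ : Tendsto (fun x => r x • (theta (ψs x) - θ₀)) u (𝓝 τ))
    (hψ : ∀ᶠ x in (u : Filter X), ψ x ∈ Ψ) {y : Par k h}
    (hy : Tendsto (fun x => r x • (ψ x - ψs x)) u (𝓝 y)) {V : X → Matrix (Fin k) (Fin k) ℝ}
    (hV : ∀ a b, Tendsto (fun x => r x ^ 2 * (V x a b - thetaVar (negHess (L x) (ψ x)) a b)) u
      (𝓝 0)) :
    Tendsto (fun x => (theta (ψ x) - θ₀) ⬝ᵥ ((V x)⁻¹ *ᵥ (theta (ψ x) - θ₀))) u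
      (𝓝 ((theta y + τ) ⬝ᵥ ((thetaVar J)⁻¹ *ᵥ (theta y + τ)))) := by
  have hI := tendsto_matrix_inv (hR.tendsto_info (tendsto_sub_of_tendsto_scaled hl hy) hψ)
    hJ.det_pos.ne'
  have hrV : Tendsto (fun x => r x ^ 2 • V x) u (𝓝 (thetaVar J)) := by
    refine tendsto_pi_nhds.2 fun a => tendsto_pi_nhds.2 fun b => ?_
    have h1 := (tendsto_pi_nhds.1 ((tendsto_pi_nhds.1 hI) (Sum.inl a))) (Sum.inl b)
    have h2 := (hV a b).add h1
    rw [zero_add] at h2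
    refine h2.congr' ?_
    filter_upwards [hl.rate.eventually_gt_atTop 0] with x hx
    have hr : r x ^ 2 ≠ 0 := by positivity
    rw [matrix_inv_smul _ (inv_ne_zero hr), inv_inv]
    simp only [thetaVar, Matrix.toBlocks₁₁, Matrix.of_apply, Matrix.smul_apply, smul_eq_mul]
    ring
  refine (tendsto_quadForm hrV (posDef_thetaVar hJ).det_pos.ne' (tendsto_theta_sub hτ hy)).congr' ?_
  filter_upwards [hl.rate.eventually_gt_atTop 0] with x hx
  rw [quadForm_smul _ _ hx.ne']

end Limits

/-! ### Events of probability tending to one -/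

namespace MIProblem

variable {p k h m : ℕ} (Q : MIProblem p k h m)

/-- The filter of events whose probability tends to one. -/
def whp : Filter (Σ n, Q.Ω n) where
  sets := {A | Tendsto (fun n => Q.P n {ω | (⟨n, ω⟩ : Σ n, Q.Ω n) ∉ A}) atTop (𝓝 0)}
  univ_sets := by simp
  sets_of_superset := by
    intro A B hA hAB
    refine tendsto_of_tendsto_of_tendsto_of_le_of_le tendsto_const_nhds hA (fun _ => zero_le)
      fun n => measure_mono fun ω hω hω' => hω (hAB hω')
  inter_sets := by
    intro A B hA hB
    have hsum := Tendsto.add (Set.mem_ofPred.1 hA) (Set.mem_ofPred.1 hB)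
    rw [add_zero] at hsum
    refine tendsto_of_tendsto_of_tendsto_of_le_of_le tendsto_const_nhds hsum (fun _ => zero_le)
      fun n => ?_
    refine (measure_mono fun ω hω => ?_).trans (measure_union_le _ _)
    by_contra hcon
    simp only [Set.mem_union, Set.mem_ofPred_eq, not_or, not_not] at hcon
    exact hω hcon

variable {Q}

lemma eventually_whp_iff {q : (Σ n, Q.Ω n) → Prop} :
    (∀ᶠ x in Q.whp, q x) ↔ Tendsto (fun n => Q.P n {ω | ¬ q ⟨n, ω⟩}) atTop (𝓝 0) := Iff.rfl

lemma tendsto_fst_whp : Tendsto (Sigma.fst : (Σ n, Q.Ω n) → ℕ) Q.whp atTop := by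
  rw [tendsto_atTop]
  intro N
  rw [eventually_whp_iff]
  refine tendsto_const_nhds.congr' ?_
  filter_upwards [eventually_ge_atTop N] with n hn
  simp [hn]

lemma eventually_whp_of_ae {q : (Σ n, Q.Ω n) → Prop} (hq : ∀ n, ∀ᵐ ω ∂Q.P n, q ⟨n, ω⟩) :
    ∀ᶠ x in Q.whp, q x := by
  rw [eventually_whp_iff]
  simp_rw [fun n => ae_iff.1 (hq n)]
  exact tendsto_const_nhds

lemma ToZeroInProb.tendsto_whp {Y : ∀ n, Q.Ω n → ℝ} (hY : Q.ToZeroInProb Y) :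
    Tendsto (fun x : Σ n, Q.Ω n => Y x.1 x.2) Q.whp (𝓝 0) := by
  rw [Metric.tendsto_nhds]
  intro ε hε
  rw [eventually_whp_iff]
  simpa using hY ε hε

/-- A property holds with probability tending to one as soon as it holds along all ultrafilters
that contain one member of each of countably many tight families of events. -/
lemma eventually_whp_of_ultrafilter {ι : Type*} [Countable ι] {A : ι → ℝ → Set (Σ n, Q.Ω n)}
    (hA : ∀ j, ∀ η : ℝ, 0 < η → ∃ C, ∀ᶠ n in atTop,
      Q.P n {ω | (⟨n, ω⟩ : Σ n, Q.Ω n) ∉ A j C} ≤ ENNReal.ofReal η)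
    {q : (Σ n, Q.Ω n) → Prop}
    (hq : ∀ u : Ultrafilter (Σ n, Q.Ω n), ↑u ≤ Q.whp → (∀ j, ∃ C, A j C ∈ u) →
      ∀ᶠ x in (u : Filter (Σ n, Q.Ω n)), q x) : ∀ᶠ x in Q.whp, q x := by
  rw [eventually_whp_iff, ENNReal.tendsto_nhds_zero]
  intro ε hε
  obtain ⟨η, hη, hsum⟩ := ENNReal.exists_pos_sum_of_countable (ENNReal.half_pos hε.ne').ne' ι
  have hA' : ∀ j, ∃ C : ℝ, ∃ N : ℕ, ∀ n, N ≤ n →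
      Q.P n {ω | (⟨n, ω⟩ : Σ n, Q.Ω n) ∉ A j C} ≤ η j := by
    intro j
    obtain ⟨C, hC⟩ := hA j (η j) (by exact_mod_cast hη j)
    obtain ⟨N, hN⟩ := eventually_atTop.1 hC
    refine ⟨C, N, fun n hn => (hN n hn).trans (le_of_eq ?_)⟩
    rw [ENNReal.ofReal_coe_nnreal]
  choose C N hCN using hA'
  -- Condition j is imposed only from its own index N j on, and the errors η j sum to less than ε/2.
  -- The complement of B is thus small for every n, although there may be infinitely many
  -- conditions.
  set B : Set (Σ n, Q.Ω n) := {x | ∀ j, N j ≤ x.1 → x ∈ A j (C j)} with hB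
  have hBc : ∀ n, Q.P n {ω | (⟨n, ω⟩ : Σ n, Q.Ω n) ∉ B} ≤ ε / 2 := by
    intro n
    have hsub : {ω | (⟨n, ω⟩ : Σ n, Q.Ω n) ∉ B} ⊆
        ⋃ j, {ω | N j ≤ n ∧ (⟨n, ω⟩ : Σ n, Q.Ω n) ∉ A j (C j)} := by
      intro ω hω
      simp only [hB, Set.mem_ofPred_eq, not_forall] at hω
      obtain ⟨j, h1, h2⟩ := hω
      exact Set.mem_iUnion.2 ⟨j, h1, h2⟩
    refine ((measure_mono hsub).trans (measure_iUnion_le _)).trans (le_trans ?_ hsum.le)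
    refine ENNReal.tsum_le_tsum fun j => ?_
    by_cases hn : N j ≤ n
    · simpa [hn] using hCN j n hn
    · simp [hn]
  have hBq : ∀ᶠ x in Q.whp, x ∈ B → q x := by
    have : {x | q x} ∈ Q.whp ⊓ 𝓟 B := by
      rw [mem_iff_ultrafilter]
      intro u hu
      have hu1 : ↑u ≤ Q.whp := hu.trans inf_le_left
      have hu2 : B ∈ u := le_principal_iff.1 (hu.trans inf_le_right)
      refine hq u hu1 fun j => ⟨C j, ?_⟩
      have h1 : ∀ᶠ x in (u : Filter (Σ n, Q.Ω n)), N j ≤ x.1 :=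
        (tendsto_fst_whp.mono_left hu1).eventually_ge_atTop (N j)
      filter_upwards [h1, hu2] with x hx hxB using hxB j hx
    exact mem_inf_principal.1 this
  rw [eventually_whp_iff, ENNReal.tendsto_nhds_zero] at hBq
  filter_upwards [hBq (ε / 2) (ENNReal.half_pos hε.ne')] with n hn
  have hsub : {ω | ¬ q ⟨n, ω⟩} ⊆ {ω | ¬ ((⟨n, ω⟩ : Σ n, Q.Ω n) ∈ B → q ⟨n, ω⟩)} ∪
      {ω | (⟨n, ω⟩ : Σ n, Q.Ω n) ∉ B} := by
    intro ω hω
    by_cases hb : (⟨n, ω⟩ : Σ n, Q.Ω n) ∈ B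
    · exact Or.inl fun hc => hω (hc hb)
    · exact Or.inr hb
  calc Q.P n {ω | ¬ q ⟨n, ω⟩} ≤ _ := (measure_mono hsub).trans (measure_union_le _ _)
    _ ≤ ε / 2 + ε / 2 := add_le_add hn (hBc n)
    _ = ε := ENNReal.add_halves ε

/-! ### Single imputed datasets -/

variable {d : Device} {Jcom Jmis : Matrix (Fin k ⊕ Fin h) (Fin k ⊕ Fin h) ℝ}

/-- The rate `√n`. -/
def rate (x : Σ n, Q.Ω n) : ℝ := Real.sqrt x.1

variable (Q) in
/-- Log-likelihood of the stack with index multiset `S`. -/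
def logLik (S : Multiset (Fin m)) (x : Σ n, Q.Ω n) (ψ : Par k h) : ℝ :=
  Real.log (Q.model.lik (stack (Q.imp x.1 x.2) S) ψ)

lemma rate_sq (x : Σ n, Q.Ω n) : rate x ^ 2 = x.1 := Real.sq_sqrt (Nat.cast_nonneg _)

lemma Regular.localized (hreg : Q.Regular d Jcom Jmis) :
    Localized Q.whp rate Q.model.Psi fun x => Q.psiStar x.1 where
  isOpen := Q.model.isOpen_Psi
  rate := Real.tendsto_sqrt_atTop.comp (tendsto_natCast_atTop_atTop.comp tendsto_fst_whp)
  centre := by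
    obtain ⟨ψ, hψ, ht⟩ := hreg.psiStar_tendsto
    exact ⟨ψ, hψ, ht.comp tendsto_fst_whp⟩

lemma _root_.StackedMI.Localized.mono {X : Type*} {l l' : Filter X} {r : X → ℝ} {Ψ : Set (Par k h)}
    {ψs : X → Par k h} (hl : Localized l r Ψ ψs) (hle : l' ≤ l) : Localized l' r Ψ ψs where
  isOpen := hl.isOpen
  rate := hl.rate.mono_left hle
  centre := by
    obtain ⟨ψ, hψ, ht⟩ := hl.centre
    exact ⟨ψ, hψ, ht.mono_left hle⟩

variable (Q) in
/-- Event that the normalized score of imputation `ℓ` is at most `C`. -/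
def scoreEvent (ℓ : Fin m) (a : Fin k ⊕ Fin h) (C : ℝ) : Set (Σ n, Q.Ω n) :=
  {x | |(Real.sqrt x.1)⁻¹ * Q.model.score [Q.imp x.1 x.2 ℓ] (Q.psiStar x.1) a| ≤ C}

variable (Q) in
/-- Event that the normalized information of imputation `ℓ` is within `ε` of its limit in the ball
of radius `ρ`. -/
def infoEvent (Jcom : Matrix (Fin k ⊕ Fin h) (Fin k ⊕ Fin h) ℝ) (ℓ : Fin m) (ε ρ : ℝ) :
    Set (Σ n, Q.Ω n) :=
  {x | 0 < ρ ∧ ∀ ψ ∈ Q.model.Psi, ‖ψ - Q.psiStar x.1‖ < ρ → ∀ a b,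
    |(x.1 : ℝ)⁻¹ * Q.model.info [Q.imp x.1 x.2 ℓ] ψ a b - Jcom a b| ≤ ε}

lemma stack_singleton {n : ℕ} (X : Fin m → Dataset n p) (ℓ : Fin m) : stack X {ℓ} = [X ℓ] := by
  simp [stack]

lemma logLik_singleton (ℓ : Fin m) :
    Q.logLik {ℓ} = fun x ψ => Real.log (Q.model.lik [Q.imp x.1 x.2 ℓ] ψ) := by
  funext x ψ
  rw [logLik, stack_singleton]

/-- Membership in the ultrafilter turns tightness of the scores into convergence and selects a fixed
radius at each accuracy. The countable scale 1/(i+1) covers every ε. -/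
lemma Regular.exists_regularAlong (hreg : Q.Regular d Jcom Jmis) {u : Ultrafilter (Σ n, Q.Ω n)}
    (hu : ↑u ≤ Q.whp) (hscore : ∀ ℓ a, ∃ C, Q.scoreEvent ℓ a C ∈ u)
    (hinfo : ∀ ℓ, ∀ i : ℕ, ∃ ρ, Q.infoEvent Jcom ℓ (1 / (i + 1)) ρ ∈ u) :
    ∃ s : Fin m → Par k h, ∀ ℓ,
      RegularAlong u rate Q.model.Psi (fun x => Q.psiStar x.1) Jcom (s ℓ) (Q.logLik {ℓ}) := by
  have hs : ∀ ℓ a, ∃ z, Tendsto (fun x : Σ n, Q.Ω n => (Real.sqrt x.1)⁻¹ *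
      Q.model.score [Q.imp x.1 x.2 ℓ] (Q.psiStar x.1) a) u (𝓝 z) := by
    intro ℓ a
    obtain ⟨C, hC⟩ := hscore ℓ a
    exact exists_tendsto_of_bounded (C := C) hC
  choose s hs using hs
  refine ⟨s, fun ℓ => ?_⟩
  rw [logLik_singleton]
  refine ⟨?_, ?_, ?_, ?_⟩
  · refine hu (eventually_whp_of_ae fun n => ?_)
    filter_upwards [hreg.smooth n ℓ] with ω hω
    exact hω.2.log fun ψ hψ => (hω.1 ψ hψ).ne'
  · exact tendsto_pi_nhds.2 fun a => hs ℓ a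
  · intro ρ hρ ε hε
    obtain ⟨i, hi⟩ := exists_nat_one_div_lt hε
    obtain ⟨ρ₀, hρ₀⟩ := hinfo ℓ i
    have hpos : 0 < ρ₀ := by
      obtain ⟨x, hx⟩ := u.nonempty_of_mem hρ₀
      exact hx.1
    filter_upwards [hρ₀, hρ.eventually (gt_mem_nhds hpos)] with x hx hx' ψ hψ hn a b
    rw [rate_sq]
    exact (hx.2 ψ hψ (hn.trans_lt hx') a b).trans hi.le
  · intro ρ hρ
    obtain ⟨c, hc, h⟩ := hreg.separated ℓ ρ hρ
    refine ⟨c, hc, hu ?_⟩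
    refine (eventually_whp_iff (Q := Q)).2 ?_
    convert h using 4 with n
    ext ω
    simp only [not_forall, not_le, rate_sq, exists_prop]

/-! ### Stacked datasets -/

lemma lik_stack {n : ℕ} (M : Model p k h) (X : Fin m → Dataset n p) (S : Multiset (Fin m))
    (ψ : Par k h) : M.lik (stack X S) ψ = (S.map fun ℓ => M.lik [X ℓ] ψ).prod := by
  have h1 : S.map (fun ℓ => M.lik [X ℓ] ψ) =
      ((S.sort.map fun ℓ => M.lik [X ℓ] ψ : List ℝ) : Multiset ℝ) := by
    rw [← Multiset.map_coe, Multiset.sort_eq]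
  rw [h1, Multiset.prod_coe, Model.lik, stack, List.map_map]
  congr 1
  refine List.map_congr_left fun ℓ _ => ?_
  simp [Model.lik]

lemma lik_stack_pos {n : ℕ} {M : Model p k h} {X : Fin m → Dataset n p} {ψ : Par k h}
    (hpos : ∀ ℓ, 0 < M.lik [X ℓ] ψ) (S : Multiset (Fin m)) : 0 < M.lik (stack X S) ψ := by
  rw [lik_stack]
  induction S using Multiset.induction_on with
  | empty => simp
  | cons a S ih =>
    rw [Multiset.map_cons, Multiset.prod_cons]
    exact mul_pos (hpos a) ih

lemma log_lik_stack {n : ℕ} {M : Model p k h} {X : Fin m → Dataset n p} {ψ : Par k h}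
    (hpos : ∀ ℓ, 0 < M.lik [X ℓ] ψ) (S : Multiset (Fin m)) :
    Real.log (M.lik (stack X S) ψ) = (S.map fun ℓ => Real.log (M.lik [X ℓ] ψ)).sum := by
  induction S using Multiset.induction_on with
  | empty => simp [lik_stack]
  | cons a S ih =>
    have h1 := lik_stack_pos hpos S
    rw [lik_stack] at h1 ih ⊢
    rw [Multiset.map_cons, Multiset.prod_cons, Multiset.map_cons, Multiset.sum_cons,
      Real.log_mul (hpos a).ne' h1.ne', ih]

lemma Regular.eventually_pos (hreg : Q.Regular d Jcom Jmis) :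
    ∀ᶠ x in Q.whp, ∀ ψ ∈ Q.model.Psi, ∀ ℓ, 0 < Q.model.lik [Q.imp x.1 x.2 ℓ] ψ := by
  refine eventually_whp_of_ae fun n => ?_
  have := ae_all_iff.2 fun ℓ => hreg.smooth n ℓ
  filter_upwards [this] with ω hω ψ hψ ℓ
  exact (hω ℓ).1 ψ hψ

/-! ### Stacked maximizers and statistics along an ultrafilter -/

section Ultra

variable {u : Ultrafilter (Σ n, Q.Ω n)} {s : Fin m → Par k h} (hreg : Q.Regular d Jcom Jmis)
  (hu : ↑u ≤ Q.whp)
  (hR : ∀ ℓ, RegularAlong u rate Q.model.Psi (fun x => Q.psiStar x.1) Jcom (s ℓ) (Q.logLik {ℓ}))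
include hreg hu hR

lemma regularAlong_stack {S : Multiset (Fin m)} (hS : S ≠ 0) :
    RegularAlong u rate Q.model.Psi (fun x => Q.psiStar x.1) ((S.card : ℝ) • Jcom)
      (S.map s).sum (Q.logLik S) := by
  have hl := hreg.localized.mono hu
  refine (RegularAlong.multiset_sum hl hR S hS).congr hl ?_
  filter_upwards [hu hreg.eventually_pos] with x hx ψ hψ
  simp only [logLik]
  rw [log_lik_stack (hx ψ hψ)]
  simp only [stack_singleton]

omit hR hu in
lemma posDef_card_smul {S : Multiset (Fin m)} (hS : S ≠ 0) : ((S.card : ℝ) • Jcom).PosDef :=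
  hreg.posDef_com.smul (by exact_mod_cast Multiset.card_pos.2 hS)

/-- The estimator is an MLE only where one exists. Existence comes from `exists_max` with a vacuous
constraint and the truth as feasible point. -/
lemma eventually_psiHat {S : Multiset (Fin m)} (hS : S ≠ 0) :
    ∀ᶠ x in (u : Filter (Σ n, Q.Ω n)),
      Q.psiHat x.1 (stack (Q.imp x.1 x.2) S) ∈ Q.model.Psi ∧ ∀ χ ∈ Q.model.Psi,
        Q.logLik S x χ ≤ Q.logLik S x (Q.psiHat x.1 (stack (Q.imp x.1 x.2) S)) := by
  have hl := hreg.localized.mono hu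
  have hex := (regularAlong_stack hreg hu hR hS).exists_max hl (A := fun _ => Set.univ)
    (fun _ => isClosed_univ) (φ := fun x => Q.psiStar x.1) (fun _ => Set.mem_univ _)
    (y := 0) (by simp)
  filter_upwards [hex, hu hreg.eventually_pos] with x hx hpos
  obtain ⟨-, ψ, hψ, hmax⟩ := hx
  simp only [Set.inter_univ] at hψ hmax
  have hML := Q.isMLE_psiHat x.1 (stack (Q.imp x.1 x.2) S) ⟨ψ, hψ, fun χ hχ => by
    have := hmax χ hχ
    exact (Real.log_le_log_iff (lik_stack_pos (hpos χ hχ) S) (lik_stack_pos (hpos ψ hψ) S)).1 this⟩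
  refine ⟨hML.1, fun χ hχ => ?_⟩
  exact Real.log_le_log (lik_stack_pos (hpos χ hχ) S) (hML.2 hχ)

lemma eventually_psiHat0 {S : Multiset (Fin m)} (hS : S ≠ 0) {τ : Fin k → ℝ}
    (hτ : Tendsto (fun x : Σ n, Q.Ω n => rate x • (theta (Q.psiStar x.1) - Q.theta0)) u (𝓝 τ)) :
    ∀ᶠ x in (u : Filter (Σ n, Q.Ω n)),
      Q.psiHat0 x.1 (stack (Q.imp x.1 x.2) S) ∈ Q.model.Psi ∧
      theta (Q.psiHat0 x.1 (stack (Q.imp x.1 x.2) S)) = Q.theta0 ∧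
      ∀ χ ∈ Q.model.Psi, theta χ = Q.theta0 →
        Q.logLik S x χ ≤ Q.logLik S x (Q.psiHat0 x.1 (stack (Q.imp x.1 x.2) S)) := by
  have hl := hreg.localized.mono hu
  have hex := (regularAlong_stack hreg hu hR hS).exists_max hl
    (fun _ => isClosed_theta_eq Q.theta0)
    (fun x => (rfl : theta (nullShift Q.theta0 (Q.psiStar x.1)) = Q.theta0)) (tendsto_nullShift hτ)
  filter_upwards [hex, hu hreg.eventually_pos] with x hx hpos
  obtain ⟨-, ψ, hψ, hmax⟩ := hx
  have hML := Q.isMLE_psiHat0 x.1 (stack (Q.imp x.1 x.2) S) ⟨ψ, hψ, fun χ hχ => by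
    have := hmax χ hχ
    exact (Real.log_le_log_iff (lik_stack_pos (hpos χ hχ.1) S)
      (lik_stack_pos (hpos ψ hψ.1) S)).1 this⟩
  refine ⟨hML.1.1, hML.1.2, fun χ hχ hθ => ?_⟩
  exact Real.log_le_log (lik_stack_pos (hpos χ hχ) S) (hML.2 ⟨hχ, hθ⟩)

/-- Limits of the stacked statistics. -/
theorem exists_limit_dHat {τ : Fin k → ℝ}
    (hτ : Tendsto (fun x : Σ n, Q.Ω n => rate x • (theta (Q.psiStar x.1) - Q.theta0)) u (𝓝 τ)) :
    ∃ b : Fin m → Fin k → ℝ,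
      (∀ ℓ, Tendsto (fun x : Σ n, Q.Ω n => rate x • (Q.thetaImp ℓ x.1 x.2 - Q.theta0)) u
        (𝓝 (b ℓ))) ∧
      ∀ S : Multiset (Fin m), S ≠ 0 → Tendsto (fun x : Σ n, Q.Ω n => Q.dHat d S x.1 x.2) u
        (𝓝 (((S.card : ℝ)⁻¹ • (S.map b).sum) ⬝ᵥ
          ((thetaVar Jcom)⁻¹ *ᵥ ((S.card : ℝ)⁻¹ • (S.map b).sum)))) := by
  have hl := hreg.localized.mono hu
  have hy : ∀ ℓ, ∃ y, Tendsto (fun x : Σ n, Q.Ω n =>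
      rate x • (Q.psiHat x.1 [Q.imp x.1 x.2 ℓ] - Q.psiStar x.1)) u (𝓝 y) ∧ s ℓ = y ᵥ* Jcom := by
    intro ℓ
    have := eventually_psiHat hreg hu hR (Multiset.singleton_ne_zero ℓ)
    simp only [stack_singleton] at this
    exact (hR ℓ).tendsto_max hl hreg.posDef_com this
  choose y hy hsy using hy
  refine ⟨fun ℓ => theta (y ℓ) + τ, fun ℓ => tendsto_theta_sub hτ (hy ℓ), fun S hS => ?_⟩
  have hRS := regularAlong_stack hreg hu hR hS
  have hJS := posDef_card_smul hreg hS
  have hmax := eventually_psiHat hreg hu hR hS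
  have hmax0 := eventually_psiHat0 hreg hu hR hS hτ
  obtain ⟨z, hz, hsz⟩ := hRS.tendsto_max hl hJS hmax
  have hN : (S.card : ℝ) ≠ 0 := by exact_mod_cast (Multiset.card_pos.2 hS).ne'
  -- Scores add while the information is |S| times `Jcom`, so the scaled stacked maximizer is the
  -- average of the single ones.
  have hzS : (S.card : ℝ) • z = (S.map y).sum := by
    have h1 : (S.map y).sum ᵥ* Jcom = (S.map s).sum := by
      have : ∀ S : Multiset (Fin m), (S.map y).sum ᵥ* Jcom = (S.map s).sum := by
        intro S
        induction S using Multiset.induction_on with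
        | empty => simp
        | cons a S ih => simp [Matrix.add_vecMul, ih, hsy a]
      exact this S
    have hdet : IsUnit Jcom.det := hreg.posDef_com.det_pos.ne'.isUnit
    have h2 : ((S.card : ℝ) • z) ᵥ* Jcom = (S.map y).sum ᵥ* Jcom := by
      rw [h1, hsz, Matrix.smul_vecMul, Matrix.vecMul_smul]
    have h3 := congrArg (fun v => v ᵥ* Jcom⁻¹) h2
    simpa [Matrix.vecMul_vecMul, Matrix.mul_nonsing_inv _ hdet] using h3
  have hb : (S.card : ℝ)⁻¹ • (S.map fun ℓ => theta (y ℓ) + τ).sum = theta z + τ := by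
    have h1 : ∀ S : Multiset (Fin m), (S.map fun ℓ => theta (y ℓ) + τ).sum =
        theta (S.map y).sum + (S.card : ℝ) • τ := by
      intro S
      induction S using Multiset.induction_on with
      | empty =>
        funext j
        simp [theta]
      | cons a S ih =>
        simp only [Multiset.map_cons, Multiset.sum_cons, ih, Multiset.card_cons]
        funext j
        simp only [theta, Pi.add_apply, Pi.smul_apply, smul_eq_mul]
        push_cast
        ring
    rw [h1, ← hzS]
    funext j
    simp only [theta, Pi.add_apply, Pi.smul_apply, smul_eq_mul]
    field_simp
  have hdev : Tendsto (fun x : Σ n, Q.Ω n => Q.device d x.1 (stack (Q.imp x.1 x.2) S)) u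
      (𝓝 ((theta z + τ) ⬝ᵥ ((thetaVar ((S.card : ℝ) • Jcom))⁻¹ *ᵥ (theta z + τ)))) := by
    cases d with
    | wald =>
      refine hRS.tendsto_wald hl hJS hτ (hmax.mono fun x hx => hx.1) hz fun a b => ?_
      have := (hreg.variance_estimator rfl S hS a b).tendsto_whp.mono_left hu
      refine this.congr fun x => ?_
      rw [rate_sq]
      rfl
    | lrt =>
      refine (hRS.tendsto_lrt hl hJS hτ hmax hmax0 hz).congr' ?_
      filter_upwards [hmax, hmax0, hu hreg.eventually_pos] with x h1 h2 h3
      simp only [device, logLik]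
      rw [Real.log_div (lik_stack_pos (h3 _ h1.1) S).ne' (lik_stack_pos (h3 _ h2.1) S).ne']
    | rao => exact hRS.tendsto_rao hl hJS hτ hmax hmax0 hz
  rw [hb]
  -- Division by |S| cancels the factor |S| by which the stacked information exceeds `Jcom`.
  have hdiv := hdev.div_const (S.card : ℝ)
  rw [thetaVar_smul _ hN, matrix_inv_smul _ (inv_ne_zero hN), inv_inv, Matrix.smul_mulVec,
    dotProduct_smul, smul_eq_mul, mul_div_cancel_left₀ _ hN] at hdiv
  exact hdiv

end Ultra

end MIProblem

/-! ### Limit of the jackknife statistics -/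

section Jackknife

variable {k m : ℕ}

/-- This is the between-group sum of squares for groups of sizes 1 and m - 1 with means b and (e -
b)/(m - 1). It depends only on the deviation of b from the overall mean t. -/
lemma quadForm_jackknife (hm : 2 ≤ m) (M : Matrix (Fin k) (Fin k) ℝ) (b t e : Fin k → ℝ)
    (ht : (m : ℝ) • t = e) :
    b ⬝ᵥ (M *ᵥ b) + ((m : ℝ) - 1) *
        ((((m : ℝ) - 1)⁻¹ • (e - b)) ⬝ᵥ (M *ᵥ (((m : ℝ) - 1)⁻¹ • (e - b)))) -
      m * (t ⬝ᵥ (M *ᵥ t)) = (m : ℝ) / (m - 1) * ((b - t) ⬝ᵥ (M *ᵥ (b - t))) := by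
  have h1 : (m : ℝ) - 1 ≠ 0 := by
    have : (2 : ℝ) ≤ m := by exact_mod_cast hm
    linarith
  subst ht
  simp only [Matrix.mulVec_smul, Matrix.mulVec_sub, smul_dotProduct, dotProduct_smul,
    sub_dotProduct, dotProduct_sub, smul_eq_mul]
  field_simp
  ring

/-- Limit of the jackknife statistics as a function of the imputation noise. -/
def jackLim (V : Matrix (Fin k) (Fin k) ℝ) (y : PiLp 2 fun _ : Fin m => EuclideanSpace ℝ (Fin k))
    (ℓ : Fin m) : ℝ :=
  (m : ℝ) / (m - 1) * ((fun j => y ℓ j - (m : ℝ)⁻¹ * ∑ a, y a j) ⬝ᵥ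
    (V⁻¹ *ᵥ fun j => y ℓ j - (m : ℝ)⁻¹ * ∑ a, y a j))

lemma continuous_jackLim (V : Matrix (Fin k) (Fin k) ℝ) : Continuous (jackLim (m := m) V) := by
  have hc : ∀ (ℓ : Fin m) (j : Fin k), Continuous
      fun y : PiLp 2 fun _ : Fin m => EuclideanSpace ℝ (Fin k) => y ℓ j := by
    intro ℓ j
    fun_prop
  have hv : ∀ ℓ : Fin m, Continuous fun (y : PiLp 2 fun _ : Fin m => EuclideanSpace ℝ (Fin k))
      (j : Fin k) => y ℓ j - (m : ℝ)⁻¹ * ∑ a, y a j := fun ℓ =>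
    continuous_pi fun j => (hc ℓ j).sub (continuous_const.mul
      (continuous_finsetSum _ fun a _ => hc a j))
  exact continuous_pi fun ℓ => continuous_const.mul
    ((hv ℓ).dotProduct (continuous_const.matrix_mulVec (hv ℓ)))

lemma singleton_val_add_compl_val (ℓ : Fin m) :
    ({ℓ} : Finset (Fin m)).val + ({ℓ}ᶜ : Finset (Fin m)).val = (Finset.univ : Finset (Fin m)).val := by
  have h : ℓ ∉ ({ℓ}ᶜ : Finset (Fin m)) := by simp
  have h2 : Finset.cons ℓ ({ℓ}ᶜ : Finset (Fin m)) h = Finset.univ := by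
    ext a
    simp
  rw [← h2, Finset.cons_val, Finset.singleton_val, Multiset.singleton_add]

end Jackknife

namespace MIProblem

variable {p k h m : ℕ} {Q : MIProblem p k h m} {d : Device}
  {Jcom Jmis : Matrix (Fin k ⊕ Fin h) (Fin k ⊕ Fin h) ℝ}

/-- A jackknife pair is disjoint and exhausts the imputations, so the prefactor is m/m and the
multiset sum is the full stack. -/
lemma smi_jackknife (hm : 2 ≤ m) (ℓ : Fin m) (n : ℕ) (ω : Q.Ω n) :
    Q.smi d {ℓ} {ℓ}ᶜ n ω = Q.dHat d {ℓ} n ω +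
      ((m : ℝ) - 1) * Q.dHat d ({ℓ}ᶜ : Finset (Fin m)).val n ω -
        m * Q.dHat d (Finset.univ : Finset (Fin m)).val n ω := by
  have hc : ((({ℓ}ᶜ : Finset (Fin m)).card : ℕ) : ℝ) = m - 1 := by
    rw [Finset.card_compl, Finset.card_singleton, Fintype.card_fin, Nat.cast_sub (by omega)]
    simp
  have hm0 : (m : ℝ) ≠ 0 := by
    have : m ≠ 0 := by omega
    exact_mod_cast this
  rw [smi, singleton_val_add_compl_val, hc, Finset.inter_compl]
  simp only [Finset.card_singleton, Finset.card_empty, Finset.singleton_val, Nat.cast_one,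
    Nat.cast_zero, mul_zero, sub_zero, add_sub_cancel, one_mul]
  rw [div_self hm0, one_mul]

lemma LocalAlternative.exists_tendsto (hloc : Q.LocalAlternative) :
    ∃ τ, Tendsto (fun n : ℕ => Real.sqrt n • (theta (Q.psiStar n) - Q.theta0)) atTop (𝓝 τ) := by
  obtain ⟨A, δ, hA, hδ⟩ := hloc
  refine ⟨A⁻¹ *ᵥ δ, ?_⟩
  have hc : Continuous fun v : Fin k → ℝ => A⁻¹ *ᵥ v := continuous_const.matrix_mulVec continuous_id
  refine ((hc.tendsto δ).comp hδ).congr fun n => ?_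
  simp only [Function.comp]
  rw [Matrix.mulVec_smul, Matrix.mulVec_mulVec,
    Matrix.nonsing_inv_mul _ ((Matrix.isUnit_iff_isUnit_det _).1 hA), Matrix.one_mulVec]

/-- The jackknife statistics are asymptotically equivalent to quadratic forms in the noise. -/
theorem tendsto_smi_sub_jackLim (hm : 2 ≤ m) (hreg : Q.Regular d Jcom Jmis)
    (hloc : Q.LocalAlternative) {ε : ℝ} (hε : 0 < ε) :
    Tendsto (fun n => Q.P n {ω | ε ≤ dist (fun ℓ => Q.smi d {ℓ} {ℓ}ᶜ n ω)
      (jackLim (thetaVar Jcom) (Q.noiseVec n ω))}) atTop (𝓝 0) := by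
  have hm2 : (2 : ℝ) ≤ m := by exact_mod_cast hm
  have hm0 : (m : ℝ) ≠ 0 := by positivity
  have hm1 : (m : ℝ) - 1 ≠ 0 := by linarith
  suffices hmain : ∀ᶠ x in Q.whp, dist (fun ℓ => Q.smi d {ℓ} {ℓ}ᶜ x.1 x.2)
      (jackLim (thetaVar Jcom) (Q.noiseVec x.1 x.2)) < ε by
    rw [eventually_whp_iff] at hmain
    simpa using hmain
  -- There is one tight family per score coordinate, indexed by a bound, and one per accuracy of the
  -- information, indexed by a radius.
  refine eventually_whp_of_ultrafilter (ι := (Fin m × (Fin k ⊕ Fin h)) ⊕ (Fin m × ℕ))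
    (A := Sum.elim (fun i C => Q.scoreEvent i.1 i.2 C)
      (fun i ρ => Q.infoEvent Jcom i.1 (1 / ((i.2 : ℝ) + 1)) ρ)) ?_ ?_
  · rintro (⟨ℓ, a⟩ | ⟨ℓ, i⟩) η hη
    · obtain ⟨C, hC⟩ := hreg.score_bounded ℓ a η hη
      refine ⟨C, ?_⟩
      simpa [scoreEvent] using hC
    · obtain ⟨ρ, hρ, hC⟩ := hreg.info_tendsto ℓ (1 / ((i : ℝ) + 1)) (by positivity) η hη
      refine ⟨ρ, ?_⟩
      filter_upwards [hC] with n hn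
      refine (measure_mono fun ω hω => ?_).trans hn
      by_contra hcon
      refine hω ⟨hρ, fun ψ hψ hψn a b => ?_⟩
      by_contra hab
      exact hcon ⟨ψ, hψ, hψn, a, b, not_le.1 hab⟩
  · intro u hu hA
    obtain ⟨s, hR⟩ := hreg.exists_regularAlong hu (fun ℓ a => hA (Sum.inl (ℓ, a)))
      (fun ℓ i => hA (Sum.inr (ℓ, i)))
    obtain ⟨τ, hτ⟩ := hloc.exists_tendsto
    obtain ⟨b, hb, hd⟩ := exists_limit_dHat hreg hu hR (τ := τ)
      ((hτ.comp tendsto_fst_whp).mono_left hu)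
    set M := (thetaVar Jcom)⁻¹ with hM
    set t : Fin k → ℝ := (m : ℝ)⁻¹ • ∑ ℓ, b ℓ with ht
    have hsmi : ∀ ℓ, Tendsto (fun x : Σ n, Q.Ω n => Q.smi d {ℓ} {ℓ}ᶜ x.1 x.2) u
        (𝓝 ((m : ℝ) / (m - 1) * ((b ℓ - t) ⬝ᵥ (M *ᵥ (b ℓ - t))))) := by
      intro ℓ
      have hne : ({ℓ}ᶜ : Finset (Fin m)).val ≠ 0 := by
        rw [Ne, Finset.val_eq_zero, ← Ne, ← Finset.nonempty_iff_ne_empty, ← Finset.card_pos,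
          Finset.card_compl, Finset.card_singleton, Fintype.card_fin]
        omega
      have hne' : (Finset.univ : Finset (Fin m)).val ≠ 0 := by
        rw [Ne, Finset.val_eq_zero, ← Ne, ← Finset.nonempty_iff_ne_empty]
        exact ⟨ℓ, Finset.mem_univ _⟩
      have h1 := hd {ℓ} (Multiset.singleton_ne_zero ℓ)
      have h2 := hd _ hne
      have h3 := hd _ hne'
      have hc : (Multiset.card ({ℓ}ᶜ : Finset (Fin m)).val : ℝ) = m - 1 := by
        rw [Finset.card_val, Finset.card_compl, Finset.card_singleton, Fintype.card_fin,
          Nat.cast_sub (by omega)]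
        simp
      have hs : (({ℓ}ᶜ : Finset (Fin m)).val.map b).sum = ∑ i, b i - b ℓ := by
        have := Finset.sum_compl_add_sum ({ℓ} : Finset (Fin m)) b
        rw [Finset.sum_singleton] at this
        rw [← this, add_sub_cancel_right]
        rfl
      have hs' : ((Finset.univ : Finset (Fin m)).val.map b).sum = ∑ i, b i := rfl
      rw [hc, hs] at h2
      rw [hs', Finset.card_val, Finset.card_univ, Fintype.card_fin, ← ht] at h3
      rw [Multiset.card_singleton, Nat.cast_one, inv_one, one_smul, Multiset.map_singleton,
        Multiset.sum_singleton] at h1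
      rw [← quadForm_jackknife hm M (b ℓ) t (∑ i, b i) (by rw [ht, smul_inv_smul₀ hm0])]
      refine ((h1.add (h2.const_mul ((m : ℝ) - 1))).sub (h3.const_mul (m : ℝ))).congr fun x => ?_
      rw [smi_jackknife hm]
    have hlim : ∀ ℓ, Tendsto (fun x : Σ n, Q.Ω n =>
        jackLim (thetaVar Jcom) (Q.noiseVec x.1 x.2) ℓ) u
        (𝓝 ((m : ℝ) / (m - 1) * ((b ℓ - t) ⬝ᵥ (M *ᵥ (b ℓ - t))))) := by
      intro ℓ
      have hc : Continuous fun v : Fin k → ℝ => (m : ℝ) / (m - 1) * (v ⬝ᵥ (M *ᵥ v)) :=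
        continuous_const.mul (continuous_id.dotProduct (continuous_const.matrix_mulVec continuous_id))
      have hmean : Tendsto (fun x : Σ n, Q.Ω n => rate x • (Q.thetaImp ℓ x.1 x.2 - Q.theta0) -
          (m : ℝ)⁻¹ • ∑ a, rate x • (Q.thetaImp a x.1 x.2 - Q.theta0)) u (𝓝 (b ℓ - t)) :=
        (hb ℓ).sub ((tendsto_finsetSum _ fun a _ => hb a).const_smul _)
      refine ((hc.tendsto _).comp hmean).congr fun x => ?_
      -- Centring over the imputations cancels any common centre, so θ̂_obs on the left may be
      -- exchanged for θ₀ on the right.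
      have e : (fun j => Q.noiseVec x.1 x.2 ℓ j - (m : ℝ)⁻¹ * ∑ a, Q.noiseVec x.1 x.2 a j) =
          rate x • (Q.thetaImp ℓ x.1 x.2 - Q.theta0) -
          (m : ℝ)⁻¹ • ∑ a, rate x • (Q.thetaImp a x.1 x.2 - Q.theta0) := by
        funext j
        simp only [noiseVec, noise, rate, Pi.sub_apply, Pi.smul_apply, smul_eq_mul,
          Finset.sum_apply, mul_sub, Finset.sum_sub_distrib, Finset.sum_const, Finset.card_univ,
          Fintype.card_fin, nsmul_eq_mul]
        field_simp
        ring
      simp only [Function.comp, jackLim]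
      rw [e]
    have hdist : Tendsto (fun x : Σ n, Q.Ω n => dist (fun ℓ => Q.smi d {ℓ} {ℓ}ᶜ x.1 x.2)
        (jackLim (thetaVar Jcom) (Q.noiseVec x.1 x.2))) u (𝓝 0) := by
      have := (tendsto_pi_nhds.2 hsmi).dist (tendsto_pi_nhds.2 hlim)
      simpa using this
    exact hdist.eventually (gt_mem_nhds hε)

end MIProblem

/-! ### Diagonalization of the missing information -/

section Diagonalization

variable {k h m : ℕ}

lemma exists_orthogonal_diagonalization {ι : Type*} [Fintype ι] [DecidableEq ι] {A : Matrix ι ι ℝ}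
    (hA : A.IsHermitian) : ∃ U : Matrix ι ι ℝ, Uᵀ * U = 1 ∧ U * Uᵀ = 1 ∧
      A = U * Matrix.diagonal hA.eigenvalues * Uᵀ := by
  have hU : (hA.eigenvectorUnitary : Matrix ι ι ℝ)ᵀ * hA.eigenvectorUnitary = 1 := by
    have := Unitary.coe_star_mul_self hA.eigenvectorUnitary
    rwa [Matrix.star_eq_conjTranspose, Matrix.conjTranspose_eq_transpose_of_trivial] at this
  refine ⟨hA.eigenvectorUnitary, hU, mul_eq_one_comm.1 hU, ?_⟩
  have := hA.spectral_theorem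
  rw [Unitary.conjStarAlgAut_apply, Matrix.star_eq_conjTranspose,
    Matrix.conjTranspose_eq_transpose_of_trivial] at this
  exact this

/-- Simultaneous diagonalization of a positive definite and a positive semidefinite matrix. -/
lemma exists_simultaneous_diagonalization {V B : Matrix (Fin k) (Fin k) ℝ} (hV : V.PosDef)
    (hB : B.PosSemidef) : ∃ (G : Matrix (Fin k) (Fin k) ℝ) (r : Fin k → ℝ), (∀ j, 0 ≤ r j) ∧
      IsUnit G.det ∧ V = G * Gᵀ ∧ B = G * Matrix.diagonal r * Gᵀ := by
  obtain ⟨U₀, hU₀, hU₀', hVU⟩ := exists_orthogonal_diagonalization hV.isHermitian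
  set v := hV.isHermitian.eigenvalues with hv
  have hvpos : ∀ i, 0 < v i := hV.eigenvalues_pos
  set K := U₀ * Matrix.diagonal fun i => Real.sqrt (v i) with hK
  set K' := (Matrix.diagonal fun i => (Real.sqrt (v i))⁻¹) * U₀ᵀ with hK'
  have hK'K : K' * K = 1 := by
    rw [hK, hK', Matrix.mul_assoc, ← Matrix.mul_assoc U₀ᵀ, hU₀, Matrix.one_mul,
      Matrix.diagonal_mul_diagonal, ← Matrix.diagonal_one]
    congr 1
    funext i
    exact inv_mul_cancel₀ (Real.sqrt_pos.2 (hvpos i)).ne'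
  have hKK' : K * K' = 1 := mul_eq_one_comm.1 hK'K
  have hVK : V = K * Kᵀ := by
    have hd : Matrix.diagonal v = (Matrix.diagonal fun i => Real.sqrt (v i)) *
        Matrix.diagonal fun i => Real.sqrt (v i) := by
      rw [Matrix.diagonal_mul_diagonal]
      congr 1
      funext i
      exact (Real.mul_self_sqrt (hvpos i).le).symm
    rw [hVU, hK, Matrix.transpose_mul, Matrix.diagonal_transpose, hd]
    simp only [Matrix.mul_assoc]
  -- This is `B` in coordinates that make `V` the identity, so an orthogonal diagonalization of it
  -- leaves `V` unaffected.
  have hC : (K' * B * K'ᵀ).PosSemidef := by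
    have := hB.mul_mul_conjTranspose_same K'
    rwa [Matrix.conjTranspose_eq_transpose_of_trivial] at this
  obtain ⟨U, hU, hU', hCU⟩ := exists_orthogonal_diagonalization hC.isHermitian
  have hnn : ∀ j, 0 ≤ hC.isHermitian.eigenvalues j := fun j => hC.eigenvalues_nonneg j
  generalize hC.isHermitian.eigenvalues = e at hCU hnn
  refine ⟨K * U, e, hnn, ?_, ?_, ?_⟩
  · refine Matrix.isUnit_det_of_right_inverse (B := Uᵀ * K') ?_
    rw [Matrix.mul_assoc, ← Matrix.mul_assoc U, hU', Matrix.one_mul, hKK']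
  · rw [Matrix.transpose_mul, Matrix.mul_assoc, ← Matrix.mul_assoc U, hU', Matrix.one_mul, hVK]
  · have hT : K'ᵀ * Kᵀ = 1 := by rw [← Matrix.transpose_mul, hKK', Matrix.transpose_one]
    calc B = (K * K') * B * (K'ᵀ * Kᵀ) := by rw [hKK', hT, Matrix.one_mul, Matrix.mul_one]
      _ = K * (K' * B * K'ᵀ) * Kᵀ := by simp only [Matrix.mul_assoc]
      _ = K * (U * Matrix.diagonal e * Uᵀ) * Kᵀ := by rw [← hCU]
      _ = _ := by rw [Matrix.transpose_mul K U]; simp only [Matrix.mul_assoc]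

/-- The odds of missing information are the generalized eigenvalues of the between-imputation
variance with respect to the complete-data variance. -/
lemma omi_eq_map {Jcom Jmis : Matrix (Fin k ⊕ Fin h) (Fin k ⊕ Fin h) ℝ}
    (hV : (thetaVar Jcom).PosDef) (hT : (thetaVar (Jcom - Jmis)).PosDef)
    {G : Matrix (Fin k) (Fin k) ℝ} {r : Fin k → ℝ} (hr : ∀ j, 0 ≤ r j) (hG : IsUnit G.det)
    (hVG : thetaVar Jcom = G * Gᵀ)
    (hBG : thetaVar (Jcom - Jmis) - thetaVar Jcom = G * Matrix.diagonal r * Gᵀ) :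
    omi Jcom Jmis = Finset.univ.val.map r := by
  set V := thetaVar Jcom with hVdef
  set T := thetaVar (Jcom - Jmis) with hTdef
  have hVu : IsUnit V.det := hV.det_pos.ne'.isUnit
  have hTu : IsUnit T.det := hT.det_pos.ne'.isUnit
  have hGT : IsUnit Gᵀ.det := by rwa [Matrix.det_transpose]
  have hF : fmiMatrix Jcom Jmis = 1 - T⁻¹ * V := by
    rw [fmiMatrix, thetaInfo, thetaInfo, ← hVdef, ← hTdef, Matrix.nonsing_inv_nonsing_inv _ hVu,
      Matrix.sub_mul, Matrix.nonsing_inv_mul _ hVu]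
  set P : Matrix (Fin k) (Fin k) ℝ := Gᵀ⁻¹ with hP
  have hGP : Gᵀ * P = 1 := Matrix.mul_nonsing_inv _ hGT
  have hPG : P * Gᵀ = 1 := Matrix.nonsing_inv_mul _ hGT
  have hne : ∀ j, 1 + r j ≠ 0 := fun j => by linarith [hr j]
  have hVP : V * P = G := by rw [hVG, Matrix.mul_assoc, hGP, Matrix.mul_one]
  have hTP : T * P = G * Matrix.diagonal fun j => 1 + r j := by
    have h1 : T = V + G * Matrix.diagonal r * Gᵀ := by rw [← hBG]; abel
    have h2 : (Matrix.diagonal fun j => 1 + r j) = 1 + Matrix.diagonal r := by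
      rw [← Matrix.diagonal_one, Matrix.diagonal_add]
    rw [h1, Matrix.add_mul, hVP, Matrix.mul_assoc, hGP, Matrix.mul_one, h2, Matrix.mul_add,
      Matrix.mul_one]
  have hTVP : T⁻¹ * V * P = P * Matrix.diagonal fun j => (1 + r j)⁻¹ := by
    have h1 : V * P = T * (P * Matrix.diagonal fun j => (1 + r j)⁻¹) := by
      rw [← Matrix.mul_assoc, hTP, Matrix.mul_assoc, Matrix.diagonal_mul_diagonal, hVP]
      have : (Matrix.diagonal fun j => (1 + r j) * (1 + r j)⁻¹) = (1 : Matrix (Fin k) (Fin k) ℝ) := by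
        rw [← Matrix.diagonal_one]
        congr 1
        funext j
        exact mul_inv_cancel₀ (hne j)
      rw [this, Matrix.mul_one]
    rw [Matrix.mul_assoc, h1, ← Matrix.mul_assoc, Matrix.nonsing_inv_mul _ hTu, Matrix.one_mul]
  have hFP : fmiMatrix Jcom Jmis = P * (Matrix.diagonal fun j => r j / (1 + r j)) * Gᵀ := by
    have h2 : (Matrix.diagonal fun j => r j / (1 + r j)) =
        1 - Matrix.diagonal fun j => (1 + r j)⁻¹ := by
      rw [← Matrix.diagonal_one, Matrix.diagonal_sub]
      congr 1
      funext j
      have := hne j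
      field_simp
      ring
    rw [hF, h2, Matrix.mul_sub, Matrix.mul_one, ← hTVP, Matrix.sub_mul, hPG, Matrix.mul_assoc, hPG,
      Matrix.mul_one]
  have hchar : (fmiMatrix Jcom Jmis).charpoly =
      (Matrix.diagonal fun j => r j / (1 + r j)).charpoly := by
    rw [hFP, Matrix.charpoly_mul_comm, ← Matrix.mul_assoc, hGP, Matrix.one_mul]
  rw [omi, hchar, Matrix.charpoly_diagonal]
  have hroots : (∏ j, (Polynomial.X - Polynomial.C (r j / (1 + r j)))).roots =
      Finset.univ.val.map fun j => r j / (1 + r j) := by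
    have := Polynomial.roots_multiset_prod_X_sub_C
      ((Finset.univ : Finset (Fin k)).val.map fun j => r j / (1 + r j))
    rw [Multiset.map_map] at this
    exact this
  rw [hroots, Multiset.map_map]
  -- The fractions are f = r/(1 + r), whose odds f/(1 - f) are r again.
  refine Multiset.map_congr rfl fun j _ => ?_
  have := hne j
  simp only [Function.comp]
  field_simp
  ring

/-- The two characteristic functions agree, since ‖Lᵀt‖² is the quadratic form of B. No inverse is
used, so `B` may be singular, as happens when some r_j vanish. -/
lemma multivariateGaussian_eq_map {B L : Matrix (Fin k) (Fin k) ℝ} (hB : B.PosSemidef)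
    (hBL : B = L * Lᵀ) :
    multivariateGaussian 0 B = (Measure.pi fun _ : Fin k => gaussianReal 0 1).map
      fun g => (WithLp.toLp 2 (L *ᵥ g) : EuclideanSpace ℝ (Fin k)) := by
  have hc : Continuous fun g : Fin k → ℝ => (WithLp.toLp 2 (L *ᵥ g) : EuclideanSpace ℝ (Fin k)) :=
    (PiLp.continuous_toLp 2 _).comp (continuous_const.matrix_mulVec continuous_id)
  have : IsProbabilityMeasure ((Measure.pi fun _ : Fin k => gaussianReal 0 1).map
      fun g => (WithLp.toLp 2 (L *ᵥ g) : EuclideanSpace ℝ (Fin k))) :=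
    Measure.isProbabilityMeasure_map hc.measurable.aemeasurable
  refine Measure.ext_of_charFun (funext fun t => ?_)
  rw [charFun_multivariateGaussian hB, charFun_apply, integral_map hc.measurable.aemeasurable
    (Continuous.aestronglyMeasurable (by fun_prop))]
  have h1 : ∀ g : Fin k → ℝ, inner ℝ (WithLp.toLp 2 (L *ᵥ g) : EuclideanSpace ℝ (Fin k)) t =
      inner ℝ (WithLp.toLp 2 g : EuclideanSpace ℝ (Fin k)) (WithLp.toLp 2 (Lᵀ *ᵥ t.ofLp)) := by
    intro g
    simp only [EuclideanSpace.inner_eq_star_dotProduct, star_trivial]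
    rw [Matrix.dotProduct_mulVec, Matrix.mulVec_transpose]
  simp_rw [h1]
  have h2 := charFun_stdGaussian (WithLp.toLp 2 (Lᵀ *ᵥ t.ofLp) : EuclideanSpace ℝ (Fin k))
  rw [← map_pi_eq_stdGaussian, charFun_apply, integral_map
    (WithLp.measurable_toLp 2 _).aemeasurable (Continuous.aestronglyMeasurable (by fun_prop))] at h2
  rw [h2, inner_zero_right, Complex.ofReal_zero, zero_mul, zero_sub, ← Complex.ofReal_pow,
    EuclideanSpace.real_norm_sq_eq, hBL, ← Matrix.mulVec_mulVec, Matrix.dotProduct_mulVec,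
    ← Matrix.mulVec_transpose]
  congr 1
  rw [neg_div]
  congr 3
  simp [dotProduct, pow_two]

lemma map_curry_pi_gaussian : (Measure.pi fun _ : Fin m × Fin k => gaussianReal 0 1).map
      (fun x (ℓ : Fin m) (j : Fin k) => x (ℓ, j)) =
    Measure.pi fun _ : Fin m => Measure.pi fun _ : Fin k => gaussianReal 0 1 := by
  have := Measure.infinitePi_map_curry (fun (_ : Fin m) (_ : Fin k) => gaussianReal 0 1)
  simp only [Measure.infinitePi_eq_pi] at this
  exact this

/-- Linear image of a Gaussian array, row by row. -/
def rowMap (L : Matrix (Fin k) (Fin k) ℝ) (x : Fin m × Fin k → ℝ) :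
    PiLp 2 fun _ : Fin m => EuclideanSpace ℝ (Fin k) :=
  WithLp.toLp 2 fun ℓ => WithLp.toLp 2 (L *ᵥ fun j => x (ℓ, j))

lemma measurable_rowMap (L : Matrix (Fin k) (Fin k) ℝ) : Measurable (rowMap (m := m) L) := by
  refine (WithLp.measurable_toLp 2 _).comp (measurable_pi_lambda _ fun ℓ =>
    (WithLp.measurable_toLp 2 _).comp ?_)
  exact (continuous_const.matrix_mulVec (continuous_pi fun j => continuous_apply (ℓ, j))).measurable

lemma pi_multivariateGaussian_eq_map {B L : Matrix (Fin k) (Fin k) ℝ} (hB : B.PosSemidef)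
    (hBL : B = L * Lᵀ) :
    (Measure.pi fun _ : Fin m => multivariateGaussian 0 B).map (WithLp.toLp 2) =
      (Measure.pi fun _ : Fin m × Fin k => gaussianReal 0 1).map (rowMap L) := by
  have hf : Measurable fun g : Fin k → ℝ =>
      (WithLp.toLp 2 (L *ᵥ g) : EuclideanSpace ℝ (Fin k)) :=
    ((PiLp.continuous_toLp 2 _).comp (continuous_const.matrix_mulVec continuous_id)).measurable
  have : IsProbabilityMeasure ((Measure.pi fun _ : Fin k => gaussianReal 0 1).map
      fun g => (WithLp.toLp 2 (L *ᵥ g) : EuclideanSpace ℝ (Fin k))) :=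
    Measure.isProbabilityMeasure_map hf.aemeasurable
  have hF : Measurable fun (x : Fin m → Fin k → ℝ) (ℓ : Fin m) =>
      (WithLp.toLp 2 (L *ᵥ x ℓ) : EuclideanSpace ℝ (Fin k)) :=
    measurable_pi_lambda _ fun ℓ => hf.comp (measurable_pi_apply ℓ)
  have hcur : Measurable fun (x : Fin m × Fin k → ℝ) (ℓ : Fin m) (j : Fin k) => x (ℓ, j) :=
    measurable_pi_lambda _ fun ℓ => measurable_pi_lambda _ fun j => measurable_pi_apply (ℓ, j)
  rw [multivariateGaussian_eq_map hB hBL, ← Measure.pi_map_pi (fun _ => hf.aemeasurable),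
    ← map_curry_pi_gaussian, Measure.map_map hF hcur,
    Measure.map_map (WithLp.measurable_toLp 2 _) (hF.comp hcur)]
  rfl

/-- Row centring commutes with the linear map, and the factors `G` cancel against V⁻¹. Only the
diagonal weights √r_j survive, squared. -/
lemma jackLim_rowMap {V G : Matrix (Fin k) (Fin k) ℝ} {r : Fin k → ℝ} (hr : ∀ j, 0 ≤ r j)
    (hG : IsUnit G.det) (hVG : V = G * Gᵀ) (x : Fin m × Fin k → ℝ) (ℓ : Fin m) :
    jackLim V (rowMap (G * Matrix.diagonal fun j => Real.sqrt (r j)) x) ℓ =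
      (m : ℝ) / (m - 1) * MvPolynomial.eval x (crossT r 1 ℓ ℓ) := by
  set D := Matrix.diagonal fun j => Real.sqrt (r j) with hD
  set z : Fin k → ℝ := fun j => x (ℓ, j) - (m : ℝ)⁻¹ * ∑ b, x (b, j) with hz
  have e : (fun j => rowMap (G * D) x ℓ j - (m : ℝ)⁻¹ * ∑ a, rowMap (G * D) x a j) =
      (G * D) *ᵥ z := by
    have hzz : z = (fun j => x (ℓ, j)) - (m : ℝ)⁻¹ • ∑ b, fun j => x (b, j) := by
      funext j
      simp [hz]
    rw [hzz, Matrix.mulVec_sub, Matrix.mulVec_smul, Matrix.mulVec_sum]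
    funext j
    simp [rowMap]
  have hGT : IsUnit Gᵀ.det := by rwa [Matrix.det_transpose]
  have h1 : V⁻¹ *ᵥ ((G * D) *ᵥ z) = Gᵀ⁻¹ *ᵥ (D *ᵥ z) := by
    rw [hVG, Matrix.mul_inv_rev, Matrix.mulVec_mulVec, Matrix.mulVec_mulVec, Matrix.mul_assoc,
      ← Matrix.mul_assoc G⁻¹, Matrix.nonsing_inv_mul _ hG, Matrix.one_mul]
  rw [jackLim, e, h1, eval_crossT, ← Matrix.mulVec_mulVec, Matrix.dotProduct_mulVec,
    ← Matrix.mulVec_transpose, Matrix.mulVec_mulVec]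
  have h2 : Gᵀ⁻¹ᵀ * G = 1 := by
    rw [Matrix.transpose_nonsing_inv, Matrix.transpose_transpose, Matrix.nonsing_inv_mul _ hG]
  rw [h2, Matrix.one_mulVec]
  congr 1
  simp only [hD, Matrix.mulVec_diagonal, dotProduct]
  refine Finset.sum_congr rfl fun j _ => ?_
  have := Real.mul_self_sqrt (hr j)
  calc _ = Real.sqrt (r j) * Real.sqrt (r j) * (z j * z j) := by ring
    _ = _ := by rw [this, pow_two]

end Diagonalization

/-! ### Assembly -/

section PowerSums

variable {k : ℕ}

lemma powerSum_map (r : Fin k → ℝ) : powerSum (Finset.univ.val.map r) = psum r := by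
  funext τ
  rw [powerSum, Multiset.map_map]
  rfl

lemma omiVar_map (hk : 1 ≤ k) (r : Fin k → ℝ) :
    omiVar k (Finset.univ.val.map r) = psum r 2 / k - psum r 1 ^ 2 / k ^ 2 := by
  have hk0 : (k : ℝ) ≠ 0 := by positivity
  have hmean : omiMean k (Finset.univ.val.map r) = psum r 1 / k := by
    simp only [omiMean, psum, pow_one]
    rfl
  have h1 : ((Finset.univ.val.map r).map fun x => (x - psum r 1 / k) ^ 2).sum =
      ∑ j, (r j - psum r 1 / k) ^ 2 := by
    rw [Multiset.map_map]
    rfl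
  have h2 : ∑ j, (r j - psum r 1 / k) ^ 2 =
      psum r 2 - 2 * (psum r 1 / k) * psum r 1 + k * (psum r 1 / k) ^ 2 := by
    simp only [sub_sq, Finset.sum_add_distrib, Finset.sum_sub_distrib, Finset.sum_const,
      Finset.card_univ, Fintype.card_fin, nsmul_eq_mul, ← Finset.sum_mul]
    have : ∑ j, 2 * r j = 2 * psum r 1 := by simp [psum, Finset.mul_sum]
    rw [this]
    simp only [psum]
    ring
  rw [omiVar, hmean, h1, h2]
  field_simp
  ring

end PowerSums

/-! ### Order of the remainder in the limiting variance -/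

section Remainder

/-- With x = 1/m, the difference divided by x is a rational function F of x that is continuous at 0.
The leading term is exactly what makes F vanish there. -/
lemma isLittleO_exactVar_sub_leadVar {k : ℝ} (hk : k ≠ 0) (R : ℕ → ℝ) :
    (fun m' : ℕ => exactVar k m' R - leadVar k m' R) =o[atTop] fun m' : ℕ => 1 / (m' : ℝ) := by
  set N : ℝ → ℝ := fun x =>
    2 * ((1 - x) ^ 2 * (3 - 7 * x) * k ^ 2 - 4 * x ^ 2 * (1 - x) * k - 4 * x ^ 3) * R 4
      - 8 * (1 - x) ^ 2 * (1 - 2 * x) * k * (R 3 * R 1)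
      + (1 - 2 * x) * ((1 - x) ^ 2 * k ^ 2 + 4 * x * (1 - x) * k + 4 * x) * R 2 ^ 2
      + 4 * (1 - x) ^ 2 * (1 - 2 * x) * (R 1 ^ 2 * R 2) with hN
  set F : ℝ → ℝ := fun x => 2 / k ^ 4 * (N x / ((1 - x) ^ 3 * (1 - 2 * x)) - N 0) with hF
  have hFc : ContinuousAt F 0 := by
    have hNc : ContinuousAt N 0 := by fun_prop
    have hD : ContinuousAt (fun x : ℝ => (1 - x) ^ 3 * (1 - 2 * x)) 0 := by fun_prop
    exact continuousAt_const.mul ((hNc.div hD (by norm_num)).sub continuousAt_const)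
  have hF0 : F 0 = 0 := by simp [hF]
  have hlim : Tendsto (fun m' : ℕ => F (m' : ℝ)⁻¹) atTop (𝓝 0) := by
    have := hFc.tendsto.comp (tendsto_inv_atTop_zero.comp (tendsto_natCast_atTop_atTop (R := ℝ)))
    rwa [hF0] at this
  rw [Asymptotics.isLittleO_iff_tendsto']
  · refine hlim.congr' ?_
    filter_upwards [eventually_ge_atTop 3] with m' hm'
    have hm : (3 : ℝ) ≤ m' := by exact_mod_cast hm'
    generalize (m' : ℝ) = t at hm
    have h0 : t ≠ 0 := by linarith
    have h1 : t - 1 ≠ 0 := by linarith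
    have h2 : t - 2 ≠ 0 := by linarith
    have e1 : 1 - t⁻¹ = (t - 1) / t := by field_simp
    have e2 : 1 - 2 * t⁻¹ = (t - 2) / t := by field_simp
    simp only [hF, hN, exactVar, leadVar, e1, e2]
    field_simp
    ring
  · filter_upwards [eventually_ge_atTop 1] with m' hm' h0
    have : (m' : ℝ) ≠ 0 := by positivity
    simp [this] at h0

end Remainder

/-! ### Polynomial growth of the variance estimator -/

section Growth

variable {k m : ℕ}

lemma continuous_sigmaFn : Continuous (sigmaFn k m) := by
  unfold sigmaFn
  fun_prop

/-- Two uses of Cauchy–Schwarz bound the quadratic by ∑ t² and its square by ∑ t⁴. The inequality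
|s| ≤ 1 + s² lets a single constant serve both. -/
lemma exists_sigmaFn_bound (k m : ℕ) : ∃ K : ℝ, 0 ≤ K ∧
    (∀ t, |sigmaFn k m t| ≤ K * (1 + ∑ ℓ, t ℓ ^ 4)) ∧
      ∀ t, |sigmaFn k m t ^ 2| ≤ K * (1 + ∑ ℓ, t ℓ ^ 4) := by
  set a : ℝ := ((k : ℝ) * (m - 1) + 2) * (m : ℝ)⁻¹ / (2 * (k : ℝ) ^ 2 * (m - 2)) with ha
  set b : ℝ := ((m : ℝ) - 1) * (k + 2) * ((m : ℝ)⁻¹) ^ 2 / (2 * (k : ℝ) ^ 2 * (m - 2)) with hb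
  have hs : ∀ t, sigmaFn k m t = a * ∑ ℓ, t ℓ ^ 2 - b * (∑ ℓ, t ℓ) ^ 2 := by
    intro t
    rw [sigmaFn, ha, hb]
    ring
  set C : ℝ := |a| + |b| * m with hC
  have hC0 : 0 ≤ C := by positivity
  have h1 : ∀ t, |sigmaFn k m t| ≤ C * ∑ ℓ, t ℓ ^ 2 := by
    intro t
    have hcs : (∑ ℓ, t ℓ) ^ 2 ≤ m * ∑ ℓ, t ℓ ^ 2 := by
      simpa using sq_sum_le_card_mul_sum_sq (s := (Finset.univ : Finset (Fin m))) (f := t)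
    have hnn : 0 ≤ ∑ ℓ, t ℓ ^ 2 := Finset.sum_nonneg fun _ _ => sq_nonneg _
    rw [hs]
    calc _ ≤ |a * ∑ ℓ, t ℓ ^ 2| + |b * (∑ ℓ, t ℓ) ^ 2| := abs_sub _ _
      _ = |a| * ∑ ℓ, t ℓ ^ 2 + |b| * (∑ ℓ, t ℓ) ^ 2 := by
          rw [abs_mul, abs_mul, abs_of_nonneg hnn, abs_of_nonneg (sq_nonneg (∑ ℓ, t ℓ))]
      _ ≤ |a| * ∑ ℓ, t ℓ ^ 2 + |b| * (m * ∑ ℓ, t ℓ ^ 2) := by gcongr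
      _ = _ := by rw [hC]; ring
  have h2 : ∀ t, sigmaFn k m t ^ 2 ≤ C ^ 2 * m * ∑ ℓ, t ℓ ^ 4 := by
    intro t
    have hcs : (∑ ℓ, t ℓ ^ 2) ^ 2 ≤ m * ∑ ℓ, t ℓ ^ 4 := by
      have := sq_sum_le_card_mul_sum_sq (s := (Finset.univ : Finset (Fin m))) (f := fun ℓ => t ℓ ^ 2)
      simpa [← pow_mul] using this
    calc sigmaFn k m t ^ 2 = |sigmaFn k m t| ^ 2 := (sq_abs _).symm
      _ ≤ (C * ∑ ℓ, t ℓ ^ 2) ^ 2 := by gcongr; exact h1 t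
      _ = C ^ 2 * (∑ ℓ, t ℓ ^ 2) ^ 2 := by ring
      _ ≤ C ^ 2 * (m * ∑ ℓ, t ℓ ^ 4) := by gcongr
      _ = _ := by ring
  have h4 : ∀ t : Fin m → ℝ, 0 ≤ ∑ ℓ, t ℓ ^ 4 := fun t =>
    Finset.sum_nonneg fun _ _ => by positivity
  have hK : 0 ≤ C ^ 2 * m := by positivity
  refine ⟨1 + C ^ 2 * m, by positivity, fun t => ?_, fun t => ?_⟩
  · have h3 : |sigmaFn k m t| ≤ 1 + sigmaFn k m t ^ 2 := by
      nlinarith [sq_nonneg (|sigmaFn k m t| - 1), sq_abs (sigmaFn k m t)]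
    nlinarith [h2 t, h4 t]
  · rw [abs_of_nonneg (sq_nonneg _)]
    nlinarith [h2 t, h4 t]

end Growth

/-! ### Convergence of the moments of the jackknife statistics -/

namespace MIProblem

variable {p k h m : ℕ} {Q : MIProblem p k h m} {d : Device}
  {Jcom Jmis : Matrix (Fin k ⊕ Fin h) (Fin k ⊕ Fin h) ℝ}

lemma sum_jackknife {M : Type*} [AddCommMonoid M]
    (f : Finset (Fin m) × Finset (Fin m) → M) :
    ∑ S ∈ jackknife m, f S = ∑ ℓ : Fin m, f ({ℓ}, {ℓ}ᶜ) := by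
  rw [jackknife, Finset.sum_image]
  intro a _ b _ hab
  exact Finset.singleton_injective (Prod.mk.inj hab).1

lemma sigmaHatSq_jackknife (n : ℕ) (ω : Q.Ω n) :
    Q.sigmaHatSq d (jackknife m) n ω = sigmaFn k m fun ℓ => Q.smi d {ℓ} {ℓ}ᶜ n ω := by
  have hcard : (jackknife m).card = m := by
    have := sum_jackknife (m := m) fun _ => (1 : ℕ)
    simpa using this
  rw [sigmaHatSq, tHat, tHat, hcard, sum_jackknife, sum_jackknife, sigmaFn]
  simp only [pow_one]

lemma compl_singleton_nonempty (hm : 2 ≤ m) (ℓ : Fin m) : ({ℓ}ᶜ : Finset (Fin m)).Nonempty := by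
  rw [← Finset.card_pos, Finset.card_compl, Finset.card_singleton, Fintype.card_fin]
  omega

lemma measurable_smi (hreg : Q.Regular d Jcom Jmis) {S₁ S₂ : Finset (Fin m)} (h₁ : S₁.Nonempty)
    (h₂ : S₂.Nonempty) (n : ℕ) : Measurable (Q.smi d S₁ S₂ n) := by
  have hne : ∀ {S : Finset (Fin m)}, S.Nonempty → S.val ≠ 0 := fun hS => by
    rw [Ne, Finset.val_eq_zero]
    exact hS.ne_empty
  have hd : ∀ {S : Multiset (Fin m)}, S ≠ 0 → Measurable (Q.dHat d S n) := fun hS =>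
    (hreg.measurable_device n _ hS).div_const _
  have h12 : S₁.val + S₂.val ≠ 0 := fun h0 => hne h₁ (add_eq_zero.1 h0).1
  exact ((((hd (hne h₁)).const_mul _).add ((hd (hne h₂)).const_mul _)).sub
    ((hd h12).const_mul _)).const_mul _

lemma UnifIntegrableSMI.uiFour (hm : 2 ≤ m) (hui : Q.UnifIntegrableSMI d 2) (ℓ : Fin m) :
    UIFour Q.P fun n ω => Q.smi d {ℓ} {ℓ}ᶜ n ω :=
  hui {ℓ} {ℓ}ᶜ (Finset.singleton_nonempty ℓ) (compl_singleton_nonempty hm ℓ)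
    (fun h => by
      have h1 : ℓ ∈ ({ℓ}ᶜ : Finset (Fin m)) := h ▸ Finset.mem_singleton_self ℓ
      simp at h1)

/-- Moments of continuous functions of at most quartic growth of the jackknife statistics. -/
theorem tendsto_integral_jackknife (hm : 3 ≤ m) (hreg : Q.Regular d Jcom Jmis)
    (hloc : Q.LocalAlternative) (himp : Q.ProperImputation Jcom Jmis)
    (hui : Q.UnifIntegrableSMI d 2) {r : Fin k → ℝ} {G : Matrix (Fin k) (Fin k) ℝ}
    (hr : ∀ j, 0 ≤ r j) (hG : IsUnit G.det) (hVG : thetaVar Jcom = G * Gᵀ)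
    (hBG : thetaVar (Jcom - Jmis) - thetaVar Jcom = G * Matrix.diagonal r * Gᵀ)
    {H : (Fin m → ℝ) → ℝ} (hH : Continuous H) {K : ℝ} (hK : 0 ≤ K)
    (hHK : ∀ t, |H t| ≤ K * (1 + ∑ ℓ, t ℓ ^ 4)) {F : MvPolynomial (Fin m × Fin k) ℝ}
    (hF : ∀ x, H (fun ℓ => (m : ℝ) / (m - 1) * MvPolynomial.eval x (crossT r 1 ℓ ℓ)) =
      MvPolynomial.eval x F) :
    Tendsto (fun n => ∫ ω, H (fun ℓ => Q.smi d {ℓ} {ℓ}ᶜ n ω) ∂Q.P n) atTop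
      (𝓝 (gaussE (Fin m × Fin k) F)) := by
  set L := G * Matrix.diagonal fun j => Real.sqrt (r j) with hL
  have hBL : thetaVar (Jcom - Jmis) - thetaVar Jcom = L * Lᵀ := by
    have hd : Matrix.diagonal r = (Matrix.diagonal fun j => Real.sqrt (r j)) *
        Matrix.diagonal fun j => Real.sqrt (r j) := by
      rw [Matrix.diagonal_mul_diagonal]
      congr 1
      funext j
      exact (Real.mul_self_sqrt (hr j)).symm
    rw [hBG, hL, Matrix.transpose_mul, Matrix.diagonal_transpose, hd]
    simp only [Matrix.mul_assoc]
  set ν := (Measure.pi fun _ : Fin m =>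
    multivariateGaussian 0 (thetaVar (Jcom - Jmis) - thetaVar Jcom)).map (WithLp.toLp 2) with hν
  have hνL : ν = (Measure.pi fun _ : Fin m × Fin k => gaussianReal 0 1).map (rowMap L) :=
    pi_multivariateGaussian_eq_map himp.posSemidef hBL
  have hνP : IsProbabilityMeasure ν :=
    Measure.isProbabilityMeasure_map (WithLp.measurable_toLp 2 _).aemeasurable
  have hcont : Continuous fun y => H (jackLim (m := m) (thetaVar Jcom) y) :=
    hH.comp (continuous_jackLim _)
  have heval : ∀ x, H (jackLim (thetaVar Jcom) (rowMap L x)) = MvPolynomial.eval x F := by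
    intro x
    rw [← hF]
    congr 1
    funext ℓ
    exact jackLim_rowMap hr hG hVG x ℓ
  have hint : Integrable (fun y => H (jackLim (m := m) (thetaVar Jcom) y)) ν := by
    rw [hνL, integrable_map_measure hcont.aestronglyMeasurable (measurable_rowMap L).aemeasurable]
    refine (integrable_eval_gaussian F).congr (Eventually.of_forall fun x => ?_)
    exact (heval x).symm
  have hval : ∫ y, H (jackLim (m := m) (thetaVar Jcom) y) ∂ν = gaussE (Fin m × Fin k) F := by
    rw [hνL, integral_map (measurable_rowMap L).aemeasurable hcont.aestronglyMeasurable]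
    simp_rw [heval]
    rfl
  rw [← hval]
  refine tendsto_integral_of_uiFour (Y := Q.noiseVec)
    (fun n => measurable_pi_lambda _ fun ℓ => measurable_smi hreg (Finset.singleton_nonempty ℓ)
      (compl_singleton_nonempty (by omega) ℓ) n)
    (fun n => Q.measurable_noiseVec hreg.measurable_thetaImp n)
    (fun g => tendsto_noiseVec hreg.measurable_thetaImp himp.condIndep himp.normality g)
    (continuous_jackLim _) (fun ε hε => tendsto_smi_sub_jackLim (by omega) hreg hloc hε)
    (fun ℓ => hui.uiFour (by omega) ℓ) hH hK hHK hint

lemma memLp_sigmaHatSq (hm : 3 ≤ m) (hreg : Q.Regular d Jcom Jmis)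
    (hui : Q.UnifIntegrableSMI d 2) {n : ℕ} (hn : 1 ≤ n) :
    MemLp (Q.sigmaHatSq d (jackknife m) n) 2 (Q.P n) := by
  obtain ⟨K, hK, -, hK2⟩ := exists_sigmaFn_bound k m
  have hT : ∀ (ℓ : Fin m) n, Measurable (Q.smi d {ℓ} {ℓ}ᶜ n) := fun ℓ n =>
    measurable_smi hreg (Finset.singleton_nonempty ℓ) (compl_singleton_nonempty (by omega) ℓ) n
  have hmeas : Measurable fun ω => sigmaFn k m fun ℓ => Q.smi d {ℓ} {ℓ}ᶜ n ω :=
    continuous_sigmaFn.measurable.comp (measurable_pi_lambda _ fun ℓ => hT ℓ n)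
  have he : Q.sigmaHatSq d (jackknife m) n = fun ω => sigmaFn k m fun ℓ => Q.smi d {ℓ} {ℓ}ᶜ n ω :=
    funext fun ω => sigmaHatSq_jackknife n ω
  rw [he, memLp_two_iff_integrable_sq hmeas.aestronglyMeasurable]
  have hi : Integrable (fun ω => K * (1 + ∑ ℓ, Q.smi d {ℓ} {ℓ}ᶜ n ω ^ 4)) (Q.P n) :=
    ((integrable_const 1).add (integrable_finsetSum _ fun ℓ _ =>
      (hui.uiFour (by omega) ℓ).integrable (hT ℓ) hn)).const_mul K
  refine hi.mono' (hmeas.pow_const 2).aestronglyMeasurable (Eventually.of_forall fun ω => ?_)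
  exact hK2 _

end MIProblem

open MIProblem in
/-- Limiting mean and variance of the bias-corrected estimator. -/
theorem tendsto_mean_variance_sigmaHatSq {p k h m : ℕ} (hk : 1 ≤ k) (hm : 3 ≤ m) (Q : MIProblem p k h m)
    (Jcom Jmis : Matrix (Fin k ⊕ Fin h) (Fin k ⊕ Fin h) ℝ) (d : Device)
    (hreg : Q.Regular d Jcom Jmis)
    (hloc : Q.LocalAlternative)
    (himp : Q.ProperImputation Jcom Jmis)
    (hui : Q.UnifIntegrableSMI d 2) :
    Tendsto (fun n : ℕ => ∫ ω, Q.sigmaHatSq d (jackknife m) n ω ∂Q.P n) atTop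
      (𝓝 (omiVar k (omi Jcom Jmis))) ∧
    Tendsto (fun n : ℕ => variance (Q.sigmaHatSq d (jackknife m) n) (Q.P n)) atTop
        (𝓝 (exactVar k m (powerSum (omi Jcom Jmis)))) := by
  obtain ⟨G, r, hr, hG, hVG, hBG⟩ := exists_simultaneous_diagonalization
    (posDef_thetaVar hreg.posDef_com) himp.posSemidef
  have homi := omi_eq_map (posDef_thetaVar hreg.posDef_com) (posDef_thetaVar hreg.posDef_obs)
    hr hG hVG hBG
  obtain ⟨K, hK, hK1, hK2⟩ := exists_sigmaFn_bound k m
  have hE := isGaussFunctional_gaussE (ι := Fin m × Fin k)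
  have h1 := tendsto_integral_jackknife hm hreg hloc himp hui hr hG hVG hBG continuous_sigmaFn hK
    hK1 (F := sLim r) fun x => (eval_sLim hm r x).symm
  have h2 := tendsto_integral_jackknife hm hreg hloc himp hui hr hG hVG hBG
    (H := fun t => sigmaFn k m t ^ 2) (continuous_sigmaFn.pow 2) hK hK2 (F := sLim r ^ 2) fun x => by
      rw [map_pow, eval_sLim hm r x]
  rw [hE.sLim_mean r hm hk] at h1
  rw [hE.sLim_sq r hm hk] at h2
  simp_rw [← sigmaHatSq_jackknife] at h1 h2
  rw [homi, omiVar_map hk, powerSum_map]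
  refine ⟨h1, ?_⟩
  -- The squared mean built into `sLim_sq` cancels here and leaves `exactVar`.
  have h3 := h2.sub (h1.pow 2)
  rw [add_sub_cancel_right] at h3
  refine h3.congr' ?_
  -- The variance is second moment minus squared mean only under square integrability, which is
  -- known for n ≥ 1.
  filter_upwards [eventually_ge_atTop 1] with n hn
  rw [variance_eq_sub (memLp_sigmaHatSq hm hreg hui hn)]
  rfl

end StackedMI

end

open StackedMI in
theorem mainTheorem8 {p k h m : ℕ} (hk : 1 ≤ k) (hm : 3 ≤ m) (Q : MIProblem p k h m)
    (Jcom Jmis : Matrix (Fin k ⊕ Fin h) (Fin k ⊕ Fin h) ℝ) (d : Device)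
    (hreg : Q.Regular d Jcom Jmis)
    (hloc : Q.LocalAlternative)
    (hobs : Q.ObsNormality Jcom Jmis)
    (himp : Q.ProperImputation Jcom Jmis)
    (hui : Q.UnifIntegrableSMI d 2) :
    (∀ n : ℕ, 1 ≤ n → MemLp (Q.sigmaHatSq d (jackknife m) n) 2 (Q.P n)) ∧
    Tendsto (fun n : ℕ => ∫ ω, Q.sigmaHatSq d (jackknife m) n ω ∂Q.P n) atTop
      (𝓝 (omiVar k (omi Jcom Jmis))) ∧
    ∃ I : ℕ → ℝ,
      I =o[atTop] (fun m' : ℕ => 1 / (m' : ℝ)) ∧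
      (∀ m' : ℕ, 3 ≤ m' → leadVar k m' (powerSum (omi Jcom Jmis)) + I m' =
        exactVar k m' (powerSum (omi Jcom Jmis))) ∧
      Tendsto (fun n : ℕ => variance (Q.sigmaHatSq d (jackknife m) n) (Q.P n)) atTop
        (𝓝 (leadVar k m (powerSum (omi Jcom Jmis)) + I m)) := by
  obtain ⟨hmean, hvar⟩ := tendsto_mean_variance_sigmaHatSq hk hm Q Jcom Jmis d hreg hloc himp hui
  have hk0 : (k : ℝ) ≠ 0 := by positivity
  refine ⟨fun n hn => MIProblem.memLp_sigmaHatSq hm hreg hui hn, hmean,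
    -- Taking the remainder to be this difference makes the exact identity automatic, so only its
    -- order in m' requires proof.
    fun m' => exactVar k m' (powerSum (omi Jcom Jmis)) - leadVar k m' (powerSum (omi Jcom Jmis)),
    isLittleO_exactVar_sub_leadVar hk0 _, fun m' _ => add_sub_cancel _ _, ?_⟩
  rw [add_sub_cancel]
  exact hvar
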